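/- Fix $d$, learning rates $\tau,\tilde\tau>0$, noise levels $\eta_T,\eta_G\ge 0$, and centred laws $\nu,\tilde\nu$ on $\mathbb{R}^d$ with finite moments of all orders and covariance matrices $\Lambda,\tilde\Lambda$. For every $n\ge d$ let $U,V_0,W_0\in\mathbb{R}^{n\times d}$ be (possibly random) matrices such that $U$ and $W_0$ have orthonormal columns and $V_0$ has columns of unit length, and let $c_k\sim\nu$, $\tilde c_k\sim\tilde\nu$, $a_k,\tilde a_k\sim N(0,I_n)$ $(k\ge 0)$ be independent of each other and of $(U,V_0,W_0)$. Put $$y_k=Uc_k+\sqrt{\eta_T}\,a_k,\qquad \tilde y_k(V)=V\tilde c_k+\sqrt{\eta_G}\,\tilde a_k,\qquad \ell_k(V,W)=F(\|y_k^TW\|)-F(\|\tilde y_k(V)^TW\|),\quad F(x)=\tfrac{x^2}{2}.$$ Add to $\ell_k$ the regularizer $-\frac{\lambda}{2}\mathrm{tr}\,H(W^TW)+\frac{\lambda}{2}\mathrm{tr}\,H(V^TV)$, with $H(A)=\log\cosh(A-I)$ elementwise, and let $\lambda\to\infty$: the generator is confined to the zero set $\{V:\mathrm{tr}\,H(V^TV)=0\}$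 of the penalty (columns of unit length), and the discriminator is required to have orthonormal columns, $W^TW=I_d$. In this regime online SGD is $$V_{k+1}=\Pi_V\Big(V_k-\tfrac{\tilde\tau}{n}\nabla_V\ell_k(V_k,W_k)\Big),\qquad W_{k+1}=\Pi_W\Big(W_k+\tfrac{\tau}{n}\nabla_W\ell_k(V_k,W_k)\Big),$$ where $\Pi_V,\Pi_W$ are measurable nearest-point maps (in Frobenius norm) onto these two sets. Let $X_k=[U,V_k,W_k]$ and $$M_k=X_k^TX_k=\begin{bmatrix}I&P_k&Q_k\\P_k^T&S_k&R_k\\Q_k^T&R_k^T&Z_k\end{bmatrix},\quad P_k=U^TV_k,\ Q_k=U^TW_k,\ R_k=V_k^TW_k,\ S_k=V_k^TV_k,\ Z_k=W_k^TW_k .$$ Assume that there are a constant $C_0$ and a deterministic matrix $M_0^*$ such that for all $n\ge d$ $$\mathbb{E}\sum_{l=1}^d\big(U_{il}^4+(V_0)_{il}^4+(W_0)_{il}^4\big)\le \frac{C_0}{n^2}\quad(1\le i\le n),\qquad \mathbb{E}\|M_0-M_0^*\|\le \frac{C_0}{\sqrt n}.$$ Then there is a deterministic function $$M(t)=\begin{bmatrix}I&P_t&Q_t\\P_t^T&S_t&R_t\\Q_t^T&R_t^T&Z_t\end{bmatrix},\qquad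 t\ge 0,$$ which is the unique solution on $[0,\infty)$, with $M(0)=M_0^*$, of $$\begin{aligned} \dot P_t&=\tilde\tau\,(Q_tR_t^T\tilde\Lambda+P_tL_t),\qquad \dot Q_t=\tau\,(\Lambda Q_t-P_t\tilde\Lambda R_t+Q_tH_t),\\ \dot R_t&=\tau\,(P_t^T\Lambda Q_t-S_t\tilde\Lambda R_t+R_tH_t)+\tilde\tau\,(\tilde\Lambda+L_t)R_t,\\ \dot S_t&=\tilde\tau\,(R_tR_t^T\tilde\Lambda+\tilde\Lambda R_tR_t^T+S_tL_t+L_tS_t),\qquad \dot Z_t=0, \end{aligned}$$ where $L_t=-\mathrm{diag}(R_tR_t^T\tilde\Lambda)$ (diagonal part) and $$H_t=\Big(1-\frac{\tau\eta_G}{2}\Big)R_t^T\tilde\Lambda R_t-\Big(1+\frac{\tau\eta_T}{2}\Big)Q_t^T\Lambda Q_t-\tau\,\frac{\eta_G^2+\eta_T^2}{2}\,I,$$ and for every $T>0$ there is a constant $C(T)$, not depending on $n$, such that for all $n\ge d$ $$\max_{0\le k\le nT}\mathbb{E}\,\big\|M_k-M(k/n)\big\|\le\frac{C(T)}{\sqrt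 n}.$$ Norms of matrices are Frobenius norms. -/

import Mathlib

open MeasureTheory ProbabilityTheory Matrix

/-- Matrices carry the product measurable structure of their entries. -/
instance instMeasurableSpaceRealMatrix {m n : Type*} : MeasurableSpace (Matrix m n ℝ) :=
  inferInstanceAs (MeasurableSpace (m → n → ℝ))

namespace GAN

noncomputable section

/-- Frobenius norm of a real matrix. -/
def frobNorm {m n : Type*} [Fintype m] [Fintype n] (A : Matrix m n ℝ) : ℝ :=
  Real.sqrt (∑ i, ∑ j, A i j ^ 2)

/-- The gradient of a scalar function of a matrix: the matrix of its partial derivatives. -/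
def matGrad {m n : Type*} [DecidableEq m] [DecidableEq n]
    (f : Matrix m n ℝ → ℝ) (X : Matrix m n ℝ) : Matrix m n ℝ :=
  Matrix.of fun i j => deriv (fun t : ℝ => f (X + t • Matrix.single i j (1 : ℝ))) 0

/-- The spiked covariance model `y = B c + √η a`. -/
def spiked {n d : ℕ} (B : Matrix (Fin n) (Fin d) ℝ) (η : ℝ) (c : Fin d → ℝ) (a : Fin n → ℝ) :
    Fin n → ℝ :=
  B *ᵥ c + Real.sqrt η • a

/-- `D̂(x) = ‖x‖`, the Euclidean norm. -/
def Dhat {d : ℕ} (x : Fin d → ℝ) : ℝ := ‖WithLp.toLp 2 x‖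

/-- `F(x) = F̂(x) = x² / 2`. -/
def Fout (x : ℝ) : ℝ := x ^ 2 / 2

/-- The multi-feature discriminator `D(y; W) = D̂(yᵀ W)`. -/
def discriminator {n d : ℕ} (y : Fin n → ℝ) (W : Matrix (Fin n) (Fin d) ℝ) : ℝ :=
  Dhat (y ᵥ* W)

/-- The part `F(D̂(yᵀ W)) - F̂(D̂(ỹᵀ W))` of the loss that depends on the data. -/
def dataLoss {n d : ℕ} (y yt : Fin n → ℝ) (W : Matrix (Fin n) (Fin d) ℝ) : ℝ :=
  Fout (discriminator y W) - Fout (discriminator yt W)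

/-- The elementwise regularizer `H(A) = log cosh (A - I)`. -/
def Hreg {d : ℕ} (A : Matrix (Fin d) (Fin d) ℝ) : Matrix (Fin d) (Fin d) ℝ :=
  (A - 1).map fun x => Real.log (Real.cosh x)

/-- The set to which an infinitely strong penalty `tr H(Vᵀ V) ≥ 0` confines the generator:
the zero set of the penalty, i.e. the matrices whose columns have unit length. -/
def genSet (n d : ℕ) : Set (Matrix (Fin n) (Fin d) ℝ) :=
  {V | (Hreg (Vᵀ * V)).trace = 0}

/-- The set to which the discriminator is confined: matrices with orthonormal columns. -/
def discSet (n d : ℕ) : Set (Matrix (Fin n) (Fin d) ℝ) :=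
  {W | Wᵀ * W = 1}

/-- `π` is a measurable nearest-point map onto the set `K`, for the Frobenius distance. -/
def IsProjection {n d : ℕ} (K : Set (Matrix (Fin n) (Fin d) ℝ))
    (π : Matrix (Fin n) (Fin d) ℝ → Matrix (Fin n) (Fin d) ℝ) : Prop :=
  Measurable π ∧ ∀ A, π A ∈ K ∧ ∀ B ∈ K, frobNorm (A - π A) ≤ frobNorm (A - B)

/-- One realization of the training process, in the regime of infinitely strong regularization:
online gradient descent for the generator and ascent for the discriminator, with rates `τt / n` and
`τ / n`, along the data loss of one fresh true sample and one fresh generated sample,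
each step followed by the nearest-point map onto the respective constraint set.
The value at `k` is the pair `(V_k, W_k)`. -/
def train {n d : ℕ} (τ τt ηT ηG : ℝ)
    (πV πW : Matrix (Fin n) (Fin d) ℝ → Matrix (Fin n) (Fin d) ℝ)
    (U V0 W0 : Matrix (Fin n) (Fin d) ℝ)
    (c ct : ℕ → Fin d → ℝ) (a b : ℕ → Fin n → ℝ) :
    ℕ → Matrix (Fin n) (Fin d) ℝ × Matrix (Fin n) (Fin d) ℝ
  | 0 => (V0, W0)
  | k + 1 =>
    let V := (train τ τt ηT ηG πV πW U V0 W0 c ct a b k).1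
    let W := (train τ τt ηT ηG πV πW U V0 W0 c ct a b k).2
    let y := spiked U ηT (c k) (a k)
    (πV (V - (τt / n) • matGrad (fun V' => dataLoss y (spiked V' ηG (ct k) (b k)) W) V),
     πW (W + (τ / n) • matGrad (fun W' => dataLoss y (spiked V ηG (ct k) (b k)) W') W))

/-- Index type of the `3d × 3d` macroscopic state. -/
abbrev MacroIdx (d : ℕ) : Type := Fin d ⊕ (Fin d ⊕ Fin d)

/-- The microscopic state `X = [U, V, W]`. -/
def micro {n d : ℕ} (U V W : Matrix (Fin n) (Fin d) ℝ) : Matrix (Fin n) (MacroIdx d) ℝ :=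
  Matrix.fromCols U (Matrix.fromCols V W)

/-- The macroscopic state `M = Xᵀ X`. -/
def macro3 {n d : ℕ} (U V W : Matrix (Fin n) (Fin d) ℝ) : Matrix (MacroIdx d) (MacroIdx d) ℝ :=
  (micro U V W)ᵀ * micro U V W

/-- The macroscopic matrix with blocks `I, P, Q; Pᵀ, S, R; Qᵀ, Rᵀ, Z`. -/
def blocks {d : ℕ} (P Q R S Z : Matrix (Fin d) (Fin d) ℝ) :
    Matrix (MacroIdx d) (MacroIdx d) ℝ :=
  Matrix.fromBlocks 1 (Matrix.fromCols P Q) (Matrix.fromRows Pᵀ Qᵀ)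
    (Matrix.fromBlocks S R Rᵀ Z)

/-- The blocks of `Xᵀ X` are the overlaps `P = UᵀV`, `Q = UᵀW`, `R = VᵀW`, `S = VᵀV`,
`Z = WᵀW` when `U` has orthonormal columns. -/
theorem macro3_eq_blocks {n d : ℕ} (U V W : Matrix (Fin n) (Fin d) ℝ) (hU : Uᵀ * U = 1) :
    macro3 U V W = blocks (Uᵀ * V) (Uᵀ * W) (Vᵀ * W) (Vᵀ * V) (Wᵀ * W) := by
  ext i j
  rcases i with i | i | i <;> rcases j with j | j | j <;>
    simp [macro3, micro, blocks, Matrix.mul_apply, ← hU, mul_comm]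

/-- `L = -diag(R Rᵀ Λ̃)`, the diagonal part. -/
def Lmat {d : ℕ} (Λt R : Matrix (Fin d) (Fin d) ℝ) : Matrix (Fin d) (Fin d) ℝ :=
  -Matrix.diagonal (R * Rᵀ * Λt).diag

/-- `H = (1 - τ η_G / 2) Rᵀ Λ̃ R - (1 + τ η_T / 2) Qᵀ Λ Q - τ (η_G² + η_T²) / 2 · I`. -/
def Hmat {d : ℕ} (τ ηT ηG : ℝ) (Λ Λt Q R : Matrix (Fin d) (Fin d) ℝ) :
    Matrix (Fin d) (Fin d) ℝ :=
  (1 - τ * ηG / 2) • (Rᵀ * Λt * R) - (1 + τ * ηT / 2) • (Qᵀ * Λ * Q)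
    - (τ * (ηG ^ 2 + ηT ^ 2) / 2) • (1 : Matrix (Fin d) (Fin d) ℝ)

/-- On `[0, ∞)` the matrix function `A` has the entrywise derivative `A'` (one-sided at `0`). -/
def HasMatDeriv {d : ℕ} (A A' : ℝ → Matrix (Fin d) (Fin d) ℝ) : Prop :=
  ∀ t : ℝ, 0 ≤ t → ∀ i j, HasDerivWithinAt (fun s => A s i j) (A' t i j) (Set.Ici 0) t

/-- `M` solves the macroscopic ODE on `[0, ∞)` with initial value `M0`. -/
def IsMacroSolution {d : ℕ} (τ τt ηT ηG : ℝ) (Λ Λt : Matrix (Fin d) (Fin d) ℝ)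
    (M0 : Matrix (MacroIdx d) (MacroIdx d) ℝ)
    (M : ℝ → Matrix (MacroIdx d) (MacroIdx d) ℝ) : Prop :=
  M 0 = M0 ∧ ∃ P Q R S Z : ℝ → Matrix (Fin d) (Fin d) ℝ,
    (∀ t : ℝ, 0 ≤ t → M t = blocks (P t) (Q t) (R t) (S t) (Z t)) ∧
    HasMatDeriv P (fun t => τt • (Q t * (R t)ᵀ * Λt + P t * Lmat Λt (R t))) ∧
    HasMatDeriv Q (fun t =>
      τ • (Λ * Q t - P t * Λt * R t + Q t * Hmat τ ηT ηG Λ Λt (Q t) (R t))) ∧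
    HasMatDeriv R (fun t =>
      τ • ((P t)ᵀ * Λ * Q t - S t * Λt * R t + R t * Hmat τ ηT ηG Λ Λt (Q t) (R t))
        + τt • ((Λt + Lmat Λt (R t)) * R t)) ∧
    HasMatDeriv S (fun t =>
      τt • (R t * (R t)ᵀ * Λt + Λt * R t * (R t)ᵀ + S t * Lmat Λt (R t) + Lmat Λt (R t) * S t)) ∧
    HasMatDeriv Z (fun _ => 0)

/-- `ν` is a centred law on `ℝ^d` with covariance matrix `Λ` and finite moments of all orders. -/
structure IsCentredLaw {d : ℕ} (ν : Measure (Fin d → ℝ)) (Λ : Matrix (Fin d) (Fin d) ℝ) :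
    Prop where
  prob : IsProbabilityMeasure ν
  moments : ∀ p : ℕ, Integrable (fun x => ‖x‖ ^ p) ν
  mean : ∀ i, ∫ x, x i ∂ν = 0
  cov : ∀ i j, ∫ x, x i * x j ∂ν = Λ i j

/-- The standard Gaussian law on `ℝ^n`. -/
def stdGauss (n : ℕ) : Measure (Fin n → ℝ) := Measure.pi fun _ => gaussianReal 0 1

/-- The randomness of the model in dimension `n`. For each `k` the four vectors
`c_k, c̃_k, a_k, ã_k` (here `c k, ct k, a k, b k`) are independent with laws `ν, νt` and twice the
standard Gaussian; the quadruples are independent over `k`; and the whole noise sequence is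
independent of the initial microscopic state. -/
structure IsNoise {n d : ℕ} {Ω : Type*} [MeasurableSpace Ω] (μ : Measure Ω)
    (ν νt : Measure (Fin d → ℝ)) (U V0 W0 : Ω → Matrix (Fin n) (Fin d) ℝ)
    (c ct : ℕ → Ω → Fin d → ℝ) (a b : ℕ → Ω → Fin n → ℝ) : Prop where
  meas_init : Measurable fun ω => (U ω, V0 ω, W0 ω)
  meas_noise : ∀ k, Measurable fun ω => (c k ω, ct k ω, a k ω, b k ω)
  law : ∀ k, μ.map (fun ω => (c k ω, ct k ω, a k ω, b k ω)) =
    ν.prod (νt.prod ((stdGauss n).prod (stdGauss n)))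
  indep_time : iIndepFun (fun k ω => (c k ω, ct k ω, a k ω, b k ω)) μ
  indep_init : IndepFun (fun ω => (U ω, V0 ω, W0 ω))
    (fun ω (k : ℕ) => (c k ω, ct k ω, a k ω, b k ω)) μ

/-- Assumptions on the initial microscopic state in dimension `n`: orthonormal `U`, `V0` and `W0`
in their constraint sets, delocalized rows, and concentration of the macroscopic state
around the deterministic matrix `M0`, with a constant `C` that is the same for all `n`. -/
structure IsInit {n d : ℕ} {Ω : Type*} [MeasurableSpace Ω] (μ : Measure Ω) (C : ℝ)
    (M0 : Matrix (MacroIdx d) (MacroIdx d) ℝ) (U V0 W0 : Ω → Matrix (Fin n) (Fin d) ℝ) :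
    Prop where
  orth : ∀ᵐ ω ∂μ, (U ω)ᵀ * U ω = 1
  gen : ∀ᵐ ω ∂μ, V0 ω ∈ genSet n d
  disc : ∀ᵐ ω ∂μ, W0 ω ∈ discSet n d
  deloc : ∀ i, ∫ ω, ∑ l, (U ω i l ^ 4 + V0 ω i l ^ 4 + W0 ω i l ^ 4) ∂μ ≤ C / (n : ℝ) ^ 2
  conc : ∫ ω, frobNorm (macro3 (U ω) (V0 ω) (W0 ω) - M0) ∂μ ≤ C / Real.sqrt n

end

end GAN

/-!
The proof is a stochastic approximation argument.

*One step.* The generator step is followed by the normalization of the columns, and the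
discriminator step by a polar factor: if `W'` is a nearest matrix with orthonormal columns to `B`,
then `B = W' N` with `N` symmetric and positive semidefinite (`exists_polar_of_nearest`). Expanding
`N` to second order gives the increments of `P`, `Q`, `R`, `S` in closed form, up to an error of
order `n^(-3/2)` (`StepBound.norm_overlap_sub_le`). The second order term of the discriminator is of
the same order `1/n` as the first order terms, since the square of the norm of a sample is of order
`n`; the law of large numbers `|a|² / n ≈ 1` turns it into the terms of `H` that contain `τ η`. The
leading part of the increment is linear in the matrices `y yᵀ`, `ỹ ỹᵀ`, `ỹ c̃ᵀ`, so its mean is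
computed from their means, and it is `1/n` times the right-hand side of the macroscopic equation
(`leadInc_mean`, `hasMean_leadStep`).

*Averaging.* All moments of the noise, as seen through matrices with unit columns, are bounded
uniformly in the dimension (`uniformMoments_noiseSize`). Hence the overlaps follow the averaged
recursion up to a martingale, whose size after `k ≤ n T` steps is of order `√k / n`, and up to the
sum of the errors of the single steps (`exists_integral_driftError_le`). A discrete Gronwall
inequality compares them with the solution of the equation (`exists_integral_macroState_sub_le`).

*The limit.* The right-hand side is cubic, so global existence is not automatic. All overlaps of
matrices with unit columns have entries in `[-1, 1]`. The equation is therefore solved first for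
a bounded, globally Lipschitz field that agrees with the right-hand side on this cube. The
macroscopic states converge to that solution, so it stays in the cube (`norm_le_one_of_tendsto`)
and solves the original equation. Uniqueness holds because the field is continuously
differentiable (`IsFlowLine.eq_of_contDiff`).
-/

namespace GAN

/-! ### Markov recursions driven by independent noise -/

/-- If `X` is independent of the pair `(Y, Z)` and `Y` is independent of `Z`, then the pair
`(X, Y)` is independent of `Z`. -/
theorem indepFun_prodMk_of_indepFun_prodMk {Ω α β γ : Type*} [MeasurableSpace Ω]
    [MeasurableSpace α] [MeasurableSpace β] [MeasurableSpace γ] {μ : Measure Ω}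
    [IsProbabilityMeasure μ] {X : Ω → α} {Y : Ω → β} {Z : Ω → γ} (hX : Measurable X)
    (hY : Measurable Y) (hZ : Measurable Z) (h : IndepFun X (fun ω => (Y ω, Z ω)) μ)
    (h' : IndepFun Y Z μ) : IndepFun (fun ω => (X ω, Y ω)) Z μ := by
  have hXY : IndepFun X Y μ := h.comp measurable_id measurable_fst
  rw [indepFun_iff_map_prod_eq_prod_map_map (hX.prodMk hY).aemeasurable hZ.aemeasurable]
  rw [indepFun_iff_map_prod_eq_prod_map_map hX.aemeasurable (hY.prodMk hZ).aemeasurable] at h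
  rw [indepFun_iff_map_prod_eq_prod_map_map hX.aemeasurable hY.aemeasurable] at hXY
  rw [indepFun_iff_map_prod_eq_prod_map_map hY.aemeasurable hZ.aemeasurable] at h'
  have := Measure.isProbabilityMeasure_map (μ := μ) hX.aemeasurable
  have := Measure.isProbabilityMeasure_map (μ := μ) hY.aemeasurable
  have := Measure.isProbabilityMeasure_map (μ := μ) hZ.aemeasurable
  have key : μ.map (fun ω => ((X ω, Y ω), Z ω)) =
      (μ.map fun ω => (X ω, (Y ω, Z ω))).map MeasurableEquiv.prodAssoc.symm := by
    rw [Measure.map_map (MeasurableEquiv.measurable _) (by fun_prop)]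
    rfl
  rw [key, h, h', hXY, ← Measure.prodAssoc_prod, Measure.map_map (MeasurableEquiv.measurable _)
    (MeasurableEquiv.measurable _)]
  simp

/-- A state driven by fresh noise is a measurable function of the initial state and of the past
noise, hence independent of the present noise. -/
theorem measurable_and_indepFun_of_recursion {Ω S N : Type*} [MeasurableSpace Ω]
    [MeasurableSpace S] [MeasurableSpace N] {μ : Measure Ω} [IsProbabilityMeasure μ]
    {Z : ℕ → Ω → S} {ξ : ℕ → Ω → N} {Φ : S × N → S} (hΦ : Measurable Φ) (hZ0 : Measurable (Z 0))
    (hξ : ∀ k, Measurable (ξ k)) (hind : iIndepFun ξ μ)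
    (hinit : IndepFun (Z 0) (fun ω k => ξ k ω) μ)
    (hrec : ∀ k ω, Z (k + 1) ω = Φ (Z k ω, ξ k ω)) (k : ℕ) :
    Measurable (Z k) ∧ IndepFun (Z k) (ξ k) μ := by
  have hf : ∃ f : S × (Finset.range k → N) → S, Measurable f ∧
      ∀ ω, Z k ω = f (Z 0 ω, fun i => ξ i ω) := by
    induction k with
    | zero => exact ⟨fun p => p.1, measurable_fst, fun ω => rfl⟩
    | succ k ih =>
      obtain ⟨f, hf, hfZ⟩ := ih
      have hsub : ∀ i : Finset.range k, i.1 ∈ Finset.range (k + 1) := fun i =>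
        Finset.mem_range.2 ((Finset.mem_range.1 i.2).trans (Nat.lt_succ_self k))
      refine ⟨fun p => Φ (f (p.1, fun i => p.2 ⟨i.1, hsub i⟩),
        p.2 ⟨k, Finset.self_mem_range_succ k⟩), ?_, fun ω => ?_⟩
      · refine hΦ.comp (Measurable.prodMk (hf.comp (measurable_fst.prodMk ?_)) ?_)
        · exact measurable_pi_lambda _ fun i => (measurable_pi_apply _).comp measurable_snd
        · exact (measurable_pi_apply _).comp measurable_snd
      · rw [hrec, hfZ]
  obtain ⟨f, hf, hfZ⟩ := hf
  have hpast : Measurable fun ω => (fun i : Finset.range k => ξ i ω) :=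
    measurable_pi_lambda _ fun i => hξ _
  have hfun : Z k = f ∘ fun ω => (Z 0 ω, fun i : Finset.range k => ξ i ω) := funext hfZ
  refine ⟨hfun ▸ hf.comp (hZ0.prodMk hpast), ?_⟩
  have h1 : IndepFun (fun ω => (fun i : Finset.range k => ξ i ω)) (ξ k) μ :=
    (hind.indepFun_finset (Finset.range k) {k} (by simp) hξ).comp
      (φ := id) (ψ := fun p : ({k} : Finset ℕ) → N => p ⟨k, Finset.mem_singleton_self k⟩)
      measurable_id (measurable_pi_apply _)
  have h2 : IndepFun (Z 0) (fun ω => ((fun i : Finset.range k => ξ i ω), ξ k ω)) μ :=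
    hinit.comp (φ := id) (ψ := fun x : ℕ → N => ((fun i : Finset.range k => x i), x k))
      measurable_id ((measurable_pi_lambda _ fun i => measurable_pi_apply _).prodMk
        (measurable_pi_apply _))
  have h3 := indepFun_prodMk_of_indepFun_prodMk hZ0 hpast (hξ k) h2 h1
  rw [hfun]
  exact h3.comp hf measurable_id

/-- Tonelli for a function of two independent variables, in the form of a bound. -/
theorem lintegral_le_of_indepFun {Ω S N : Type*} [MeasurableSpace Ω]
    [MeasurableSpace S] [MeasurableSpace N] {μ : Measure Ω} [IsProbabilityMeasure μ]
    {Z : Ω → S} {ξ : Ω → N} (hZ : Measurable Z) (hξ : Measurable ξ) (hind : IndepFun Z ξ μ)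
    {G : Set S} (hG : MeasurableSet G) (hZG : ∀ᵐ ω ∂μ, Z ω ∈ G) {f : S × N → ENNReal}
    (hf : Measurable f) {B : ENNReal} (hB : ∀ s ∈ G, ∫⁻ x, f (s, x) ∂(μ.map ξ) ≤ B) :
    ∫⁻ ω, f (Z ω, ξ ω) ∂μ ≤ B := by
  have := Measure.isProbabilityMeasure_map (μ := μ) hZ.aemeasurable
  have := Measure.isProbabilityMeasure_map (μ := μ) hξ.aemeasurable
  rw [← lintegral_map hf (hZ.prodMk hξ),
    (indepFun_iff_map_prod_eq_prod_map_map hZ.aemeasurable hξ.aemeasurable).1 hind,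
    lintegral_prod _ hf.aemeasurable]
  calc ∫⁻ s, ∫⁻ x, f (s, x) ∂(μ.map ξ) ∂(μ.map Z) ≤ ∫⁻ _, B ∂(μ.map Z) := by
        refine lintegral_mono_ae ?_
        filter_upwards [(ae_map_iff hZ.aemeasurable hG).2 hZG] with s hs using hB s hs
    _ = B := by simp

/-- `E[φ(Z) g(Z, ξ)] = 0` when `ξ` is independent of `(Z, φ)` and `g(s, ·)` is centred. -/
theorem integral_mul_eq_zero_of_indepFun {Ω S N : Type*} [MeasurableSpace Ω]
    [MeasurableSpace S] [MeasurableSpace N] {μ : Measure Ω} [IsProbabilityMeasure μ]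
    {Z : Ω → S} {ξ : Ω → N} (hZ : Measurable Z) (hξ : Measurable ξ) (hind : IndepFun Z ξ μ)
    {G : Set S} (hG : MeasurableSet G) (hZG : ∀ᵐ ω ∂μ, Z ω ∈ G) {φ : S → ℝ} (hφ : Measurable φ)
    {g : S × N → ℝ} (hg : Measurable g)
    (hint : Integrable (fun ω => φ (Z ω) * g (Z ω, ξ ω)) μ)
    (h0 : ∀ s ∈ G, ∫ x, g (s, x) ∂(μ.map ξ) = 0) :
    ∫ ω, φ (Z ω) * g (Z ω, ξ ω) ∂μ = 0 := by
  have := Measure.isProbabilityMeasure_map (μ := μ) hZ.aemeasurable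
  have := Measure.isProbabilityMeasure_map (μ := μ) hξ.aemeasurable
  have hF : Measurable fun p : S × N => φ p.1 * g p := (hφ.comp measurable_fst).mul hg
  have hlaw := (indepFun_iff_map_prod_eq_prod_map_map hZ.aemeasurable hξ.aemeasurable).1 hind
  have hint' : Integrable (fun p : S × N => φ p.1 * g p) ((μ.map Z).prod (μ.map ξ)) := by
    rw [← hlaw]
    exact (integrable_map_measure hF.aestronglyMeasurable (hZ.prodMk hξ).aemeasurable).2 hint
  have hmap := integral_map (μ := μ) (hZ.prodMk hξ).aemeasurable
    (f := fun p : S × N => φ p.1 * g p) hF.aestronglyMeasurable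
  rw [← hmap, hlaw, integral_prod _ hint']
  refine integral_eq_zero_of_ae ?_
  filter_upwards [(ae_map_iff hZ.aemeasurable hG).2 hZG] with s hs
  simp only [Pi.zero_apply]
  rw [integral_const_mul, h0 s hs, mul_zero]

theorem integral_sq_le_of_lintegral_le {Ω : Type*} [MeasurableSpace Ω] {μ : Measure Ω}
    {f : Ω → ℝ} (hf : AEStronglyMeasurable f μ) {B : ℝ} (hB : 0 ≤ B)
    (h : ∫⁻ ω, ENNReal.ofReal (f ω ^ 2) ∂μ ≤ ENNReal.ofReal B) :
    MemLp f 2 μ ∧ ∫ ω, f ω ^ 2 ∂μ ≤ B := by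
  have hint : Integrable (fun ω => f ω ^ 2) μ :=
    (lintegral_ofReal_ne_top_iff_integrable (hf.pow 2) (ae_of_all _ fun _ => sq_nonneg _)).1
      (h.trans_lt ENNReal.ofReal_lt_top).ne
  refine ⟨(memLp_two_iff_integrable_sq hf).2 hint, ?_⟩
  rw [integral_eq_lintegral_of_nonneg_ae (ae_of_all _ fun _ => sq_nonneg _) (hf.pow 2)]
  exact ENNReal.toReal_le_of_le_ofReal hB h

/-- The second moments of a sum of centred increments `D(Z_j, ξ_j)` add up, because the increments
are orthogonal in `L²`. -/
theorem integral_sq_martingale_le {Ω S N : Type*} [MeasurableSpace Ω]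
    [MeasurableSpace S] [MeasurableSpace N] {μ : Measure Ω} [IsProbabilityMeasure μ]
    {Z : ℕ → Ω → S} {ξ : ℕ → Ω → N} {Φ : S × N → S} (hΦ : Measurable Φ) (hZ0 : Measurable (Z 0))
    (hξ : ∀ k, Measurable (ξ k)) (hind : iIndepFun ξ μ)
    (hinit : IndepFun (Z 0) (fun ω k => ξ k ω) μ)
    (hrec : ∀ k ω, Z (k + 1) ω = Φ (Z k ω, ξ k ω))
    {ρ : Measure N} (hρ : ∀ k, μ.map (ξ k) = ρ)
    {G : Set S} (hG : MeasurableSet G) (hZG : ∀ k, ∀ᵐ ω ∂μ, Z k ω ∈ G)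
    {D : S × N → ℝ} (hD : Measurable D) {B : ℝ} (hB : 0 ≤ B)
    (h0 : ∀ s ∈ G, ∫ x, D (s, x) ∂ρ = 0)
    (h2 : ∀ s ∈ G, ∫⁻ x, ENNReal.ofReal (D (s, x) ^ 2) ∂ρ ≤ ENNReal.ofReal B) (k : ℕ) :
    MemLp (fun ω => ∑ j ∈ Finset.range k, D (Z j ω, ξ j ω)) 2 μ ∧
      ∫ ω, (∑ j ∈ Finset.range k, D (Z j ω, ξ j ω)) ^ 2 ∂μ ≤ k * B := by
  -- the running sum is adjoined to the state, so that it too is independent of the next noise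
  set m : ℕ → Ω → ℝ := fun k ω => ∑ j ∈ Finset.range k, D (Z j ω, ξ j ω) with hm
  have haug : ∀ k, Measurable (fun ω => (Z k ω, m k ω)) ∧
      IndepFun (fun ω => (Z k ω, m k ω)) (ξ k) μ := fun k =>
    measurable_and_indepFun_of_recursion (Z := fun k ω => (Z k ω, m k ω)) (ξ := ξ)
      (Φ := fun p : (S × ℝ) × N => (Φ (p.1.1, p.2), p.1.2 + D (p.1.1, p.2)))
      ((hΦ.comp (by fun_prop)).prodMk ((by fun_prop : Measurable fun p : (S × ℝ) × N => p.1.2).add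
        (hD.comp (by fun_prop))))
      (by simpa [hm] using hZ0.prodMk measurable_const) hξ hind
      (by
        have : IndepFun (fun ω => (Z 0 ω, (0 : ℝ))) (fun ω k => ξ k ω) μ :=
          hinit.comp (φ := fun z => (z, (0 : ℝ))) (ψ := id)
            (measurable_id.prodMk measurable_const) measurable_id
        simpa [hm] using this)
      (fun k ω => by simp [hm, hrec, Finset.sum_range_succ]) k
  induction k with
  | zero => simp
  | succ k ih =>
    obtain ⟨ihm, ihB⟩ := ih
    obtain ⟨hmeas, hindk⟩ := haug k
    have hZk : Measurable (Z k) := measurable_fst.comp hmeas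
    have hDk : Measurable fun ω => D (Z k ω, ξ k ω) := hD.comp (hZk.prodMk (hξ k))
    have hD2 := integral_sq_le_of_lintegral_le hDk.aestronglyMeasurable hB
      (lintegral_le_of_indepFun hZk (hξ k) (hindk.comp measurable_fst measurable_id) hG (hZG k)
        (f := fun p => ENNReal.ofReal (D p ^ 2)) (by fun_prop) (by rw [hρ]; exact h2))
    have hprod : Integrable (fun ω => m k ω * D (Z k ω, ξ k ω)) μ := ihm.integrable_mul hD2.1
    have hcross : ∫ ω, m k ω * D (Z k ω, ξ k ω) ∂μ = 0 :=
      integral_mul_eq_zero_of_indepFun hmeas (hξ k) hindk (G := Prod.fst ⁻¹' G)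
        (measurable_fst hG) (hZG k) (φ := Prod.snd) measurable_snd
        (g := fun p => D (p.1.1, p.2)) (hD.comp (by fun_prop)) hprod
        (fun s hs => by rw [hρ]; exact h0 _ hs)
    have hsucc : ∀ ω, m (k + 1) ω = m k ω + D (Z k ω, ξ k ω) := fun ω => by
      simp [hm, Finset.sum_range_succ]
    refine ⟨?_, ?_⟩
    · have := ihm.add hD2.1
      convert this using 1
      funext ω
      exact hsucc ω
    · calc ∫ ω, m (k + 1) ω ^ 2 ∂μ
          = ∫ ω, (m k ω ^ 2 + 2 * (m k ω * D (Z k ω, ξ k ω)) + D (Z k ω, ξ k ω) ^ 2) ∂μ := by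
            congr 1; funext ω; rw [hsucc]; ring
        _ = ∫ ω, m k ω ^ 2 ∂μ + 2 * ∫ ω, m k ω * D (Z k ω, ξ k ω) ∂μ
              + ∫ ω, D (Z k ω, ξ k ω) ^ 2 ∂μ := by
            have i1 : Integrable (fun ω => m k ω ^ 2) μ := ihm.integrable_sq
            have i2 : Integrable (fun ω => 2 * (m k ω * D (Z k ω, ξ k ω))) μ := hprod.const_mul 2
            have i12 : Integrable (fun ω => m k ω ^ 2 + 2 * (m k ω * D (Z k ω, ξ k ω))) μ :=
              i1.add i2
            rw [integral_add i12 hD2.1.integrable_sq, integral_add i1 i2, integral_const_mul]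
        _ ≤ (k + 1 : ℕ) * B := by
            rw [hcross]; push_cast; linarith [hD2.2, ihB]

theorem integral_abs_le_sqrt {Ω : Type*} [MeasurableSpace Ω] {μ : Measure Ω}
    [IsProbabilityMeasure μ] {f : Ω → ℝ} (hf : MemLp f 2 μ) {B : ℝ}
    (h : ∫ ω, f ω ^ 2 ∂μ ≤ B) : ∫ ω, |f ω| ∂μ ≤ Real.sqrt B := by
  have h1 : Integrable (fun ω => |f ω|) μ := (hf.integrable one_le_two).abs
  have h2 : Integrable (fun ω => f ω ^ 2) μ := hf.integrable_sq
  apply Real.le_sqrt_of_sq_le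
  set m := ∫ ω, |f ω| ∂μ with hmdef
  have h3 : 0 ≤ ∫ ω, (|f ω| - m) ^ 2 ∂μ := integral_nonneg fun _ => sq_nonneg _
  have h4 : ∫ ω, (|f ω| - m) ^ 2 ∂μ = ∫ ω, f ω ^ 2 ∂μ - 2 * m * m + m ^ 2 := by
    calc ∫ ω, (|f ω| - m) ^ 2 ∂μ = ∫ ω, (f ω ^ 2 - 2 * m * |f ω| + m ^ 2) ∂μ := by
          congr 1; funext ω; rw [← sq_abs (f ω)]; ring
      _ = _ := by
          have i1 : Integrable (fun ω => 2 * m * |f ω|) μ := h1.const_mul _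
          have i2 : Integrable (fun ω => f ω ^ 2 - 2 * m * |f ω|) μ := h2.sub i1
          rw [integral_add i2 (integrable_const _), integral_sub h2 i1, integral_const_mul]
          simp [hmdef]
  nlinarith

/-! ### Nearest points of the constraint sets -/

theorem frobNorm_sq_eq_sum {m n : Type*} [Fintype m] [Fintype n] (A : Matrix m n ℝ) :
    frobNorm A ^ 2 = ∑ i, ∑ j, A i j ^ 2 :=
  Real.sq_sqrt (Finset.sum_nonneg fun _ _ => Finset.sum_nonneg fun _ _ => sq_nonneg _)

theorem frobNorm_sq {m n : Type*} [Fintype m] [Fintype n] (A : Matrix m n ℝ) :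
    frobNorm A ^ 2 = (Aᵀ * A).trace := by
  rw [frobNorm_sq_eq_sum, Finset.sum_comm]
  simp [Matrix.trace, Matrix.mul_apply, sq]

theorem frobNorm_nonneg {m n : Type*} [Fintype m] [Fintype n] (A : Matrix m n ℝ) :
    0 ≤ frobNorm A := Real.sqrt_nonneg _

theorem trace_le_of_frobNorm_le {m n : Type*} [Fintype m] [Fintype n] [DecidableEq n]
    {B W O : Matrix m n ℝ} (hW : Wᵀ * W = 1) (hO : Oᵀ * O = 1)
    (h : frobNorm (B - W) ≤ frobNorm (B - O)) : (Bᵀ * O).trace ≤ (Bᵀ * W).trace := by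
  have h2 := pow_le_pow_left₀ (frobNorm_nonneg _) h 2
  have key : ∀ X : Matrix m n ℝ, ((B - X)ᵀ * (B - X)).trace =
      (Bᵀ * B).trace - 2 * (Bᵀ * X).trace + (Xᵀ * X).trace := fun X => by
    have : (Xᵀ * B).trace = (Bᵀ * X).trace := by
      rw [← Matrix.trace_transpose (Bᵀ * X), Matrix.transpose_mul, Matrix.transpose_transpose]
    simp only [Matrix.transpose_sub, Matrix.sub_mul, Matrix.mul_sub, Matrix.trace_sub, this]
    ring
  rw [frobNorm_sq, frobNorm_sq, key, key, hW, hO] at h2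
  linarith

theorem trace_vecMulVec_mul {n : Type*} [Fintype n] (v w : n → ℝ) (A : Matrix n n ℝ) :
    (vecMulVec v w * A).trace = w ⬝ᵥ (A *ᵥ v) := by
  rw [vecMulVec_mul, trace_vecMulVec, dotProduct_comm, ← dotProduct_mulVec]

theorem reflection_transpose_mul_self {n : Type*} [Fintype n] [DecidableEq n] {u : n → ℝ}
    (hu : u ⬝ᵥ u ≠ 0) :
    (1 - (2 / (u ⬝ᵥ u)) • vecMulVec u u)ᵀ * (1 - (2 / (u ⬝ᵥ u)) • vecMulVec u u) =
      (1 : Matrix n n ℝ) := by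
  simp only [transpose_sub, transpose_one, transpose_smul, transpose_vecMulVec, Matrix.sub_mul,
    Matrix.mul_sub, Matrix.one_mul, Matrix.mul_one, Matrix.smul_mul, Matrix.mul_smul,
    vecMulVec_mul_vecMulVec, smul_smul, vecMulVec_smul]
  rw [← sub_eq_zero]
  ext i j
  simp
  field_simp
  ring

/-- A square matrix `A` at which `O ↦ tr (O A)` is maximal over the orthogonal group at `O = 1`
has a nonnegative quadratic form. Only reflections `1 - 2 v vᵀ / |v|²` are compared with `1`. -/
theorem dotProduct_mulVec_nonneg_of_trace_le {n : Type*} [Fintype n] [DecidableEq n]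
    {A : Matrix n n ℝ} (h : ∀ O : Matrix n n ℝ, Oᵀ * O = 1 → (O * A).trace ≤ A.trace)
    (v : n → ℝ) : 0 ≤ v ⬝ᵥ (A *ᵥ v) := by
  by_cases hv : v ⬝ᵥ v = 0
  · rw [dotProduct_self_eq_zero.1 hv]; simp
  · have hv' : 0 < v ⬝ᵥ v := lt_of_le_of_ne
      (Finset.sum_nonneg fun i _ => mul_self_nonneg (v i)) (Ne.symm hv)
    have hO := reflection_transpose_mul_self hv
    have h1 := h _ hO
    rw [Matrix.sub_mul, Matrix.one_mul, Matrix.smul_mul, trace_sub, trace_smul,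
      trace_vecMulVec_mul, smul_eq_mul] at h1
    have h2 : 0 ≤ 2 / (v ⬝ᵥ v) * (v ⬝ᵥ A *ᵥ v) := by linarith
    exact nonneg_of_mul_nonneg_right h2 (by positivity)

/-- The comparison of `1` with a product of two reflections, in the matrix
`O = (1 - 2 v vᵀ / |v|²) (1 - 2 w wᵀ / |w|²)`. -/
theorem two_reflections_le_of_trace_le {n : Type*} [Fintype n] [DecidableEq n]
    {A : Matrix n n ℝ} (h : ∀ O : Matrix n n ℝ, Oᵀ * O = 1 → (O * A).trace ≤ A.trace)
    (v w : n → ℝ) : 2 * (v ⬝ᵥ w) * (w ⬝ᵥ (A *ᵥ v)) ≤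
      (w ⬝ᵥ w) * (v ⬝ᵥ (A *ᵥ v)) + (v ⬝ᵥ v) * (w ⬝ᵥ (A *ᵥ w)) := by
  by_cases hv : v ⬝ᵥ v = 0
  · rw [dotProduct_self_eq_zero.1 hv]; simp
  by_cases hw : w ⬝ᵥ w = 0
  · rw [dotProduct_self_eq_zero.1 hw]; simp
  have hv' : 0 < v ⬝ᵥ v := lt_of_le_of_ne
    (Finset.sum_nonneg fun i _ => mul_self_nonneg (v i)) (Ne.symm hv)
  have hw' : 0 < w ⬝ᵥ w := lt_of_le_of_ne
    (Finset.sum_nonneg fun i _ => mul_self_nonneg (w i)) (Ne.symm hw)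
  set Hv := (1 - (2 / (v ⬝ᵥ v)) • vecMulVec v v : Matrix n n ℝ)
  set Hw := (1 - (2 / (w ⬝ᵥ w)) • vecMulVec w w : Matrix n n ℝ)
  have hO : (Hv * Hw)ᵀ * (Hv * Hw) = 1 := by
    rw [transpose_mul, Matrix.mul_assoc, ← Matrix.mul_assoc Hvᵀ, reflection_transpose_mul_self hv, Matrix.one_mul,
      reflection_transpose_mul_self hw]
  have h1 := h _ hO
  have h2 : (Hv * Hw * A).trace = A.trace - 2 / (v ⬝ᵥ v) * (v ⬝ᵥ A *ᵥ v)
      - 2 / (w ⬝ᵥ w) * (w ⬝ᵥ A *ᵥ w)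
      + 2 / (v ⬝ᵥ v) * (2 / (w ⬝ᵥ w)) * (v ⬝ᵥ w) * (w ⬝ᵥ A *ᵥ v) := by
    simp only [Hv, Hw, Matrix.sub_mul, Matrix.mul_sub, Matrix.one_mul, Matrix.mul_one,
      Matrix.smul_mul, Matrix.mul_smul, smul_smul, vecMulVec_mul_vecMulVec, trace_sub, trace_smul, trace_vecMulVec_mul, smul_eq_mul,
      vecMulVec_smul]
    ring
  rw [h2] at h1
  have h3 : 0 ≤ ((v ⬝ᵥ v) * (w ⬝ᵥ w) / 2) * (2 / (v ⬝ᵥ v) * (v ⬝ᵥ A *ᵥ v)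
      + 2 / (w ⬝ᵥ w) * (w ⬝ᵥ A *ᵥ w)
      - 2 / (v ⬝ᵥ v) * (2 / (w ⬝ᵥ w)) * (v ⬝ᵥ w) * (w ⬝ᵥ A *ᵥ v)) :=
    mul_nonneg (by positivity) (by linarith)
  have h4 : ((v ⬝ᵥ v) * (w ⬝ᵥ w) / 2) * (2 / (v ⬝ᵥ v) * (v ⬝ᵥ A *ᵥ v)
      + 2 / (w ⬝ᵥ w) * (w ⬝ᵥ A *ᵥ w)
      - 2 / (v ⬝ᵥ v) * (2 / (w ⬝ᵥ w)) * (v ⬝ᵥ w) * (w ⬝ᵥ A *ᵥ v)) =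
      (w ⬝ᵥ w) * (v ⬝ᵥ (A *ᵥ v)) + (v ⬝ᵥ v) * (w ⬝ᵥ (A *ᵥ w))
        - 2 * (v ⬝ᵥ w) * (w ⬝ᵥ (A *ᵥ v)) := by
    field_simp
  linarith

theorem eq_zero_of_forall_linear_add_quadratic_nonneg {a b : ℝ}
    (h : ∀ ε : ℝ, 0 ≤ ε * a + ε ^ 2 * b) : a = 0 := by
  by_contra ha
  have h1 := h (-a / (1 + |b|))
  have hb : 0 < 1 + |b| := by positivity
  have h2 : -a / (1 + |b|) * a + (-a / (1 + |b|)) ^ 2 * b =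
      -(a ^ 2 / (1 + |b|)) * (1 - b / (1 + |b|)) := by
    field_simp
    ring
  rw [h2] at h1
  have h3 : b / (1 + |b|) < 1 := (div_lt_one hb).2 (by linarith [le_abs_self b])
  have h4 : 0 < a ^ 2 / (1 + |b|) := by positivity
  nlinarith

/-- The symmetry of a matrix `A` at which `O ↦ tr (O A)` is maximal over the orthogonal group at
`O = 1`: the first-order part of the comparison with two reflections along nearby directions. -/
theorem isSymm_of_trace_le {n : Type*} [Fintype n] [DecidableEq n]
    {A : Matrix n n ℝ} (h : ∀ O : Matrix n n ℝ, Oᵀ * O = 1 → (O * A).trace ≤ A.trace) :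
    Aᵀ = A := by
  have key : ∀ v z : n → ℝ, z ⬝ᵥ (A *ᵥ v) = v ⬝ᵥ (A *ᵥ z) := fun v z => by
    by_cases hv : v ⬝ᵥ v = 0
    · rw [dotProduct_self_eq_zero.1 hv]; simp
    have h0 : (v ⬝ᵥ v) * (v ⬝ᵥ (A *ᵥ z) - z ⬝ᵥ (A *ᵥ v)) = 0 := by
      refine eq_zero_of_forall_linear_add_quadratic_nonneg
        (b := (z ⬝ᵥ z) * (v ⬝ᵥ (A *ᵥ v)) + (v ⬝ᵥ v) * (z ⬝ᵥ (A *ᵥ z))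
          - 2 * (v ⬝ᵥ z) * (z ⬝ᵥ (A *ᵥ v))) fun ε => ?_
      have h1 := two_reflections_le_of_trace_le h v (v + ε • z)
      simp only [mulVec_add, mulVec_smul, add_dotProduct, dotProduct_add, smul_dotProduct,
        dotProduct_smul, smul_eq_mul, dotProduct_comm z v] at h1
      linarith
    have := (mul_eq_zero.1 h0).resolve_left hv
    linarith
  ext i j
  have := key (Pi.single i 1) (Pi.single j 1)
  simpa using this

/-- A nearest point `W` of the set of matrices with orthonormal columns is a polar factor of `B`,
whether or not `B` has full rank. -/
theorem exists_polar_of_nearest {m n : Type*} [Fintype m] [Fintype n] [DecidableEq m]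
    [DecidableEq n] {B W : Matrix m n ℝ} (hW : Wᵀ * W = 1)
    (h : ∀ O : Matrix m n ℝ, Oᵀ * O = 1 → frobNorm (B - W) ≤ frobNorm (B - O)) :
    ∃ N : Matrix n n ℝ, Nᵀ = N ∧ (∀ x, 0 ≤ x ⬝ᵥ (N *ᵥ x)) ∧ B = W * N := by
  have hA : ∀ O : Matrix m m ℝ, Oᵀ * O = 1 → (O * (W * Bᵀ)).trace ≤ (W * Bᵀ).trace := by
    intro O hO
    have hOW : (O * W)ᵀ * (O * W) = 1 := by
      rw [transpose_mul, Matrix.mul_assoc, ← Matrix.mul_assoc Oᵀ, hO, Matrix.one_mul, hW]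
    have := trace_le_of_frobNorm_le hW hOW (h _ hOW)
    rwa [Matrix.trace_mul_comm, Matrix.trace_mul_comm Bᵀ W, Matrix.mul_assoc] at this
  have hsymm := isSymm_of_trace_le hA
  have hpos := dotProduct_mulVec_nonneg_of_trace_le hA
  rw [transpose_mul, transpose_transpose] at hsymm
  refine ⟨Bᵀ * W, ?_, fun x => ?_, ?_⟩
  · calc (Bᵀ * W)ᵀ = Wᵀ * (B * Wᵀ) * W := by
          rw [transpose_mul, transpose_transpose, Matrix.mul_assoc, Matrix.mul_assoc, hW,
            Matrix.mul_one]
      _ = Bᵀ * W := by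
          rw [hsymm, ← Matrix.mul_assoc, hW, Matrix.one_mul]
  · have := hpos (W *ᵥ x)
    have h1 : Bᵀ * W = Wᵀ * (W * Bᵀ) * W := by
      rw [← Matrix.mul_assoc, hW, Matrix.one_mul]
    have h2 : x ⬝ᵥ (Bᵀ * W) *ᵥ x = (W *ᵥ x) ⬝ᵥ (W * Bᵀ) *ᵥ (W *ᵥ x) := by
      rw [h1, ← mulVec_mulVec, ← mulVec_mulVec, dotProduct_mulVec, vecMul_transpose]
    rwa [h2]
  · rw [← Matrix.mul_assoc, ← hsymm, Matrix.mul_assoc, hW, Matrix.mul_one]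

theorem mem_genSet_iff {n d : ℕ} {V : Matrix (Fin n) (Fin d) ℝ} :
    V ∈ genSet n d ↔ ∀ j, ∑ i, V i j ^ 2 = 1 := by
  have hlog : ∀ x : ℝ, 0 ≤ Real.log (Real.cosh x) := fun x => Real.log_nonneg (Real.one_le_cosh x)
  have hlog0 : ∀ x : ℝ, Real.log (Real.cosh x) = 0 ↔ x = 0 := fun x => by
    constructor
    · intro hx
      by_contra hne
      exact (Real.log_pos ((Real.one_lt_cosh).2 hne)).ne' hx
    · rintro rfl; simp
  simp only [genSet, Set.mem_ofPred_eq, Hreg, Matrix.trace, Matrix.diag, Matrix.map_apply]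
  rw [Finset.sum_eq_zero_iff_of_nonneg fun i _ => hlog _]
  simp [hlog0, sub_eq_zero, Matrix.mul_apply, sq]

/-- A nearest point of the set of matrices with unit columns normalizes each column. -/
theorem exists_diagonal_of_nearest {n d : ℕ} {A V : Matrix (Fin n) (Fin d) ℝ}
    (hV : V ∈ genSet n d)
    (h : ∀ B ∈ genSet n d, frobNorm (A - V) ≤ frobNorm (A - B)) :
    ∃ s : Fin d → ℝ, (∀ j, 0 ≤ s j) ∧ A = V * Matrix.diagonal s := by
  rw [mem_genSet_iff] at hV
  refine ⟨fun j => Real.sqrt (∑ i, A i j ^ 2), fun j => Real.sqrt_nonneg _, ?_⟩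
  ext i j
  rw [Matrix.mul_diagonal]
  set r := Real.sqrt (∑ i, A i j ^ 2) with hr
  have hr2 : r ^ 2 = ∑ i, A i j ^ 2 := Real.sq_sqrt (Finset.sum_nonneg fun _ _ => sq_nonneg _)
  have hr0 : 0 ≤ r := Real.sqrt_nonneg _
  suffices hs : ∑ i, (A i j - V i j * r) ^ 2 ≤ 0 by
    have h0 := (Finset.sum_eq_zero_iff_of_nonneg (fun i _ => sq_nonneg (A i j - V i j * r))).1
      (le_antisymm hs (Finset.sum_nonneg fun _ _ => sq_nonneg _)) i (Finset.mem_univ i)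
    exact sub_eq_zero.1 (pow_eq_zero_iff two_ne_zero |>.1 h0)
  have hexp : ∑ i, (A i j - V i j * r) ^ 2 = 2 * r * (r - ∑ i, A i j * V i j) := by
    calc ∑ i, (A i j - V i j * r) ^ 2
        = ∑ i, (A i j ^ 2 - 2 * r * (A i j * V i j) + r ^ 2 * V i j ^ 2) :=
          Finset.sum_congr rfl fun i _ => by ring
      _ = 2 * r * (r - ∑ i, A i j * V i j) := by
          rw [Finset.sum_add_distrib, Finset.sum_sub_distrib, ← Finset.mul_sum, ← Finset.mul_sum,
            hV j, ← hr2]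
          ring
  rw [hexp]
  rcases hr0.eq_or_lt with h0 | hpos
  · rw [← h0]; simp
  -- the comparison matrix has the normalized column of `A` in place `j`
  set b : Fin n → ℝ := fun i => A i j / r with hb
  have hb1 : ∑ i, b i ^ 2 = 1 := by
    simp only [hb, div_pow]
    rw [← Finset.sum_div, ← hr2, div_self (by positivity)]
  have hmem : V.updateCol j b ∈ genSet n d := by
    rw [mem_genSet_iff]
    intro j'
    by_cases hj : j' = j
    · subst hj; simpa using hb1
    · simpa [Matrix.updateCol_ne hj] using hV j'
  have h1 := pow_le_pow_left₀ (frobNorm_nonneg _) (h _ hmem) 2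
  rw [frobNorm_sq_eq_sum, frobNorm_sq_eq_sum, Finset.sum_comm, Finset.sum_comm (γ := Fin n),
    ← Finset.add_sum_erase _ _ (Finset.mem_univ j),
    ← Finset.add_sum_erase _ _ (Finset.mem_univ j)] at h1
  have h2 : ∀ j' ∈ Finset.univ.erase j, ∑ i, (A - V.updateCol j b) i j' ^ 2 =
      ∑ i, (A - V) i j' ^ 2 := fun j' hj' => by
    refine Finset.sum_congr rfl fun i _ => ?_
    rw [Matrix.sub_apply, Matrix.sub_apply, Matrix.updateCol_ne (Finset.ne_of_mem_erase hj')]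
  rw [Finset.sum_congr rfl h2, add_le_add_iff_right] at h1
  have h3 : ∀ u : Fin n → ℝ, ∑ i, u i ^ 2 = 1 → ∑ i, (A i j - u i) ^ 2 =
      r ^ 2 + 1 - 2 * ∑ i, A i j * u i := fun u hu => by
    calc ∑ i, (A i j - u i) ^ 2 = ∑ i, (A i j ^ 2 + u i ^ 2 - 2 * (A i j * u i)) :=
          Finset.sum_congr rfl fun i _ => by ring
      _ = _ := by
          rw [Finset.sum_sub_distrib, Finset.sum_add_distrib, ← Finset.mul_sum, hu, ← hr2]
  simp only [Matrix.sub_apply, Matrix.updateCol_self] at h1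
  rw [h3 _ (hV j), h3 b hb1] at h1
  have h4 : ∑ i, A i j * b i = r := by
    calc ∑ i, A i j * b i = (∑ i, A i j ^ 2) / r := by
          rw [Finset.sum_div]; exact Finset.sum_congr rfl fun i _ => by simp only [hb]; ring
      _ = r := by rw [← hr2]; field_simp
  rw [h4] at h1
  have : r - ∑ i, A i j * V i j ≤ 0 := by linarith
  exact mul_nonpos_of_nonneg_of_nonpos (by positivity) this

/-! ### Second-order expansion of the retractions -/

section Frobenius

attribute [local instance] Matrix.frobeniusNormedAddCommGroup Matrix.frobeniusNormedSpace

theorem norm_eq_frobNorm {m n : Type*} [Fintype m] [Fintype n] (A : Matrix m n ℝ) :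
    ‖A‖ = frobNorm A := by
  rw [Matrix.frobenius_norm_def, frobNorm, Real.sqrt_eq_rpow]
  simp

theorem norm_sq_eq_trace {m n : Type*} [Fintype m] [Fintype n] (A : Matrix m n ℝ) :
    ‖A‖ ^ 2 = (Aᵀ * A).trace := by
  rw [norm_eq_frobNorm, frobNorm_sq]

theorem norm_sq_eq_sum {m n : Type*} [Fintype m] [Fintype n] (A : Matrix m n ℝ) :
    ‖A‖ ^ 2 = ∑ i, ∑ j, A i j ^ 2 := by
  rw [norm_eq_frobNorm, frobNorm_sq_eq_sum]

theorem norm_transpose' {m n : Type*} [Fintype m] [Fintype n] (A : Matrix m n ℝ) :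
    ‖Aᵀ‖ = ‖A‖ := Matrix.frobenius_norm_transpose A

theorem norm_mul_le_of_le' {l m n : Type*} [Fintype l] [Fintype m] [Fintype n]
    {A : Matrix l m ℝ} {B : Matrix m n ℝ} {a b : ℝ} (hA : ‖A‖ ≤ a) (hB : ‖B‖ ≤ b) :
    ‖A * B‖ ≤ a * b :=
  (Matrix.frobenius_norm_mul A B).trans
    (mul_le_mul hA hB (norm_nonneg _) ((norm_nonneg _).trans hA))

theorem norm_transpose_mul_le {l m n : Type*} [Fintype l] [Fintype m] [Fintype n]
    {A : Matrix m l ℝ} {B : Matrix m n ℝ} {a b : ℝ} (hA : ‖A‖ ≤ a) (hB : ‖B‖ ≤ b) :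
    ‖Aᵀ * B‖ ≤ a * b :=
  norm_mul_le_of_le' (by rwa [norm_transpose']) hB

theorem norm_smul_le' {m n : Type*} [Fintype m] [Fintype n]
    {A : Matrix m n ℝ} {a c : ℝ} (hc : 0 ≤ c) (hA : ‖A‖ ≤ a) : ‖c • A‖ ≤ c * a := by
  rw [norm_smul, Real.norm_of_nonneg hc]
  exact mul_le_mul_of_nonneg_left hA hc

/-- If `N` is symmetric and positive semidefinite with `N² = 1 + E`, then `N` is at least as close
to `1` as `N²` is: `E = X + X N` with `X = N - 1`, and the two terms have nonnegative inner
product. -/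
theorem norm_sub_one_le {n : Type*} [Fintype n] [DecidableEq n] {N E : Matrix n n ℝ}
    (hpos : ∀ x, 0 ≤ x ⬝ᵥ (N *ᵥ x)) (h : N * N = 1 + E) : ‖N - 1‖ ≤ ‖E‖ := by
  have hE : E = (N - 1) + (N - 1) * N := by
    rw [Matrix.sub_mul, h, Matrix.one_mul]; abel
  have hX : 0 ≤ ((N - 1)ᵀ * ((N - 1) * N)).trace := by
    rw [← Matrix.mul_assoc, Matrix.trace_mul_comm, ← Matrix.mul_assoc, Matrix.trace_mul_comm,
      Matrix.trace]
    refine Finset.sum_nonneg fun i _ => ?_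
    have h1 : ((N - 1) * (N * (N - 1)ᵀ)).diag i =
        (fun j => (N - 1) i j) ⬝ᵥ (N *ᵥ fun j => (N - 1) i j) := by
      simp only [Matrix.diag_apply, Matrix.mul_apply, dotProduct, mulVec, Matrix.transpose_apply]
    rw [h1]
    exact hpos _
  have hX' : (((N - 1) * N)ᵀ * (N - 1)).trace = ((N - 1)ᵀ * ((N - 1) * N)).trace := by
    rw [← Matrix.trace_transpose, Matrix.transpose_mul, Matrix.transpose_transpose]
  have hsq : ‖N - 1‖ ^ 2 ≤ ‖E‖ ^ 2 := by
    have h2 : ‖E‖ ^ 2 = ‖N - 1‖ ^ 2 + 2 * ((N - 1)ᵀ * ((N - 1) * N)).trace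
        + ‖(N - 1) * N‖ ^ 2 := by
      rw [norm_sq_eq_trace E, norm_sq_eq_trace (N - 1), norm_sq_eq_trace ((N - 1) * N), hE,
        Matrix.transpose_add, Matrix.add_mul, Matrix.mul_add, Matrix.mul_add, Matrix.trace_add,
        Matrix.trace_add, Matrix.trace_add, hX']
      ring
    rw [h2]
    have := sq_nonneg ‖(N - 1) * N‖
    linarith
  exact le_of_sq_le_sq hsq (norm_nonneg _)

theorem sub_one_eq_of_mul_self_eq {n : Type*} [Fintype n] [DecidableEq n] {N E : Matrix n n ℝ}
    (h : N * N = 1 + E) :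
    N - 1 = (1 / 2 : ℝ) • E - (1 / 2 : ℝ) • ((N - 1) * (N - 1)) := by
  have : (N - 1) * (N - 1) = 1 + E - N - N + 1 := by
    rw [Matrix.sub_mul, Matrix.mul_sub, Matrix.mul_sub, h]; simp; abel
  rw [this]
  module

/-- The diagonal part of a matrix. -/
def diagPart {n : Type*} [DecidableEq n] (A : Matrix n n ℝ) : Matrix n n ℝ :=
  Matrix.diagonal A.diag

theorem norm_diagPart_le {n : Type*} [Fintype n] [DecidableEq n] (A : Matrix n n ℝ) :
    ‖diagPart A‖ ≤ ‖A‖ := by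
  refine le_of_sq_le_sq ?_ (norm_nonneg _)
  rw [norm_sq_eq_sum, norm_sq_eq_sum]
  refine Finset.sum_le_sum fun i _ => Finset.sum_le_sum fun j _ => ?_
  by_cases hij : i = j
  · subst hij; simp [diagPart]
  · simp [diagPart, Matrix.diagonal_apply_ne _ hij, sq_nonneg]

theorem diagPart_transpose {n : Type*} [DecidableEq n] (A : Matrix n n ℝ) :
    (diagPart A)ᵀ = diagPart A := by simp [diagPart]

/-- Expansion of the step `V ↦ V + ε Δ` followed by the normalization of the columns. -/
theorem normalize_expansion {m n : Type*} [Fintype m] [Fintype n] [DecidableEq n]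
    {V V' Δ : Matrix m n ℝ} {s : n → ℝ} {ε L : ℝ} (hε : 0 ≤ ε) (hε1 : ε ≤ 1) (hL : 1 ≤ L)
    (hVd : diagPart (Vᵀ * V) = 1) (hVd' : diagPart (V'ᵀ * V') = 1) (hs : ∀ j, 0 ≤ s j)
    (hA : V + ε • Δ = V' * Matrix.diagonal s)
    (hV : ‖V‖ ≤ L) (hV' : ‖V'‖ ≤ L) (hΔ : ‖Δ‖ ≤ L) :
    ‖V' - V‖ ≤ 4 * L ^ 3 * ε ∧
      ‖V' - V - ε • (Δ - V * diagPart (Vᵀ * Δ))‖ ≤ 17 * L ^ 5 * ε ^ 2 := by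
  set N : Matrix n n ℝ := Matrix.diagonal s with hNdef
  set E : Matrix n n ℝ := (2 * ε) • diagPart (Vᵀ * Δ) + ε ^ 2 • diagPart (Δᵀ * Δ) with hE
  have hNN : N * N = 1 + E := by
    have h1 : diagPart ((V' * N)ᵀ * (V' * N)) = N * N := by
      have hd : ∀ j, (V'ᵀ * V') j j = 1 := fun j => by
        have := congrFun (congrFun hVd' j) j
        simpa [diagPart] using this
      rw [Matrix.transpose_mul, Matrix.mul_assoc, ← Matrix.mul_assoc V'ᵀ, hNdef,
        Matrix.diagonal_transpose, Matrix.diagonal_mul_diagonal, diagPart]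
      congr 1
      funext j
      simp [Matrix.diagonal_mul, Matrix.mul_diagonal, hd]
    rw [← h1, ← hA, ← hVd, hE]
    ext i j
    by_cases hij : i = j
    · subst hij
      have : (Δᵀ * V) i i = (Vᵀ * Δ) i i := by simp [Matrix.mul_apply, mul_comm]
      simp [diagPart, Matrix.add_mul, Matrix.mul_add, this]
      ring
    · simp [diagPart, Matrix.diagonal_apply_ne _ hij]
  have hpos : ∀ x, 0 ≤ x ⬝ᵥ (N *ᵥ x) := fun x => by
    refine Finset.sum_nonneg fun i _ => ?_
    rw [hNdef, Matrix.mulVec_diagonal]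
    nlinarith [hs i, mul_nonneg (hs i) (mul_self_nonneg (x i))]
  have hL0 : (0 : ℝ) ≤ L := by linarith
  have hEn : ‖E‖ ≤ 3 * L ^ 2 * ε := by
    have h1 : ‖(2 * ε) • diagPart (Vᵀ * Δ)‖ ≤ 2 * ε * (L * L) :=
      norm_smul_le' (by positivity) ((norm_diagPart_le _).trans (norm_transpose_mul_le hV hΔ))
    have h2 : ‖ε ^ 2 • diagPart (Δᵀ * Δ)‖ ≤ ε ^ 2 * (L * L) :=
      norm_smul_le' (by positivity) ((norm_diagPart_le _).trans (norm_transpose_mul_le hΔ hΔ))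
    have h3 : ε ^ 2 * (L * L) ≤ ε * (L * L) :=
      mul_le_mul_of_nonneg_right (by nlinarith) (by positivity)
    calc ‖E‖ ≤ _ := norm_add_le _ _
      _ ≤ _ := by nlinarith
  have hX : ‖N - 1‖ ≤ 3 * L ^ 2 * ε := (norm_sub_one_le hpos hNN).trans hEn
  have hdiff : V' - V = ε • Δ - V' * (N - 1) := by
    rw [Matrix.mul_sub, ← hA, Matrix.mul_one]; abel
  have hd : ‖V' - V‖ ≤ 4 * L ^ 3 * ε := by
    rw [hdiff]
    have h1 := norm_smul_le' hε hΔ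
    have h2 := norm_mul_le_of_le' hV' hX
    have h3 : ε * L ≤ ε * L ^ 3 :=
      mul_le_mul_of_nonneg_left (by nlinarith [sq_nonneg (L - 1), mul_nonneg hL0 hL0]) hε
    calc ‖ε • Δ - V' * (N - 1)‖ ≤ _ := norm_sub_le _ _
      _ ≤ _ := by nlinarith
  refine ⟨hd, ?_⟩
  have hrem : V' - V - ε • (Δ - V * diagPart (Vᵀ * Δ)) =
      -((V' - V) * (N - 1)) + (1 / 2 : ℝ) • (V * ((N - 1) * (N - 1)))
        - (1 / 2 : ℝ) • (ε ^ 2 • (V * diagPart (Δᵀ * Δ))) := by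
    have h1 : V' * (N - 1) = (V' - V) * (N - 1) + V * (N - 1) := by
      rw [Matrix.sub_mul]; abel
    have h2 : V * (N - 1) = ε • (V * diagPart (Vᵀ * Δ))
        + (1 / 2 : ℝ) • (ε ^ 2 • (V * diagPart (Δᵀ * Δ)))
        - (1 / 2 : ℝ) • (V * ((N - 1) * (N - 1))) := by
      conv_lhs => rw [sub_one_eq_of_mul_self_eq hNN, hE]
      simp only [Matrix.mul_sub, Matrix.mul_add, Matrix.mul_smul, smul_add]
      module
    have h3 : V' - V = ε • Δ - ((V' - V) * (N - 1) + V * (N - 1)) := by rw [← h1]; exact hdiff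
    conv_lhs => rw [h3, h2]
    module
  rw [hrem]
  have h1 := norm_mul_le_of_le' hd hX
  have h2 : ‖(1 / 2 : ℝ) • (V * ((N - 1) * (N - 1)))‖ ≤ _ :=
    norm_smul_le' (by norm_num) (norm_mul_le_of_le' hV (norm_mul_le_of_le' hX hX))
  have h3 : ‖(1 / 2 : ℝ) • (ε ^ 2 • (V * diagPart (Δᵀ * Δ)))‖ ≤ _ :=
    norm_smul_le' (by norm_num) (norm_smul_le' (sq_nonneg ε) (norm_mul_le_of_le' hV
      ((norm_diagPart_le _).trans (norm_transpose_mul_le hΔ hΔ))))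
  have h4 : L ^ 3 * ε ^ 2 ≤ L ^ 5 * ε ^ 2 :=
    mul_le_mul_of_nonneg_right (pow_le_pow_right₀ hL (by norm_num)) (sq_nonneg _)
  calc _ ≤ ‖(V' - V) * (N - 1)‖ + ‖(1 / 2 : ℝ) • (V * ((N - 1) * (N - 1)))‖
        + ‖(1 / 2 : ℝ) • (ε ^ 2 • (V * diagPart (Δᵀ * Δ)))‖ := by
        refine (norm_sub_le _ _).trans (add_le_add_left ((norm_add_le _ _).trans ?_) _)
        rw [norm_neg]
    _ ≤ 4 * L ^ 3 * ε * (3 * L ^ 2 * ε) + 1 / 2 * (L * (3 * L ^ 2 * ε * (3 * L ^ 2 * ε)))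
        + 1 / 2 * (ε ^ 2 * (L * (L * L))) := by linarith
    _ = 16.5 * (L ^ 5 * ε ^ 2) + 0.5 * (L ^ 3 * ε ^ 2) := by ring
    _ ≤ 17 * L ^ 5 * ε ^ 2 := by linarith

/-- Expansion of the step `W ↦ W + ε Δ` followed by the nearest point with orthonormal columns,
as seen from a fixed frame `X`. The matrix `Δ` itself may be large: only `Xᵀ Δ`, `Wᵀ Δ` and the
second-order term `ε Δᵀ Δ ≈ Γ` enter. -/
theorem orthonormalize_expansion {m n p : Type*} [Fintype m] [Fintype n] [Fintype p]
    [DecidableEq n]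
    {W W' Δ : Matrix m n ℝ} {N Γ : Matrix n n ℝ} {X : Matrix m p ℝ} {ε L κ : ℝ} (hε : 0 ≤ ε)
    (hL : 1 ≤ L)
    (hWo : Wᵀ * W = 1) (hWo' : W'ᵀ * W' = 1) (hsymm : Nᵀ = N) (hpos : ∀ x, 0 ≤ x ⬝ᵥ (N *ᵥ x))
    (hB : W + ε • Δ = W' * N) (hW : ‖W‖ ≤ L) (hW' : ‖W'‖ ≤ L) (hX : ‖X‖ ≤ L)
    (hXΔ : ‖Xᵀ * Δ‖ ≤ L) (hWΔ : ‖Wᵀ * Δ‖ ≤ L) (hΔΔ : ‖ε • (Δᵀ * Δ)‖ ≤ L)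
    (hΓ : ‖ε • (Δᵀ * Δ) - Γ‖ ≤ κ) :
    ‖Xᵀ * (W' - W)‖ ≤ 4 * L ^ 3 * ε ∧
      ‖Xᵀ * (W' - W) - ε • (Xᵀ * Δ - (1 / 2 : ℝ) • (Xᵀ * W * (Wᵀ * Δ + Δᵀ * W + Γ)))‖ ≤
        17 * L ^ 4 * ε ^ 2 + L ^ 2 * ε * κ := by
  have hL0 : (0 : ℝ) ≤ L := by linarith
  have hκ : 0 ≤ κ := (norm_nonneg _).trans hΓ
  set E : Matrix n n ℝ := ε • (Wᵀ * Δ + Δᵀ * W + ε • (Δᵀ * Δ)) with hE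
  have hNN : N * N = 1 + E := by
    have h1 : (W' * N)ᵀ * (W' * N) = N * N := by
      rw [Matrix.transpose_mul, Matrix.mul_assoc, ← Matrix.mul_assoc W'ᵀ, hWo', Matrix.one_mul,
        hsymm]
    rw [← h1, ← hB, ← hWo, hE]
    simp only [Matrix.transpose_add, Matrix.transpose_smul, Matrix.add_mul, Matrix.mul_add,
      Matrix.smul_mul, Matrix.mul_smul]
    module
  have hΔW : ‖Δᵀ * W‖ ≤ L := by
    rw [← norm_transpose', Matrix.transpose_mul, Matrix.transpose_transpose]; exact hWΔ
  have hEn : ‖E‖ ≤ 3 * L * ε := by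
    have h1 : ‖Wᵀ * Δ + Δᵀ * W + ε • (Δᵀ * Δ)‖ ≤ L + L + L := (norm_add₃_le).trans (by linarith)
    have := norm_smul_le' hε h1
    linarith
  have hN1 : ‖N - 1‖ ≤ 3 * L * ε := (norm_sub_one_le hpos hNN).trans hEn
  have hdiff : W' - W = ε • Δ - W' * (N - 1) := by
    rw [Matrix.mul_sub, ← hB, Matrix.mul_one]; abel
  have hXdiff : Xᵀ * (W' - W) = ε • (Xᵀ * Δ) - Xᵀ * W' * (N - 1) := by
    conv_lhs => rw [hdiff]
    rw [Matrix.mul_sub, Matrix.mul_smul, Matrix.mul_assoc]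
  have hd : ‖Xᵀ * (W' - W)‖ ≤ 4 * L ^ 3 * ε := by
    rw [hXdiff]
    have h1 := norm_smul_le' hε hXΔ
    have h2 := norm_mul_le_of_le' (norm_transpose_mul_le hX hW') hN1
    have h3 : ε * L ≤ ε * L ^ 3 :=
      mul_le_mul_of_nonneg_left (by nlinarith [sq_nonneg (L - 1), mul_nonneg hL0 hL0]) hε
    calc _ ≤ _ := norm_sub_le _ _
      _ ≤ _ := by nlinarith
  refine ⟨hd, ?_⟩
  have hrem : Xᵀ * (W' - W)
      - ε • (Xᵀ * Δ - (1 / 2 : ℝ) • (Xᵀ * W * (Wᵀ * Δ + Δᵀ * W + Γ))) =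
      -(Xᵀ * (W' - W) * (N - 1)) + (1 / 2 : ℝ) • (Xᵀ * W * ((N - 1) * (N - 1)))
        - (1 / 2 : ℝ) • (ε • (Xᵀ * W * (ε • (Δᵀ * Δ) - Γ))) := by
    have h1 : Xᵀ * W' * (N - 1) = Xᵀ * (W' - W) * (N - 1) + Xᵀ * W * (N - 1) := by
      rw [← Matrix.add_mul, ← Matrix.mul_add, sub_add_cancel]
    have h2 : Xᵀ * W * (N - 1) = (1 / 2 : ℝ) • (Xᵀ * W * E)
        - (1 / 2 : ℝ) • (Xᵀ * W * ((N - 1) * (N - 1))) := by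
      conv_lhs => rw [sub_one_eq_of_mul_self_eq hNN]
      simp only [Matrix.mul_sub, Matrix.mul_smul]
    have h3 : Xᵀ * (W' - W) = ε • (Xᵀ * Δ) -
        (Xᵀ * (W' - W) * (N - 1) + Xᵀ * W * (N - 1)) := by rw [← h1]; exact hXdiff
    conv_lhs => rw [h3, h2, hE]
    simp only [Matrix.mul_add, Matrix.mul_smul, Matrix.mul_sub _ _ Γ]
    module
  rw [hrem]
  have h1 := norm_mul_le_of_le' hd hN1
  have h2 : ‖(1 / 2 : ℝ) • (Xᵀ * W * ((N - 1) * (N - 1)))‖ ≤ _ :=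
    norm_smul_le' (by norm_num) (norm_mul_le_of_le' (norm_transpose_mul_le hX hW)
      (norm_mul_le_of_le' hN1 hN1))
  have h3 : ‖(1 / 2 : ℝ) • (ε • (Xᵀ * W * (ε • (Δᵀ * Δ) - Γ)))‖ ≤ _ :=
    norm_smul_le' (by norm_num) (norm_smul_le' hε
      (norm_mul_le_of_le' (norm_transpose_mul_le hX hW) hΓ))
  have h4 : 0 ≤ L ^ 2 * ε * κ := by positivity
  have h5 : 0 ≤ L ^ 4 * ε ^ 2 := by positivity
  calc _ ≤ ‖Xᵀ * (W' - W) * (N - 1)‖ + ‖(1 / 2 : ℝ) • (Xᵀ * W * ((N - 1) * (N - 1)))‖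
        + ‖(1 / 2 : ℝ) • (ε • (Xᵀ * W * (ε • (Δᵀ * Δ) - Γ)))‖ := by
        refine (norm_sub_le _ _).trans (add_le_add_left ((norm_add_le _ _).trans ?_) _)
        rw [norm_neg]
    _ ≤ 4 * L ^ 3 * ε * (3 * L * ε) + 1 / 2 * (L * L * (3 * L * ε * (3 * L * ε)))
        + 1 / 2 * (ε * (L * L * κ)) := by linarith
    _ = 16.5 * (L ^ 4 * ε ^ 2) + 0.5 * (L ^ 2 * ε * κ) := by ring
    _ ≤ 17 * L ^ 4 * ε ^ 2 + L ^ 2 * ε * κ := by linarith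

end Frobenius

/-! ### One step of the overlaps -/

section Increment

variable {n d : ℕ}

/-- The overlaps `P = UᵀV`, `Q = UᵀW`, `R = VᵀW`, `S = VᵀV`, in this order. The block `Z = WᵀW`
is constant and is left out. -/
def overlap (U V W : Matrix (Fin n) (Fin d) ℝ) : Fin 4 → Matrix (Fin d) (Fin d) ℝ
  | 0 => Uᵀ * V
  | 1 => Uᵀ * W
  | 2 => Vᵀ * W
  | 3 => Vᵀ * V

/-- The raw generator direction `τ̃ W Wᵀ C`, where `C` stands for `ỹ c̃ᵀ`. -/
def genRaw (τt : ℝ) (W C : Matrix (Fin n) (Fin d) ℝ) : Matrix (Fin n) (Fin d) ℝ :=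
  W * (τt • (Wᵀ * C))

/-- The generator direction, made tangent to the set of matrices with unit columns. -/
def genDir (τt : ℝ) (V W C : Matrix (Fin n) (Fin d) ℝ) : Matrix (Fin n) (Fin d) ℝ :=
  genRaw τt W C - V * diagPart (Vᵀ * genRaw τt W C)

/-- The raw discriminator direction `τ (A - B) W`, where `A`, `B` stand for `y yᵀ`, `ỹ ỹᵀ`. -/
def discRaw (τ : ℝ) (W : Matrix (Fin n) (Fin d) ℝ) (A B : Matrix (Fin n) (Fin n) ℝ) :
    Matrix (Fin n) (Fin d) ℝ :=
  τ • ((A - B) * W)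

/-- The limit of the quadratic term `Δᵀ Δ / n` of the discriminator step `Δ`: the norms
`|y|² / n`, `|ỹ|² / n` are replaced by `η_T`, `η_G`, and `y · ỹ / n` by `0`. -/
def discQuad (τ ηT ηG : ℝ) (W : Matrix (Fin n) (Fin d) ℝ) (A B : Matrix (Fin n) (Fin n) ℝ) :
    Matrix (Fin d) (Fin d) ℝ :=
  τ ^ 2 • (ηT • (Wᵀ * A * W) + ηG • (Wᵀ * B * W))

/-- Twice the correction that restores the orthonormality of the columns of `W`. -/
def discCorr (τ ηT ηG : ℝ) (W : Matrix (Fin n) (Fin d) ℝ) (A B : Matrix (Fin n) (Fin n) ℝ) :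
    Matrix (Fin d) (Fin d) ℝ :=
  Wᵀ * discRaw τ W A B + (discRaw τ W A B)ᵀ * W + discQuad τ ηT ηG W A B

/-- The leading part of `n` times the increment of the overlaps in one step, a linear function of
the data matrices `A = y yᵀ`, `B = ỹ ỹᵀ`, `C = ỹ c̃ᵀ`. -/
noncomputable def leadInc (τ τt ηT ηG : ℝ) (U V W : Matrix (Fin n) (Fin d) ℝ)
    (A B : Matrix (Fin n) (Fin n) ℝ) (C : Matrix (Fin n) (Fin d) ℝ) :
    Fin 4 → Matrix (Fin d) (Fin d) ℝ
  | 0 => Uᵀ * genDir τt V W C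
  | 1 => Uᵀ * discRaw τ W A B - (1 / 2 : ℝ) • (Uᵀ * W * discCorr τ ηT ηG W A B)
  | 2 => Vᵀ * discRaw τ W A B - (1 / 2 : ℝ) • (Vᵀ * W * discCorr τ ηT ηG W A B)
      + (genDir τt V W C)ᵀ * W
  | 3 => Vᵀ * genDir τt V W C + (genDir τt V W C)ᵀ * V

attribute [local instance] Matrix.frobeniusNormedAddCommGroup Matrix.frobeniusNormedSpace

/-- The step sizes of one update, all bounded by `L`, while `κ` bounds the fluctuation of the
quadratic term of the discriminator step. Only overlaps of the discriminator direction are bounded: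
its norm is of order `√n`. -/
structure StepBound (τ τt ηT ηG ε L κ : ℝ) (U V W : Matrix (Fin n) (Fin d) ℝ)
    (A B : Matrix (Fin n) (Fin n) ℝ) (C : Matrix (Fin n) (Fin d) ℝ) : Prop where
  one_le : 1 ≤ L
  normU : ‖U‖ ≤ L
  normV : ‖V‖ ≤ L
  normW : ‖W‖ ≤ L
  gen_small : ‖τt • (Wᵀ * C)‖ ≤ L
  gen : ‖genRaw τt W C‖ ≤ L
  discU : ‖Uᵀ * discRaw τ W A B‖ ≤ L
  discV : ‖Vᵀ * discRaw τ W A B‖ ≤ L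
  discW : ‖Wᵀ * discRaw τ W A B‖ ≤ L
  quad : ‖ε • ((discRaw τ W A B)ᵀ * discRaw τ W A B)‖ ≤ L
  quad_lim : ‖discQuad τ ηT ηG W A B‖ ≤ L
  fluct : ‖ε • ((discRaw τ W A B)ᵀ * discRaw τ W A B) - discQuad τ ηT ηG W A B‖ ≤ κ

variable {τ τt ηT ηG ε L κ : ℝ} {U V W V' W' : Matrix (Fin n) (Fin d) ℝ}
  {A B : Matrix (Fin n) (Fin n) ℝ} {C : Matrix (Fin n) (Fin d) ℝ}

theorem StepBound.norm_genDir_le (h : StepBound τ τt ηT ηG ε L κ U V W A B C) :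
    ‖genDir τt V W C‖ ≤ 2 * L ^ 3 := by
  have hL := h.one_le
  have h1 : ‖V * diagPart (Vᵀ * genRaw τt W C)‖ ≤ L * (L * L) :=
    norm_mul_le_of_le' h.normV ((norm_diagPart_le _).trans (norm_transpose_mul_le h.normV h.gen))
  have h2 : L ≤ L ^ 3 := le_self_pow₀ hL (by norm_num)
  calc _ ≤ _ := norm_sub_le _ _
    _ ≤ L + L * (L * L) := add_le_add h.gen h1
    _ ≤ 2 * L ^ 3 := by nlinarith

theorem StepBound.norm_discCorr_le (h : StepBound τ τt ηT ηG ε L κ U V W A B C) :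
    ‖discCorr τ ηT ηG W A B‖ ≤ 3 * L := by
  have h1 : ‖(discRaw τ W A B)ᵀ * W‖ ≤ L := by
    rw [← norm_transpose', Matrix.transpose_mul, Matrix.transpose_transpose]; exact h.discW
  exact norm_add₃_le.trans (by linarith [h.discW, h.quad_lim])

theorem StepBound.norm_leadInc_le (h : StepBound τ τt ηT ηG ε L κ U V W A B C) (m : Fin 4) :
    ‖leadInc τ τt ηT ηG U V W A B C m‖ ≤ 6 * L ^ 4 := by
  have hL := h.one_le
  have hL0 : 0 ≤ L := by linarith
  have hG := h.norm_genDir_le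
  have hC := h.norm_discCorr_le
  have p1 : L ≤ L ^ 4 := le_self_pow₀ hL (by norm_num)
  have p3 : L ^ 3 ≤ L ^ 4 := pow_le_pow_right₀ hL (by norm_num)
  have hT : ∀ X : Matrix (Fin n) (Fin d) ℝ, ‖X‖ ≤ L → ‖(genDir τt V W C)ᵀ * X‖ ≤ 2 * L ^ 4 :=
    fun X hX => (norm_transpose_mul_le hG hX).trans (by linarith [pow_succ L 3])
  have hT' : ∀ X : Matrix (Fin n) (Fin d) ℝ, ‖X‖ ≤ L → ‖Xᵀ * genDir τt V W C‖ ≤ 2 * L ^ 4 :=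
    fun X hX => (norm_transpose_mul_le hX hG).trans (by linarith [pow_succ L 3])
  have hD : ∀ X : Matrix (Fin n) (Fin d) ℝ, ‖X‖ ≤ L → ‖Xᵀ * discRaw τ W A B‖ ≤ L →
      ‖Xᵀ * discRaw τ W A B - (1 / 2 : ℝ) • (Xᵀ * W * discCorr τ ηT ηG W A B)‖ ≤ 3 * L ^ 4 :=
    fun X hX hXD => by
      have h1 : ‖(1 / 2 : ℝ) • (Xᵀ * W * discCorr τ ηT ηG W A B)‖ ≤ 1 / 2 * (L * L * (3 * L)) :=
        norm_smul_le' (by norm_num)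
          (norm_mul_le_of_le' (norm_transpose_mul_le hX h.normW) hC)
      exact (norm_sub_le _ _).trans (by nlinarith)
  fin_cases m
  · exact (hT' U h.normU).trans (by linarith)
  · exact (hD U h.normU h.discU).trans (by linarith)
  · exact (norm_add_le _ _).trans (by linarith [hD V h.normV h.discV, hT W h.normW])
  · exact (norm_add_le _ _).trans (by linarith [hT' V h.normV, hT V h.normV])

/-- One step of the overlaps agrees with its leading part up to the second order. -/
theorem StepBound.norm_overlap_sub_le (h : StepBound τ τt ηT ηG ε L κ U V W A B C)
    (hε : 0 ≤ ε) (hε1 : ε ≤ 1) (hVd : diagPart (Vᵀ * V) = 1) (hVd' : diagPart (V'ᵀ * V') = 1)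
    (hV' : ‖V'‖ ≤ L) (hWo : Wᵀ * W = 1) (hWo' : W'ᵀ * W' = 1) (hW' : ‖W'‖ ≤ L)
    {s : Fin d → ℝ} (hs : ∀ j, 0 ≤ s j) (hA : V + ε • genRaw τt W C = V' * Matrix.diagonal s)
    {N : Matrix (Fin d) (Fin d) ℝ} (hsymm : Nᵀ = N) (hpos : ∀ x, 0 ≤ x ⬝ᵥ (N *ᵥ x))
    (hB : W + ε • discRaw τ W A B = W' * N) (m : Fin 4) :
    ‖overlap U V' W' m - overlap U V W m - ε • leadInc τ τt ηT ηG U V W A B C m‖ ≤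
      100 * L ^ 6 * (ε ^ 2 + ε * κ) := by
  have hL := h.one_le
  have hL0 : 0 ≤ L := by linarith
  have hκ : 0 ≤ κ := (norm_nonneg _).trans h.fluct
  obtain ⟨hV1, hV2⟩ := normalize_expansion hε hε1 hL hVd hVd' hs hA h.normV hV' h.gen
  have hW2 := fun (X : Matrix (Fin n) (Fin d) ℝ) (hX : ‖X‖ ≤ L)
      (hXD : ‖Xᵀ * discRaw τ W A B‖ ≤ L) =>
    orthonormalize_expansion (X := X) hε hL hWo hWo' hsymm hpos hB h.normW hW' hX hXD h.discW
      h.quad h.fluct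
  set r := V' - V - ε • genDir τt V W C with hr
  have hV2' : ‖r‖ ≤ 17 * L ^ 5 * ε ^ 2 := hV2
  have p4 : L ^ 4 ≤ L ^ 6 := pow_le_pow_right₀ hL (by norm_num)
  have p5 : L ^ 5 ≤ L ^ 6 := pow_le_pow_right₀ hL (by norm_num)
  have p2 : L ^ 2 ≤ L ^ 6 := pow_le_pow_right₀ hL (by norm_num)
  have e0 : 0 ≤ ε ^ 2 := sq_nonneg _
  have ek : 0 ≤ ε * κ := mul_nonneg hε hκ
  have q4 := mul_le_mul_of_nonneg_right p4 e0
  have q5 := mul_le_mul_of_nonneg_right p5 e0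
  have q2 := mul_le_mul_of_nonneg_right p2 ek
  have q6 : 0 ≤ L ^ 6 * ε ^ 2 := by positivity
  have q6' : 0 ≤ L ^ 6 * (ε * κ) := by positivity
  have hVr : V' - V = ε • genDir τt V W C + r := by rw [hr]; abel
  have hXr : ∀ X : Matrix (Fin n) (Fin d) ℝ, ‖X‖ ≤ L → ‖Xᵀ * r‖ ≤ 17 * (L ^ 6 * ε ^ 2) :=
    fun X hX => (norm_transpose_mul_le hX hV2').trans (le_of_eq (by ring))
  have hrX : ∀ X : Matrix (Fin n) (Fin d) ℝ, ‖X‖ ≤ L → ‖rᵀ * X‖ ≤ 17 * (L ^ 6 * ε ^ 2) :=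
    fun X hX => (norm_transpose_mul_le hV2' hX).trans (le_of_eq (by ring))
  fin_cases m
  · have : Uᵀ * V' - Uᵀ * V - ε • (Uᵀ * genDir τt V W C) = Uᵀ * r := by
      rw [hr, Matrix.mul_sub, Matrix.mul_sub, Matrix.mul_smul]
    change ‖Uᵀ * V' - Uᵀ * V - ε • (Uᵀ * genDir τt V W C)‖ ≤ _
    rw [this]
    exact (hXr U h.normU).trans (by nlinarith)
  · change ‖Uᵀ * W' - Uᵀ * W - ε • (Uᵀ * discRaw τ W A B
      - (1 / 2 : ℝ) • (Uᵀ * W * discCorr τ ηT ηG W A B))‖ ≤ _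
    rw [← Matrix.mul_sub]
    exact (hW2 U h.normU h.discU).2.trans (by nlinarith)
  · set t := Vᵀ * (W' - W) - ε • (Vᵀ * discRaw τ W A B
      - (1 / 2 : ℝ) • (Vᵀ * W * discCorr τ ηT ηG W A B)) with ht
    have htn : ‖t‖ ≤ 17 * L ^ 4 * ε ^ 2 + L ^ 2 * ε * κ := (hW2 V h.normV h.discV).2
    have hgen : (genDir τt V W C)ᵀ * (W' - W) = (τt • (Wᵀ * C))ᵀ * (Wᵀ * (W' - W))
        - diagPart (Vᵀ * genRaw τt W C) * (Vᵀ * (W' - W)) := by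
      rw [genDir, Matrix.transpose_sub, Matrix.sub_mul, Matrix.transpose_mul V, diagPart_transpose,
        Matrix.mul_assoc (diagPart _)]
      congr 1
      rw [genRaw, Matrix.transpose_mul, Matrix.mul_assoc]
    have hgenn : ‖(genDir τt V W C)ᵀ * (W' - W)‖ ≤ L * (4 * L ^ 3 * ε)
        + L * L * (4 * L ^ 3 * ε) := by
      rw [hgen]
      refine (norm_sub_le _ _).trans (add_le_add
        (norm_transpose_mul_le h.gen_small (hW2 W h.normW h.discW).1)
        (norm_mul_le_of_le' ((norm_diagPart_le _).trans (norm_transpose_mul_le h.normV h.gen))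
          (hW2 V h.normV h.discV).1))
    have hid : V'ᵀ * W' - Vᵀ * W - ε • (Vᵀ * discRaw τ W A B
        - (1 / 2 : ℝ) • (Vᵀ * W * discCorr τ ηT ηG W A B) + (genDir τt V W C)ᵀ * W) =
        t + rᵀ * W' + ε • ((genDir τt V W C)ᵀ * (W' - W)) := by
      have h1 : V'ᵀ * W' = (V' - V)ᵀ * W' + Vᵀ * W' := by
        rw [← Matrix.add_mul, ← Matrix.transpose_add, sub_add_cancel]
      rw [ht, h1, hVr]
      simp only [Matrix.transpose_add, Matrix.transpose_smul, Matrix.add_mul, Matrix.smul_mul,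
        Matrix.mul_sub]
      module
    change ‖V'ᵀ * W' - Vᵀ * W - ε • (Vᵀ * discRaw τ W A B
      - (1 / 2 : ℝ) • (Vᵀ * W * discCorr τ ηT ηG W A B) + (genDir τt V W C)ᵀ * W)‖ ≤ _
    rw [hid]
    calc _ ≤ ‖t‖ + ‖rᵀ * W'‖ + ‖ε • ((genDir τt V W C)ᵀ * (W' - W))‖ := norm_add₃_le
      _ ≤ (17 * L ^ 4 * ε ^ 2 + L ^ 2 * ε * κ) + 17 * (L ^ 6 * ε ^ 2)
          + ε * (L * (4 * L ^ 3 * ε) + L * L * (4 * L ^ 3 * ε)) :=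
        add_le_add (add_le_add htn (hrX W' hW')) (norm_smul_le' hε hgenn)
      _ = 21 * (L ^ 4 * ε ^ 2) + 4 * (L ^ 5 * ε ^ 2) + 17 * (L ^ 6 * ε ^ 2)
          + L ^ 2 * (ε * κ) := by ring
      _ ≤ _ := by nlinarith
  · have hid : V'ᵀ * V' - Vᵀ * V - ε • (Vᵀ * genDir τt V W C + (genDir τt V W C)ᵀ * V) =
        Vᵀ * r + rᵀ * V + (V' - V)ᵀ * (V' - V) := by
      have h1 : V' = V + (V' - V) := by abel
      have h2 : V'ᵀ * V' = Vᵀ * V + Vᵀ * (V' - V) + (V' - V)ᵀ * V + (V' - V)ᵀ * (V' - V) := by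
        conv_lhs => rw [h1]
        rw [Matrix.transpose_add, Matrix.add_mul, Matrix.mul_add, Matrix.mul_add]
        abel
      have h3 : Vᵀ * (V' - V) = ε • (Vᵀ * genDir τt V W C) + Vᵀ * r := by
        rw [hVr, Matrix.mul_add, Matrix.mul_smul]
      have h4 : (V' - V)ᵀ * V = ε • ((genDir τt V W C)ᵀ * V) + rᵀ * V := by
        rw [hVr, Matrix.transpose_add, Matrix.transpose_smul, Matrix.add_mul, Matrix.smul_mul]
      rw [h2, h3, h4]
      module
    change ‖V'ᵀ * V' - Vᵀ * V
      - ε • (Vᵀ * genDir τt V W C + (genDir τt V W C)ᵀ * V)‖ ≤ _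
    rw [hid]
    calc _ ≤ ‖Vᵀ * r‖ + ‖rᵀ * V‖ + ‖(V' - V)ᵀ * (V' - V)‖ := norm_add₃_le
      _ ≤ 17 * (L ^ 6 * ε ^ 2) + 17 * (L ^ 6 * ε ^ 2)
          + 4 * L ^ 3 * ε * (4 * L ^ 3 * ε) :=
        add_le_add (add_le_add (hXr V h.normV) (hrX V h.normV)) (norm_transpose_mul_le hV1 hV1)
      _ ≤ _ := by nlinarith

end Increment

/-! ### Mean of one step -/

/-- The right-hand side of the macroscopic equation for `(P, Q, R, S)`. -/
noncomputable def drift {d : ℕ} (τ τt ηT ηG : ℝ) (Λ Λt : Matrix (Fin d) (Fin d) ℝ)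
    (x : Fin 4 → Matrix (Fin d) (Fin d) ℝ) : Fin 4 → Matrix (Fin d) (Fin d) ℝ
  | 0 => τt • (x 1 * (x 2)ᵀ * Λt + x 0 * Lmat Λt (x 2))
  | 1 => τ • (Λ * x 1 - x 0 * Λt * x 2 + x 1 * Hmat τ ηT ηG Λ Λt (x 1) (x 2))
  | 2 => τ • ((x 0)ᵀ * Λ * x 1 - x 3 * Λt * x 2 + x 2 * Hmat τ ηT ηG Λ Λt (x 1) (x 2))
        + τt • ((Λt + Lmat Λt (x 2)) * x 2)
  | 3 => τt • (x 2 * (x 2)ᵀ * Λt + Λt * x 2 * (x 2)ᵀ + x 3 * Lmat Λt (x 2)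
        + Lmat Λt (x 2) * x 3)

theorem Lmat_eq_neg_diagPart {d : ℕ} (Λt R : Matrix (Fin d) (Fin d) ℝ) :
    Lmat Λt R = -diagPart (R * Rᵀ * Λt) := rfl

theorem diagPart_smul {n : Type*} [DecidableEq n] (c : ℝ) (A : Matrix n n ℝ) :
    diagPart (c • A) = c • diagPart A := by
  simp [diagPart, Matrix.diag_smul, Matrix.diagonal_smul]

section MeanAlgebra

variable {n d : ℕ} {U V W : Matrix (Fin n) (Fin d) ℝ} {Λ Λt : Matrix (Fin d) (Fin d) ℝ}

theorem transpose_mul_discRaw_mean (X : Matrix (Fin n) (Fin d) ℝ) (τ ηT ηG : ℝ) :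
    Xᵀ * discRaw τ W (U * Λ * Uᵀ + ηT • 1) (V * Λt * Vᵀ + ηG • 1) =
      τ • (Xᵀ * U * Λ * (Uᵀ * W) - Xᵀ * V * Λt * (Vᵀ * W) + (ηT - ηG) • (Xᵀ * W)) := by
  simp only [discRaw, Matrix.mul_smul, Matrix.sub_mul, Matrix.add_mul, Matrix.mul_sub,
    Matrix.mul_add, Matrix.smul_mul, Matrix.one_mul, Matrix.mul_assoc]
  module

theorem discCorr_mean (hW : Wᵀ * W = 1) (hΛ : Λᵀ = Λ) (hΛt : Λtᵀ = Λt) (τ ηT ηG : ℝ) :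
    discCorr τ ηT ηG W (U * Λ * Uᵀ + ηT • 1) (V * Λt * Vᵀ + ηG • 1) =
      (2 * τ) • ((ηT - ηG) • 1 - Hmat τ ηT ηG Λ Λt (Uᵀ * W) (Vᵀ * W)) := by
  have h1 := transpose_mul_discRaw_mean (U := U) (V := V) (Λ := Λ) (Λt := Λt) (W := W) W τ ηT ηG
  have hQ : Wᵀ * U = (Uᵀ * W)ᵀ := by simp
  have hR : Wᵀ * V = (Vᵀ * W)ᵀ := by simp
  rw [hW, hQ, hR] at h1
  have h2 : (discRaw τ W (U * Λ * Uᵀ + ηT • 1) (V * Λt * Vᵀ + ηG • 1))ᵀ * W =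
      (Wᵀ * discRaw τ W (U * Λ * Uᵀ + ηT • 1) (V * Λt * Vᵀ + ηG • 1))ᵀ := by
    rw [Matrix.transpose_mul, Matrix.transpose_transpose]
  have h3 : Wᵀ * (U * Λ * Uᵀ + ηT • 1) * W = (Uᵀ * W)ᵀ * Λ * (Uᵀ * W) + ηT • 1 := by
    simp only [Matrix.add_mul, Matrix.mul_add, Matrix.smul_mul, Matrix.mul_smul,
      Matrix.mul_one, hW, ← hQ, Matrix.mul_assoc]
  have h4 : Wᵀ * (V * Λt * Vᵀ + ηG • 1) * W = (Vᵀ * W)ᵀ * Λt * (Vᵀ * W) + ηG • 1 := by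
    simp only [Matrix.add_mul, Matrix.mul_add, Matrix.smul_mul, Matrix.mul_smul,
      Matrix.mul_one, hW, ← hR, Matrix.mul_assoc]
  rw [discCorr, h2, h1, discQuad, h3, h4, Hmat]
  simp only [Matrix.transpose_smul, Matrix.transpose_add, Matrix.transpose_sub,
    Matrix.transpose_mul, Matrix.transpose_transpose, Matrix.transpose_one, hΛ, hΛt,
    Matrix.mul_assoc]
  module

theorem leadInc_mean (hU : Uᵀ * U = 1) (hW : Wᵀ * W = 1) (hΛ : Λᵀ = Λ) (hΛt : Λtᵀ = Λt)
    (τ τt ηT ηG : ℝ) (m : Fin 4) :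
    leadInc τ τt ηT ηG U V W (U * Λ * Uᵀ + ηT • 1) (V * Λt * Vᵀ + ηG • 1) (V * Λt) m =
      drift τ τt ηT ηG Λ Λt (overlap U V W) m := by
  have hraw : ∀ X : Matrix (Fin n) (Fin d) ℝ, Xᵀ * genRaw τt W (V * Λt) =
      τt • (Xᵀ * W * (Vᵀ * W)ᵀ * Λt) := fun X => by
    simp [genRaw, Matrix.mul_assoc]
  have hgen : ∀ X : Matrix (Fin n) (Fin d) ℝ, Xᵀ * genDir τt V W (V * Λt) =
      τt • (Xᵀ * W * (Vᵀ * W)ᵀ * Λt + Xᵀ * V * Lmat Λt (Vᵀ * W)) := fun X => by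
    rw [genDir, Matrix.mul_sub, hraw, ← Matrix.mul_assoc, hraw, diagPart_smul,
      Lmat_eq_neg_diagPart, Matrix.mul_smul, Matrix.mul_neg]
    module
  have hL : (Lmat Λt (Vᵀ * W))ᵀ = Lmat Λt (Vᵀ * W) := by
    rw [Lmat_eq_neg_diagPart, Matrix.transpose_neg, diagPart_transpose]
  have hgenT : ∀ X : Matrix (Fin n) (Fin d) ℝ, (genDir τt V W (V * Λt))ᵀ * X =
      τt • (Λt * (Vᵀ * W) * (Xᵀ * W)ᵀ + Lmat Λt (Vᵀ * W) * (Xᵀ * V)ᵀ) := fun X => by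
    have h1 : (genDir τt V W (V * Λt))ᵀ * X = (Xᵀ * genDir τt V W (V * Λt))ᵀ := by
      rw [Matrix.transpose_mul, Matrix.transpose_transpose]
    rw [h1, hgen X, Matrix.transpose_smul, Matrix.transpose_add,
      Matrix.transpose_mul (Xᵀ * W * (Vᵀ * W)ᵀ) Λt, Matrix.transpose_mul (Xᵀ * W) (Vᵀ * W)ᵀ,
      Matrix.transpose_mul (Xᵀ * V) (Lmat _ _), Matrix.transpose_transpose (Vᵀ * W), hΛt, hL,
      Matrix.mul_assoc Λt]
  have hR : Wᵀ * V = (Vᵀ * W)ᵀ := by simp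
  have hP : Vᵀ * U = (Uᵀ * V)ᵀ := by simp
  have hS : (Vᵀ * V)ᵀ = Vᵀ * V := by simp
  fin_cases m
  · exact hgen U
  · change Uᵀ * discRaw τ W _ _ - (1 / 2 : ℝ) • (Uᵀ * W * discCorr τ ηT ηG W _ _) =
      τ • (Λ * (Uᵀ * W) - Uᵀ * V * Λt * (Vᵀ * W)
        + Uᵀ * W * Hmat τ ηT ηG Λ Λt (Uᵀ * W) (Vᵀ * W))
    rw [transpose_mul_discRaw_mean, discCorr_mean hW hΛ hΛt, hU, Matrix.one_mul, Matrix.mul_smul,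
      Matrix.mul_sub, Matrix.mul_smul, Matrix.mul_one]
    module
  · change Vᵀ * discRaw τ W _ _ - (1 / 2 : ℝ) • (Vᵀ * W * discCorr τ ηT ηG W _ _)
      + (genDir τt V W (V * Λt))ᵀ * W =
      τ • ((Uᵀ * V)ᵀ * Λ * (Uᵀ * W) - Vᵀ * V * Λt * (Vᵀ * W)
        + Vᵀ * W * Hmat τ ηT ηG Λ Λt (Uᵀ * W) (Vᵀ * W))
      + τt • ((Λt + Lmat Λt (Vᵀ * W)) * (Vᵀ * W))
    rw [hgenT W, transpose_mul_discRaw_mean, discCorr_mean hW hΛ hΛt, hP, hR, hW,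
      Matrix.transpose_one, Matrix.mul_one, Matrix.transpose_transpose, Matrix.add_mul,
      Matrix.mul_smul, Matrix.mul_sub, Matrix.mul_smul, Matrix.mul_one]
    module
  · change Vᵀ * genDir τt V W (V * Λt) + (genDir τt V W (V * Λt))ᵀ * V =
      τt • (Vᵀ * W * (Vᵀ * W)ᵀ * Λt + Λt * (Vᵀ * W) * (Vᵀ * W)ᵀ
        + Vᵀ * V * Lmat Λt (Vᵀ * W) + Lmat Λt (Vᵀ * W) * (Vᵀ * V))
    rw [hgenT V, hgen V, hS]
    module

end MeanAlgebra

/-- The random matrix `f` has integrable entries, with expectations the entries of `M`. -/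
structure HasMean {Ω m n : Type*} [MeasurableSpace Ω] (μ : Measure Ω) (f : Ω → Matrix m n ℝ)
    (M : Matrix m n ℝ) : Prop where
  integrable : ∀ i j, Integrable (fun ω => f ω i j) μ
  mean : ∀ i j, ∫ ω, f ω i j ∂μ = M i j

namespace HasMean

variable {Ω l m n : Type*} [MeasurableSpace Ω] {μ : Measure Ω}
  {f g : Ω → Matrix m n ℝ} {M M' : Matrix m n ℝ}

theorem add (hf : HasMean μ f M) (hg : HasMean μ g M') :
    HasMean μ (fun ω => f ω + g ω) (M + M') where
  integrable i j := (hf.integrable i j).add (hg.integrable i j)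
  mean i j := by
    rw [Matrix.add_apply, ← hf.mean, ← hg.mean,
      ← integral_add (hf.integrable i j) (hg.integrable i j)]
    rfl

theorem sub (hf : HasMean μ f M) (hg : HasMean μ g M') :
    HasMean μ (fun ω => f ω - g ω) (M - M') where
  integrable i j := (hf.integrable i j).sub (hg.integrable i j)
  mean i j := by
    rw [Matrix.sub_apply, ← hf.mean, ← hg.mean,
      ← integral_sub (hf.integrable i j) (hg.integrable i j)]
    rfl

theorem smul (hf : HasMean μ f M) (c : ℝ) : HasMean μ (fun ω => c • f ω) (c • M) where
  integrable i j := (hf.integrable i j).const_mul c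
  mean i j := by
    rw [Matrix.smul_apply, ← hf.mean, smul_eq_mul, ← integral_const_mul]
    rfl

theorem transpose (hf : HasMean μ f M) : HasMean μ (fun ω => (f ω)ᵀ) Mᵀ where
  integrable i j := hf.integrable j i
  mean i j := hf.mean j i

theorem const_mul [Fintype m] (hf : HasMean μ f M) (A : Matrix l m ℝ) :
    HasMean μ (fun ω => A * f ω) (A * M) where
  integrable i j := by
    simp only [Matrix.mul_apply]
    exact integrable_finsetSum _ fun k _ => (hf.integrable k j).const_mul _
  mean i j := by
    simp only [Matrix.mul_apply]
    rw [integral_finsetSum _ fun k _ => (hf.integrable k j).const_mul _]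
    simp only [integral_const_mul, hf.mean]

theorem mul_const [Fintype n] (hf : HasMean μ f M) (A : Matrix n l ℝ) :
    HasMean μ (fun ω => f ω * A) (M * A) := by
  simpa using (hf.transpose.const_mul Aᵀ).transpose

theorem diagPart [DecidableEq n] {f : Ω → Matrix n n ℝ} {M : Matrix n n ℝ}
    (hf : HasMean μ f M) : HasMean μ (fun ω => diagPart (f ω)) (GAN.diagPart M) where
  integrable i j := by
    by_cases hij : i = j
    · subst hij; simpa [GAN.diagPart] using hf.integrable i i
    · simp [GAN.diagPart, Matrix.diagonal_apply_ne _ hij]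
  mean i j := by
    by_cases hij : i = j
    · subst hij; simpa [GAN.diagPart] using hf.mean i i
    · simp [GAN.diagPart, Matrix.diagonal_apply_ne _ hij]

theorem comp_measurePreserving {Ω' : Type*} [MeasurableSpace Ω'] {μ' : Measure Ω'}
    {φ : Ω' → Ω} (hφ : MeasurePreserving φ μ' μ) (hf : HasMean μ f M) :
    HasMean μ' (fun ω => f (φ ω)) M where
  integrable i j := hφ.integrable_comp_of_integrable (hf.integrable i j)
  mean i j := by
    have h := (hf.integrable i j).aestronglyMeasurable
    rw [← hφ.map_eq] at h
    rw [← hf.mean i j, ← hφ.map_eq, integral_map hφ.measurable.aemeasurable h]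

variable {d k : ℕ} {A B : Ω → Matrix (Fin k) (Fin k) ℝ} {C : Ω → Matrix (Fin k) (Fin d) ℝ}
  {A₀ B₀ : Matrix (Fin k) (Fin k) ℝ} {C₀ : Matrix (Fin k) (Fin d) ℝ}

theorem leadInc (hA : HasMean μ A A₀) (hB : HasMean μ B B₀) (hC : HasMean μ C C₀)
    (τ τt ηT ηG : ℝ) (U V W : Matrix (Fin k) (Fin d) ℝ) (i : Fin 4) :
    HasMean μ (fun ω => GAN.leadInc τ τt ηT ηG U V W (A ω) (B ω) (C ω) i)
      (GAN.leadInc τ τt ηT ηG U V W A₀ B₀ C₀ i) := by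
  have hraw : HasMean μ (fun ω => genRaw τt W (C ω)) (genRaw τt W C₀) :=
    ((hC.const_mul _).smul τt).const_mul W
  have hgen : HasMean μ (fun ω => genDir τt V W (C ω)) (genDir τt V W C₀) :=
    hraw.sub ((hraw.const_mul _).diagPart.const_mul V)
  have hdisc : HasMean μ (fun ω => discRaw τ W (A ω) (B ω)) (discRaw τ W A₀ B₀) :=
    ((hA.sub hB).mul_const W).smul τ
  have hquad : HasMean μ (fun ω => discQuad τ ηT ηG W (A ω) (B ω)) (discQuad τ ηT ηG W A₀ B₀) :=
    ((((hA.const_mul _).mul_const W).smul ηT).add (((hB.const_mul _).mul_const W).smul ηG)).smul _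
  have hcorr : HasMean μ (fun ω => discCorr τ ηT ηG W (A ω) (B ω)) (discCorr τ ηT ηG W A₀ B₀) :=
    ((hdisc.const_mul _).add (hdisc.transpose.mul_const W)).add hquad
  have hX : ∀ X : Matrix (Fin k) (Fin d) ℝ, HasMean μ
      (fun ω => Xᵀ * discRaw τ W (A ω) (B ω)
        - (1 / 2 : ℝ) • (Xᵀ * W * discCorr τ ηT ηG W (A ω) (B ω)))
      (Xᵀ * discRaw τ W A₀ B₀ - (1 / 2 : ℝ) • (Xᵀ * W * discCorr τ ηT ηG W A₀ B₀)) :=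
    fun X => (hdisc.const_mul _).sub ((hcorr.const_mul _).smul _)
  fin_cases i
  · exact hgen.const_mul _
  · exact hX U
  · exact (hX V).add (hgen.transpose.mul_const W)
  · exact (hgen.const_mul _).add (hgen.transpose.mul_const V)

end HasMean

/-! ### Moments of the Gaussian noise -/

instance (n : ℕ) : IsProbabilityMeasure (stdGauss n) := by
  unfold stdGauss; infer_instance

theorem measurePreserving_stdGauss_apply {n : ℕ} (i : Fin n) :
    MeasurePreserving (fun a : Fin n → ℝ => a i) (stdGauss n) (gaussianReal 0 1) :=
  measurePreserving_eval (fun _ : Fin n => gaussianReal 0 1) i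

/-- A unit vector `u` maps the standard Gaussian law of `ℝⁿ` to the one of `ℝ`. -/
theorem map_stdGauss_dotProduct {n : ℕ} {u : Fin n → ℝ} (hu : ∑ i, u i ^ 2 = 1) :
    (stdGauss n).map (fun a => ∑ i, u i * a i) = gaussianReal 0 1 := by
  have hmeas : Measurable fun a : Fin n → ℝ => ∑ i, u i * a i := by fun_prop
  have := Measure.isProbabilityMeasure_map (μ := stdGauss n) hmeas.aemeasurable
  refine Measure.ext_of_charFun ?_
  funext t
  rw [charFun_apply_real, integral_map hmeas.aemeasurable (by fun_prop), stdGauss]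
  have h1 : ∀ a : Fin n → ℝ, Complex.exp (t * ((∑ i, u i * a i : ℝ) : ℂ) * Complex.I) =
      ∏ i, Complex.exp (((t * u i : ℝ) : ℂ) * (a i : ℂ) * Complex.I) := fun a => by
    rw [← Complex.exp_sum]
    congr 1
    push_cast
    rw [Finset.mul_sum, Finset.sum_mul]
    exact Finset.sum_congr rfl fun i _ => by ring
  simp_rw [h1]
  rw [integral_fintype_prod_eq_prod
    (f := fun i (x : ℝ) => Complex.exp (((t * u i : ℝ) : ℂ) * (x : ℂ) * Complex.I))]
  simp_rw [← charFun_apply_real, charFun_gaussianReal]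
  rw [← Complex.exp_sum]
  congr 1
  have hu' : ∑ i, (u i : ℂ) ^ 2 = 1 := by exact_mod_cast hu
  push_cast
  simp only [mul_zero, zero_mul, zero_sub, one_mul]
  rw [Finset.sum_neg_distrib, ← Finset.sum_div]
  simp_rw [mul_pow]
  rw [← Finset.mul_sum, hu', mul_one]

theorem integral_gaussianReal_sq : ∫ x, x ^ 2 ∂(gaussianReal 0 1) = 1 := by
  have h := variance_fun_id_gaussianReal (μ := 0) (v := 1)
  rw [variance_eq_integral (by fun_prop)] at h
  simpa using h

theorem integrable_gaussianReal_pow (p : ℕ) :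
    Integrable (fun x : ℝ => x ^ p) (gaussianReal 0 1) := by
  rcases Nat.eq_zero_or_pos p with rfl | hp
  · simp
  have h := (memLp_id_gaussianReal (μ := 0) (v := 1) p).integrable_norm_pow (by simpa using hp.ne')
  refine (integrable_norm_iff (by fun_prop)).1 ?_
  simpa using h

theorem integrable_stdGauss_apply {n : ℕ} (i : Fin n) :
    Integrable (fun a : Fin n → ℝ => a i) (stdGauss n) ∧ ∫ a, a i ∂(stdGauss n) = 0 := by
  have hmp := measurePreserving_stdGauss_apply i
  refine ⟨?_, ?_⟩
  · have := hmp.integrable_comp_of_integrable (g := fun x : ℝ => x ^ 1)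
      (integrable_gaussianReal_pow 1)
    simpa [Function.comp_def] using this
  · have h0 : ∫ x, x ∂(gaussianReal 0 1) = 0 := integral_id_gaussianReal
    rw [← hmp.map_eq, integral_map hmp.measurable.aemeasurable (by fun_prop)] at h0
    exact h0

theorem hasMean_stdGauss (n : ℕ) : HasMean (stdGauss n) (fun a => vecMulVec a a) 1 := by
  have key : ∀ i j : Fin n, Integrable (fun a : Fin n → ℝ => a i * a j) (stdGauss n) ∧
      ∫ a, a i * a j ∂(stdGauss n) = (1 : Matrix (Fin n) (Fin n) ℝ) i j := by
    intro i j
    have hmp := measurePreserving_stdGauss_apply i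
    have hsq := integrable_gaussianReal_pow 2
    by_cases hij : i = j
    · subst hij
      have e : (fun a : Fin n → ℝ => a i * a i) = (fun x : ℝ => x ^ 2) ∘ (fun a => a i) := by
        funext a; simp [sq]
      refine ⟨?_, ?_⟩
      · rw [e]; exact hmp.integrable_comp_of_integrable hsq
      · rw [Matrix.one_apply_eq, ← integral_gaussianReal_sq, ← hmp.map_eq,
          integral_map hmp.measurable.aemeasurable (by fun_prop)]
        simp [sq]
    · have hI : iIndepFun (fun (i : Fin n) (a : Fin n → ℝ) => a i) (stdGauss n) :=
        iIndepFun_pi (X := fun _ x => x) fun _ => by fun_prop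
      have hind := hI.indepFun hij
      refine ⟨hind.integrable_mul (integrable_stdGauss_apply i).1
        (integrable_stdGauss_apply j).1, ?_⟩
      rw [Matrix.one_apply_ne hij]
      have := hind.integral_mul_eq_mul_integral
        (integrable_stdGauss_apply i).1.aestronglyMeasurable
        (integrable_stdGauss_apply j).1.aestronglyMeasurable
      simpa [(integrable_stdGauss_apply i).2] using this
  exact ⟨fun i j => (key i j).1, fun i j => (key i j).2⟩

/-- The fluctuation of `|a|²` around `n`: its variance is of order `n`. -/
theorem exists_integral_normSq_sub_sq_le : ∃ B : ℝ, 0 ≤ B ∧ ∀ n : ℕ,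
    Integrable (fun a : Fin n → ℝ => (a ⬝ᵥ a - n) ^ 2) (stdGauss n) ∧
      ∫ a, (a ⬝ᵥ a - n) ^ 2 ∂(stdGauss n) ≤ n * B := by
  refine ⟨Var[fun x => x ^ 2; gaussianReal 0 1], variance_nonneg _ _, fun n => ?_⟩
  have hL : MemLp (fun x : ℝ => x ^ 2) 2 (gaussianReal 0 1) := by
    rw [memLp_two_iff_integrable_sq (by fun_prop)]
    simpa [← pow_mul] using integrable_gaussianReal_pow 4
  have hLi : ∀ i : Fin n, MemLp (fun a : Fin n → ℝ => a i ^ 2) 2 (stdGauss n) := fun i =>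
    hL.comp_measurePreserving (measurePreserving_stdGauss_apply i)
  have hvar := variance_sum_pi (ι := Fin n) (μ := fun _ => gaussianReal 0 1)
    (X := fun _ x => x ^ 2) fun _ => hL
  have hfun : (fun a : Fin n → ℝ => a ⬝ᵥ a) = ∑ i, fun a : Fin n → ℝ => a i ^ 2 := by
    funext a; simp [dotProduct, sq]
  have hsumL : MemLp (fun a : Fin n → ℝ => a ⬝ᵥ a) 2 (stdGauss n) := by
    rw [hfun]; exact memLp_finsetSum' _ fun i _ => hLi i
  have hmean : ∫ a : Fin n → ℝ, a ⬝ᵥ a ∂(stdGauss n) = n := by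
    simp only [dotProduct]
    have hM := hasMean_stdGauss n
    have hi : ∀ i ∈ Finset.univ, Integrable (fun a : Fin n → ℝ => a i * a i) (stdGauss n) :=
      fun i _ => hM.integrable i i
    rw [integral_finsetSum _ hi]
    calc ∑ i, ∫ a : Fin n → ℝ, a i * a i ∂(stdGauss n) = ∑ i : Fin n, (1 : ℝ) :=
          Finset.sum_congr rfl fun i _ => (hM.mean i i).trans (Matrix.one_apply_eq i)
      _ = n := by simp
  refine ⟨(hsumL.sub (memLp_const (n : ℝ))).integrable_sq, ?_⟩
  have h1 := variance_eq_integral (X := fun a : Fin n → ℝ => a ⬝ᵥ a) (μ := stdGauss n)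
    (by fun_prop)
  rw [hmean] at h1
  rw [← h1, hfun]
  refine (hvar.trans ?_).le
  simp

/-- The scalar product of two independent standard Gaussian vectors is of order `√n`. -/
theorem integral_dotProduct_sq (n : ℕ) :
    Integrable (fun x : (Fin n → ℝ) × (Fin n → ℝ) => (x.1 ⬝ᵥ x.2) ^ 2)
      ((stdGauss n).prod (stdGauss n)) ∧
    ∫ x, (x.1 ⬝ᵥ x.2) ^ 2 ∂((stdGauss n).prod (stdGauss n)) = n := by
  have hM := hasMean_stdGauss n
  have hfun : (fun x : (Fin n → ℝ) × (Fin n → ℝ) => (x.1 ⬝ᵥ x.2) ^ 2) =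
      fun x => ∑ i, ∑ j, (vecMulVec x.1 x.1 i j) * (vecMulVec x.2 x.2 i j) := by
    funext x
    rw [dotProduct, sq, Finset.sum_mul_sum]
    exact Finset.sum_congr rfl fun i _ => Finset.sum_congr rfl fun j _ => by
      simp only [vecMulVec_apply]; ring
  have hint : ∀ i j : Fin n, Integrable (fun x : (Fin n → ℝ) × (Fin n → ℝ) =>
      (vecMulVec x.1 x.1 i j) * (vecMulVec x.2 x.2 i j)) ((stdGauss n).prod (stdGauss n)) :=
    fun i j => (hM.integrable i j).mul_prod (hM.integrable i j)
  rw [hfun]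
  refine ⟨integrable_finsetSum _ fun i _ => integrable_finsetSum _ fun j _ => hint i j, ?_⟩
  rw [integral_finsetSum _ fun i _ => integrable_finsetSum _ fun j _ => hint i j]
  simp_rw [fun i => integral_finsetSum _ fun j (_ : j ∈ Finset.univ) => hint i j]
  have hval : ∀ i j : Fin n, ∫ x : (Fin n → ℝ) × (Fin n → ℝ),
      (vecMulVec x.1 x.1 i j) * (vecMulVec x.2 x.2 i j) ∂((stdGauss n).prod (stdGauss n)) =
      if i = j then 1 else 0 := fun i j => by
    rw [integral_prod_mul (fun a : Fin n → ℝ => vecMulVec a a i j)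
      (fun a : Fin n → ℝ => vecMulVec a a i j), hM.mean, Matrix.one_apply]
    split_ifs <;> simp
  simp_rw [hval]
  simp

/-! ### The noise of one step -/

/-- The noise `(c, c̃, a, ã)` of one step. -/
abbrev Noise (d n : ℕ) : Type :=
  (Fin d → ℝ) × (Fin d → ℝ) × (Fin n → ℝ) × (Fin n → ℝ)

/-- The law of the noise of one step. -/
noncomputable def noiseLaw {d : ℕ} (ν νt : Measure (Fin d → ℝ)) (n : ℕ) : Measure (Noise d n) :=
  ν.prod (νt.prod ((stdGauss n).prod (stdGauss n)))

section NoiseLaw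

variable {d n : ℕ} (ν νt : Measure (Fin d → ℝ)) [IsProbabilityMeasure ν]
  [IsProbabilityMeasure νt]

instance : IsProbabilityMeasure (noiseLaw ν νt n) := by
  unfold noiseLaw; infer_instance

theorem measurePreserving_noise_true :
    MeasurePreserving (fun x : Noise d n => (x.1, x.2.2.1)) (noiseLaw ν νt n)
      (ν.prod (stdGauss n)) :=
  (MeasurePreserving.id ν).prod (measurePreserving_fst.comp measurePreserving_snd)

theorem measurePreserving_noise_gen :
    MeasurePreserving (fun x : Noise d n => (x.2.1, x.2.2.2)) (noiseLaw ν νt n)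
      (νt.prod (stdGauss n)) :=
  ((MeasurePreserving.id νt).prod measurePreserving_snd).comp measurePreserving_snd

theorem measurePreserving_noise_gauss :
    MeasurePreserving (fun x : Noise d n => x.2.2) (noiseLaw ν νt n)
      ((stdGauss n).prod (stdGauss n)) :=
  measurePreserving_snd.comp measurePreserving_snd

end NoiseLaw

section Spiked

variable {d n : ℕ} {ν : Measure (Fin d → ℝ)} {Λ : Matrix (Fin d) (Fin d) ℝ}

theorem IsCentredLaw.isSymm (h : IsCentredLaw ν Λ) : Λᵀ = Λ := by
  ext i j
  rw [Matrix.transpose_apply, ← h.cov, ← h.cov]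
  simp_rw [mul_comm]

theorem IsCentredLaw.integrable_apply (h : IsCentredLaw ν Λ) (i : Fin d) :
    Integrable (fun x : Fin d → ℝ => x i) ν := by
  refine (h.moments 1).mono' (measurable_pi_apply i).aestronglyMeasurable (ae_of_all _ fun x => ?_)
  simpa using norm_le_pi_norm x i

theorem IsCentredLaw.hasMean (h : IsCentredLaw ν Λ) : HasMean ν (fun x => vecMulVec x x) Λ where
  integrable i j := by
    refine (h.moments 2).mono' (by simp only [vecMulVec_apply]; fun_prop) (ae_of_all _ fun x => ?_)
    rw [vecMulVec_apply, norm_mul, sq]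
    exact mul_le_mul (norm_le_pi_norm x i) (norm_le_pi_norm x j) (norm_nonneg _) (norm_nonneg _)
  mean i j := h.cov i j

theorem hasMean_cross (h : IsCentredLaw ν Λ) :
    HasMean (ν.prod (stdGauss n)) (fun x => vecMulVec x.1 x.2) 0 := by
  have := h.prob
  refine ⟨fun i j => (h.integrable_apply i).mul_prod (integrable_stdGauss_apply j).1,
    fun i j => ?_⟩
  have := integral_prod_mul (μ := ν) (ν := stdGauss n) (fun x : Fin d → ℝ => x i) (fun a => a j)
  rw [h.mean, zero_mul] at this
  simpa [vecMulVec_apply] using this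

theorem hasMean_spiked (h : IsCentredLaw ν Λ) (B : Matrix (Fin n) (Fin d) ℝ) {η : ℝ}
    (hη : 0 ≤ η) :
    HasMean (ν.prod (stdGauss n))
      (fun x => vecMulVec (spiked B η x.1 x.2) (spiked B η x.1 x.2)) (B * Λ * Bᵀ + η • 1) := by
  have := h.prob
  have h1 : HasMean (ν.prod (stdGauss n)) (fun x => vecMulVec x.1 x.1) Λ :=
    h.hasMean.comp_measurePreserving (f := fun x => vecMulVec x x) measurePreserving_fst
  have h2 : HasMean (ν.prod (stdGauss n)) (fun x => vecMulVec x.2 x.2) 1 :=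
    (hasMean_stdGauss n).comp_measurePreserving (f := fun x => vecMulVec x x)
      measurePreserving_snd
  have h3 := hasMean_cross (n := n) h
  have h4 := (((h1.const_mul B).mul_const Bᵀ).add
    (((h3.const_mul B).smul (Real.sqrt η)).add
      (((h3.const_mul B).transpose).smul (Real.sqrt η)))).add (h2.smul η)
  convert h4 using 1
  · funext x
    have hs : Real.sqrt η * Real.sqrt η = η := Real.mul_self_sqrt hη
    rw [spiked, add_vecMulVec, vecMulVec_add, vecMulVec_add, smul_vecMulVec, smul_vecMulVec,
      vecMulVec_smul, vecMulVec_smul, smul_smul, hs, mul_vecMulVec, mul_vecMulVec,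
      transpose_vecMulVec, vecMulVec_mul, vecMul_transpose]
    abel
  · simp

theorem hasMean_spiked_feature (h : IsCentredLaw ν Λ) (B : Matrix (Fin n) (Fin d) ℝ) (η : ℝ) :
    HasMean (ν.prod (stdGauss n)) (fun x => vecMulVec (spiked B η x.1 x.2) x.1) (B * Λ) := by
  have := h.prob
  have h1 : HasMean (ν.prod (stdGauss n)) (fun x => vecMulVec x.1 x.1) Λ :=
    h.hasMean.comp_measurePreserving (f := fun x => vecMulVec x x) measurePreserving_fst
  have h3 := hasMean_cross (n := n) h
  have h4 := (h1.const_mul B).add (h3.transpose.smul (Real.sqrt η))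
  convert h4 using 1
  · funext x
    rw [spiked, add_vecMulVec, smul_vecMulVec, mul_vecMulVec, transpose_vecMulVec]
  · simp

end Spiked

/-! ### Moment bounds that are uniform in the dimension -/

/-- A family of random variables, each on a probability space of its own, has moments of all
orders that are bounded uniformly over the family. -/
def UniformMoments {I : Type*} {N : I → Type*} [∀ i, MeasurableSpace (N i)]
    (ρ : ∀ i, Measure (N i)) (f : ∀ i, N i → ℝ) : Prop :=
  (∀ i, Measurable (f i)) ∧ ∀ p : ℕ, ∃ B : NNReal, ∀ i, ∫⁻ x, ‖f i x‖ₑ ^ p ∂(ρ i) ≤ B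

namespace UniformMoments

variable {I : Type*} {N : I → Type*} [∀ i, MeasurableSpace (N i)] {ρ : ∀ i, Measure (N i)}
  {f g : ∀ i, N i → ℝ}

theorem const [∀ i, IsProbabilityMeasure (ρ i)] (c : ℝ) :
    UniformMoments ρ fun _ _ => c :=
  ⟨fun _ => measurable_const, fun p => ⟨‖c‖₊ ^ p, fun i => by simp [enorm]⟩⟩

theorem add (hf : UniformMoments ρ f) (hg : UniformMoments ρ g) :
    UniformMoments ρ fun i x => f i x + g i x := by
  refine ⟨fun i => (hf.1 i).add (hg.1 i), fun p => ?_⟩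
  obtain ⟨A, hA⟩ := hf.2 p
  obtain ⟨B, hB⟩ := hg.2 p
  refine ⟨2 ^ p * (A + B), fun i => ?_⟩
  have hpt : ∀ x, ‖f i x + g i x‖ₑ ^ p ≤ 2 ^ p * (‖f i x‖ₑ ^ p + ‖g i x‖ₑ ^ p) := fun x => by
    have h1 : ‖f i x + g i x‖ₑ ≤ 2 * max ‖f i x‖ₑ ‖g i x‖ₑ := by
      refine (enorm_add_le _ _).trans ?_
      rw [two_mul]
      exact add_le_add (le_max_left _ _) (le_max_right _ _)
    refine (pow_le_pow_left' h1 p).trans ?_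
    rw [mul_pow]
    gcongr
    rcases le_total ‖f i x‖ₑ ‖g i x‖ₑ with h | h
    · rw [max_eq_right h]; exact le_add_self
    · rw [max_eq_left h]; exact le_self_add
  calc ∫⁻ x, ‖f i x + g i x‖ₑ ^ p ∂(ρ i)
      ≤ ∫⁻ x, 2 ^ p * (‖f i x‖ₑ ^ p + ‖g i x‖ₑ ^ p) ∂(ρ i) := lintegral_mono hpt
    _ = 2 ^ p * (∫⁻ x, ‖f i x‖ₑ ^ p ∂(ρ i) + ∫⁻ x, ‖g i x‖ₑ ^ p ∂(ρ i)) := by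
        have h1 : Measurable fun x => ‖f i x‖ₑ ^ p := (hf.1 i).enorm.pow_const p
        have h2 : Measurable fun x => ‖g i x‖ₑ ^ p := (hg.1 i).enorm.pow_const p
        rw [lintegral_const_mul (f := fun x => ‖f i x‖ₑ ^ p + ‖g i x‖ₑ ^ p) _ (h1.add h2),
          lintegral_add_left h1]
    _ ≤ 2 ^ p * (A + B) := by gcongr <;> [exact hA i; exact hB i]
    _ = ((2 ^ p * (A + B) : NNReal) : ENNReal) := by push_cast; rfl

theorem abs (hf : UniformMoments ρ f) : UniformMoments ρ fun i x => |f i x| :=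
  ⟨fun i => (hf.1 i).abs, fun p => by simpa using hf.2 p⟩

theorem sum [∀ i, IsProbabilityMeasure (ρ i)] {J : Type*} (s : Finset J)
    {f : J → ∀ i, N i → ℝ} (hf : ∀ j, UniformMoments ρ (f j)) :
    UniformMoments ρ fun i x => ∑ j ∈ s, f j i x := by
  classical
  induction s using Finset.induction_on with
  | empty => simpa using const (ρ := ρ) 0
  | insert j s hj ih =>
    simp only [Finset.sum_insert hj]
    exact (hf j).add ih

theorem of_measurePreserving {E : Type*} [MeasurableSpace E] {γ : Measure E} {g : E → ℝ}
    (hg : Measurable g) (hmom : ∀ p : ℕ, ∫⁻ x, ‖g x‖ₑ ^ p ∂γ < ⊤) {φ : ∀ i, N i → E}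
    (hφ : ∀ i, MeasurePreserving (φ i) (ρ i) γ) : UniformMoments ρ fun i x => g (φ i x) := by
  refine ⟨fun i => hg.comp (hφ i).measurable, fun p => ⟨(∫⁻ x, ‖g x‖ₑ ^ p ∂γ).toNNReal,
    fun i => ?_⟩⟩
  rw [ENNReal.coe_toNNReal (hmom p).ne]
  exact ((hφ i).lintegral_comp (hg.enorm.pow_const p)).le

end UniformMoments

theorem lintegral_enorm_pow_lt_top {E : Type*} [MeasurableSpace E] {γ : Measure E} {g : E → ℝ}
    {p : ℕ} (h : Integrable (fun x => |g x| ^ p) γ) : ∫⁻ x, ‖g x‖ₑ ^ p ∂γ < ⊤ := by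
  have := h.hasFiniteIntegral
  rw [hasFiniteIntegral_iff_enorm] at this
  simpa using this

/-- A dimension `n > 0` and a microscopic state `(U, V, W)` with columns of unit length. -/
structure UnitState (d : ℕ) where
  /-- the dimension of the data -/
  dim : ℕ
  pos : 0 < dim
  /-- the features of the true model -/
  U : Matrix (Fin dim) (Fin d) ℝ
  /-- the features of the generator -/
  V : Matrix (Fin dim) (Fin d) ℝ
  /-- the features of the discriminator -/
  W : Matrix (Fin dim) (Fin d) ℝ
  unitU : ∀ j, ∑ i, U i j ^ 2 = 1
  unitV : ∀ j, ∑ i, V i j ^ 2 = 1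
  unitW : ∀ j, ∑ i, W i j ^ 2 = 1

/-- The `ℓ¹` norm of a vector. -/
def l1 {k : Type*} [Fintype k] (v : k → ℝ) : ℝ := ∑ j, |v j|

/-- The size of the noise as it is seen from a state `(U, V, W)`. -/
noncomputable def noiseSize {d n : ℕ} (U V W : Matrix (Fin n) (Fin d) ℝ) (x : Noise d n) : ℝ :=
  1 + (l1 x.1 + l1 x.2.1 + (l1 (Uᵀ *ᵥ x.2.2.1) + l1 (Vᵀ *ᵥ x.2.2.1) + l1 (Wᵀ *ᵥ x.2.2.1))
    + (l1 (Uᵀ *ᵥ x.2.2.2) + l1 (Vᵀ *ᵥ x.2.2.2) + l1 (Wᵀ *ᵥ x.2.2.2))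
    + ((x.2.2.1 ⬝ᵥ x.2.2.1) / n + (x.2.2.2 ⬝ᵥ x.2.2.2) / n))

/-- The rescaled deviation of `|a|² / n`, `|ã|² / n` and `a · ã / n` from `1`, `1` and `0`. -/
noncomputable def noiseFluct {d n : ℕ} (x : Noise d n) : ℝ :=
  Real.sqrt n * (|(x.2.2.1 ⬝ᵥ x.2.2.1) / n - 1| + |(x.2.2.2 ⬝ᵥ x.2.2.2) / n - 1|
    + |x.2.2.1 ⬝ᵥ x.2.2.2| / n)

theorem noiseFluct_nonneg {d n : ℕ} (x : Noise d n) : 0 ≤ noiseFluct x := by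
  unfold noiseFluct; positivity

section

variable {d : ℕ} {ν νt : Measure (Fin d → ℝ)} {Λ Λt : Matrix (Fin d) (Fin d) ℝ}

theorem uniformMoments_l1_feature {I : Type*} {N : I → Type*} [∀ i, MeasurableSpace (N i)]
    {ρ : ∀ i, Measure (N i)} [∀ i, IsProbabilityMeasure (ρ i)] (hν : IsCentredLaw ν Λ)
    {φ : ∀ i, N i → Fin d → ℝ} (hφ : ∀ i, MeasurePreserving (φ i) (ρ i) ν) :
    UniformMoments ρ fun i x => l1 (φ i x) := by
  refine UniformMoments.sum _ fun j => UniformMoments.abs ?_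
  refine UniformMoments.of_measurePreserving (g := fun c : Fin d → ℝ => c j)
    (measurable_pi_apply j) (fun p => lintegral_enorm_pow_lt_top ?_) hφ
  refine (hν.moments p).mono'
    ((measurable_pi_apply j).abs.pow_const p).aestronglyMeasurable (ae_of_all _ fun x => ?_)
  simpa using pow_le_pow_left₀ (abs_nonneg _) (norm_le_pi_norm x j) p

theorem uniformMoments_l1_overlap {I : Type*} {N : I → Type*} [∀ i, MeasurableSpace (N i)]
    {ρ : ∀ i, Measure (N i)} [∀ i, IsProbabilityMeasure (ρ i)] {dim : I → ℕ}
    {X : ∀ i, Matrix (Fin (dim i)) (Fin d) ℝ} (hX : ∀ i j, ∑ k, X i k j ^ 2 = 1)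
    {φ : ∀ i, N i → Fin (dim i) → ℝ} (hφ : ∀ i, MeasurePreserving (φ i) (ρ i) (stdGauss (dim i))) :
    UniformMoments ρ fun i x => l1 ((X i)ᵀ *ᵥ φ i x) := by
  refine UniformMoments.sum _ fun j => UniformMoments.abs ?_
  refine UniformMoments.of_measurePreserving (γ := gaussianReal 0 1) (g := fun x : ℝ => x)
    measurable_id (fun p => lintegral_enorm_pow_lt_top ?_)
    (φ := fun i x => ((X i)ᵀ *ᵥ φ i x) j) fun i => ?_
  · simpa [abs_pow] using (integrable_gaussianReal_pow p).abs
  · have h1 : MeasurePreserving (fun a : Fin (dim i) → ℝ => ((X i)ᵀ *ᵥ a) j)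
        (stdGauss (dim i)) (gaussianReal 0 1) := by
      refine ⟨?_, ?_⟩
      · simp only [mulVec, dotProduct]; fun_prop
      · exact map_stdGauss_dotProduct (hX i j)
    exact h1.comp (hφ i)

theorem uniformMoments_normSq_div {I : Type*} {N : I → Type*} [∀ i, MeasurableSpace (N i)]
    {ρ : ∀ i, Measure (N i)} {dim : I → ℕ} (hdim : ∀ i, 0 < dim i)
    {φ : ∀ i, N i → Fin (dim i) → ℝ} (hφ : ∀ i, MeasurePreserving (φ i) (ρ i) (stdGauss (dim i))) :
    UniformMoments ρ fun i x => (φ i x ⬝ᵥ φ i x) / dim i := by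
  have hmeas : ∀ n : ℕ, Measurable fun a : Fin n → ℝ => (a ⬝ᵥ a) / n := fun n => by
    simp only [dotProduct]; fun_prop
  refine ⟨fun i => (hmeas _).comp (hφ i).measurable, fun p =>
    ⟨Real.toNNReal (∫ x, x ^ (2 * p) ∂(gaussianReal 0 1)), fun i => ?_⟩⟩
  rw [(hφ i).lintegral_comp ((hmeas (dim i)).enorm.pow_const p)
    (f := fun a : Fin (dim i) → ℝ => ‖(a ⬝ᵥ a) / dim i‖ₑ ^ p)]
  generalize hn : dim i = n
  have hn0 : 0 < n := hn ▸ hdim i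
  have hn' : (0 : ℝ) < n := by exact_mod_cast hn0
  -- convexity of the `p`-th power
  have hpt : ∀ a : Fin n → ℝ, ((a ⬝ᵥ a) / n) ^ p ≤ ∑ k, (1 / n : ℝ) * a k ^ (2 * p) := fun a => by
    have := Real.pow_arith_mean_le_arith_mean_pow Finset.univ (fun _ : Fin n => (1 / n : ℝ))
      (fun k => a k ^ 2) (fun _ _ => by positivity) (by simp; field_simp)
      (fun _ _ => sq_nonneg _) p
    simp only [← pow_mul] at this
    convert this using 2
    rw [dotProduct, Finset.sum_div]
    exact Finset.sum_congr rfl fun k _ => by ring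
  have hk : ∀ k ∈ Finset.univ, Integrable (fun a : Fin n → ℝ => (1 / n : ℝ) * a k ^ (2 * p))
      (stdGauss n) := fun k _ =>
    ((measurePreserving_stdGauss_apply k).integrable_comp_of_integrable
      (integrable_gaussianReal_pow (2 * p))).const_mul _
  have hint : Integrable (fun a : Fin n → ℝ => ∑ k, (1 / n : ℝ) * a k ^ (2 * p)) (stdGauss n) :=
    integrable_finsetSum _ hk
  have hval : ∫ a, ∑ k, (1 / n : ℝ) * a k ^ (2 * p) ∂(stdGauss n) =
      ∫ x, x ^ (2 * p) ∂(gaussianReal 0 1) := by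
    rw [integral_finsetSum _ hk]
    have h1 : ∀ k : Fin n, ∫ a, (1 / n : ℝ) * a k ^ (2 * p) ∂(stdGauss n) =
        (1 / n : ℝ) * ∫ x, x ^ (2 * p) ∂(gaussianReal 0 1) := fun k => by
      rw [integral_const_mul, ← (measurePreserving_stdGauss_apply k).map_eq,
        integral_map (measurePreserving_stdGauss_apply k).measurable.aemeasurable (by fun_prop)]
    rw [Finset.sum_congr rfl fun k _ => h1 k]
    simp
    field_simp
  have hnn : ∀ a : Fin n → ℝ, 0 ≤ (a ⬝ᵥ a) / n := fun a =>
    div_nonneg (Finset.sum_nonneg fun k _ => mul_self_nonneg _) hn'.le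
  calc ∫⁻ a, ‖(a ⬝ᵥ a) / n‖ₑ ^ p ∂(stdGauss n)
      ≤ ∫⁻ a, ENNReal.ofReal (∑ k, (1 / n : ℝ) * a k ^ (2 * p)) ∂(stdGauss n) := by
        refine lintegral_mono fun a => ?_
        rw [Real.enorm_of_nonneg (hnn a), ← ENNReal.ofReal_pow (hnn a)]
        exact ENNReal.ofReal_le_ofReal (hpt a)
    _ = ENNReal.ofReal (∫ x, x ^ (2 * p) ∂(gaussianReal 0 1)) := by
        rw [← ofReal_integral_eq_lintegral_ofReal hint (ae_of_all _ fun a =>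
          Finset.sum_nonneg fun k _ => mul_nonneg (by positivity)
            (by rw [pow_mul]; positivity)), hval]
    _ = _ := rfl

theorem uniformMoments_noiseSize (hν : IsCentredLaw ν Λ) (hνt : IsCentredLaw νt Λt) :
    UniformMoments (fun s : UnitState d => noiseLaw ν νt s.dim)
      (fun s x => noiseSize s.U s.V s.W x) := by
  have := hν.prob
  have := hνt.prob
  have hc : ∀ s : UnitState d, MeasurePreserving (fun x : Noise d s.dim => x.1)
      (noiseLaw ν νt s.dim) ν := fun s => measurePreserving_fst
  have hct : ∀ s : UnitState d, MeasurePreserving (fun x : Noise d s.dim => x.2.1)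
      (noiseLaw ν νt s.dim) νt := fun s => measurePreserving_fst.comp measurePreserving_snd
  have ha : ∀ s : UnitState d, MeasurePreserving (fun x : Noise d s.dim => x.2.2.1)
      (noiseLaw ν νt s.dim) (stdGauss s.dim) := fun s =>
    measurePreserving_fst.comp (measurePreserving_noise_gauss ν νt)
  have hb : ∀ s : UnitState d, MeasurePreserving (fun x : Noise d s.dim => x.2.2.2)
      (noiseLaw ν νt s.dim) (stdGauss s.dim) := fun s =>
    measurePreserving_snd.comp (measurePreserving_noise_gauss ν νt)
  have hU : ∀ s : UnitState d, ∀ j, ∑ i, s.U i j ^ 2 = 1 := fun s => s.unitU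
  have hV : ∀ s : UnitState d, ∀ j, ∑ i, s.V i j ^ 2 = 1 := fun s => s.unitV
  have hW : ∀ s : UnitState d, ∀ j, ∑ i, s.W i j ^ 2 = 1 := fun s => s.unitW
  have hp : ∀ s : UnitState d, 0 < s.dim := fun s => s.pos
  exact (UniformMoments.const 1).add (((((uniformMoments_l1_feature hν hc).add
    (uniformMoments_l1_feature hνt hct)).add
    (((uniformMoments_l1_overlap hU ha).add (uniformMoments_l1_overlap hV ha)).add
      (uniformMoments_l1_overlap hW ha))).add
    (((uniformMoments_l1_overlap hU hb).add (uniformMoments_l1_overlap hV hb)).add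
      (uniformMoments_l1_overlap hW hb))).add
    ((uniformMoments_normSq_div hp ha).add (uniformMoments_normSq_div hp hb)))

theorem exists_lintegral_noiseFluct_sq_le (hν : IsCentredLaw ν Λ) (hνt : IsCentredLaw νt Λt) :
    ∃ B : NNReal, ∀ n : ℕ, 0 < n →
      ∫⁻ x, ENNReal.ofReal (noiseFluct (d := d) x ^ 2) ∂(noiseLaw ν νt n) ≤ B := by
  have := hν.prob
  have := hνt.prob
  obtain ⟨B, hB0, hB⟩ := exists_integral_normSq_sub_sq_le
  refine ⟨Real.toNNReal (3 * (B + B + 1)), fun n hn => ?_⟩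
  have hn' : (0 : ℝ) < n := by exact_mod_cast hn
  have ha : MeasurePreserving (fun x : Noise d n => x.2.2.1) (noiseLaw ν νt n) (stdGauss n) :=
    measurePreserving_fst.comp (measurePreserving_noise_gauss ν νt)
  have hb : MeasurePreserving (fun x : Noise d n => x.2.2.2) (noiseLaw ν νt n) (stdGauss n) :=
    measurePreserving_snd.comp (measurePreserving_noise_gauss ν νt)
  have hab := measurePreserving_noise_gauss (n := n) ν νt
  obtain ⟨i1, v1⟩ := hB n
  obtain ⟨i2, v2⟩ := integral_dotProduct_sq n
  have ia : Integrable (fun x : Noise d n => (x.2.2.1 ⬝ᵥ x.2.2.1 - n) ^ 2) (noiseLaw ν νt n) :=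
    ha.integrable_comp_of_integrable i1
  have ib : Integrable (fun x : Noise d n => (x.2.2.2 ⬝ᵥ x.2.2.2 - n) ^ 2) (noiseLaw ν νt n) :=
    hb.integrable_comp_of_integrable i1
  have iab : Integrable (fun x : Noise d n => (x.2.2.1 ⬝ᵥ x.2.2.2) ^ 2) (noiseLaw ν νt n) :=
    hab.integrable_comp_of_integrable i2
  have va : ∫ x : Noise d n, (x.2.2.1 ⬝ᵥ x.2.2.1 - n) ^ 2 ∂(noiseLaw ν νt n) ≤ n * B := by
    rw [← ha.map_eq, integral_map ha.measurable.aemeasurable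
      (by rw [ha.map_eq]; exact i1.aestronglyMeasurable)] at v1
    exact v1
  have vb : ∫ x : Noise d n, (x.2.2.2 ⬝ᵥ x.2.2.2 - n) ^ 2 ∂(noiseLaw ν νt n) ≤ n * B := by
    have v1' := (hB n).2
    rw [← hb.map_eq, integral_map hb.measurable.aemeasurable
      (by rw [hb.map_eq]; exact i1.aestronglyMeasurable)] at v1'
    exact v1'
  have vab : ∫ x : Noise d n, (x.2.2.1 ⬝ᵥ x.2.2.2) ^ 2 ∂(noiseLaw ν νt n) = n := by
    rw [← hab.map_eq, integral_map hab.measurable.aemeasurable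
      (by rw [hab.map_eq]; exact i2.aestronglyMeasurable)] at v2
    exact v2
  set F : Noise d n → ℝ := fun x => (3 / n : ℝ) * ((x.2.2.1 ⬝ᵥ x.2.2.1 - n) ^ 2
    + (x.2.2.2 ⬝ᵥ x.2.2.2 - n) ^ 2 + (x.2.2.1 ⬝ᵥ x.2.2.2) ^ 2) with hF
  have iF : Integrable F (noiseLaw ν νt n) := ((ia.add ib).add iab).const_mul _
  have vF : ∫ x, F x ∂(noiseLaw ν νt n) ≤ 3 * (B + B + 1) := by
    have i12 : Integrable (fun x : Noise d n => (x.2.2.1 ⬝ᵥ x.2.2.1 - n) ^ 2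
      + (x.2.2.2 ⬝ᵥ x.2.2.2 - n) ^ 2) (noiseLaw ν νt n) := ia.add ib
    rw [hF, integral_const_mul, integral_add i12 iab, integral_add ia ib, vab]
    calc (3 / n : ℝ) * (_ + _ + n) ≤ (3 / n : ℝ) * (n * B + n * B + n) := by gcongr
      _ = 3 * (B + B + 1) := by field_simp
  have hpt : ∀ x : Noise d n, noiseFluct x ^ 2 ≤ F x := fun x => by
    have e1 : ∀ r : ℝ, |r / n - 1| = |r - n| / n := fun r => by
      rw [← abs_of_pos hn', ← abs_div, abs_of_pos hn']
      congr 1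
      field_simp
    rw [noiseFluct, hF, mul_pow, Real.sq_sqrt hn'.le, e1, e1]
    have e2 : ∀ p q r : ℝ, (p + q + r) ^ 2 ≤ 3 * (p ^ 2 + q ^ 2 + r ^ 2) := fun p q r => by
      nlinarith [sq_nonneg (p - q), sq_nonneg (q - r), sq_nonneg (p - r)]
    have e3 := e2 |x.2.2.1 ⬝ᵥ x.2.2.1 - n| |x.2.2.2 ⬝ᵥ x.2.2.2 - n| |x.2.2.1 ⬝ᵥ x.2.2.2|
    simp only [sq_abs] at e3
    rw [← add_div, ← add_div, div_pow]
    have e4 : ∀ r : ℝ, (n : ℝ) * (r / (n : ℝ) ^ 2) = (1 / n : ℝ) * r := fun r => by field_simp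
    rw [e4]
    refine (mul_le_mul_of_nonneg_left e3 (by positivity)).trans (le_of_eq ?_)
    ring
  calc ∫⁻ x, ENNReal.ofReal (noiseFluct x ^ 2) ∂(noiseLaw ν νt n)
      ≤ ∫⁻ x, ENNReal.ofReal (F x) ∂(noiseLaw ν νt n) :=
        lintegral_mono fun x => ENNReal.ofReal_le_ofReal (hpt x)
    _ = ENNReal.ofReal (∫ x, F x ∂(noiseLaw ν νt n)) :=
        (ofReal_integral_eq_lintegral_ofReal iF
          (ae_of_all _ fun x => (sq_nonneg _).trans (hpt x))).symm
    _ ≤ ENNReal.ofReal (3 * (B + B + 1)) := ENNReal.ofReal_le_ofReal vF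
    _ = _ := rfl

end

/-! ### The step sizes in terms of the noise -/

section L1

theorem l1_nonneg {k : Type*} [Fintype k] (v : k → ℝ) : 0 ≤ l1 v :=
  Finset.sum_nonneg fun _ _ => abs_nonneg _

theorem l1_add_le {k : Type*} [Fintype k] (v w : k → ℝ) : l1 (v + w) ≤ l1 v + l1 w := by
  rw [l1, l1, l1, ← Finset.sum_add_distrib]
  exact Finset.sum_le_sum fun j _ => abs_add_le _ _

theorem l1_smul {k : Type*} [Fintype k] (c : ℝ) (v : k → ℝ) : l1 (c • v) = |c| * l1 v := by
  simp [l1, abs_mul, Finset.mul_sum]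

theorem sum_sq_le_l1_sq {k : Type*} [Fintype k] (v : k → ℝ) : ∑ i, v i ^ 2 ≤ l1 v ^ 2 := by
  rw [sq (l1 v), l1, Finset.sum_mul]
  refine Finset.sum_le_sum fun i _ => ?_
  rw [← sq_abs, sq]
  exact mul_le_mul_of_nonneg_left
    (Finset.single_le_sum (f := fun j => |v j|) (fun _ _ => abs_nonneg _) (Finset.mem_univ i))
    (abs_nonneg _)

theorem abs_dotProduct_le_l1 {k : Type*} [Fintype k] (v w : k → ℝ) : |v ⬝ᵥ w| ≤ l1 v * l1 w := by
  rw [l1, Finset.sum_mul]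
  refine (Finset.abs_sum_le_sum_abs _ _).trans (Finset.sum_le_sum fun j _ => ?_)
  rw [abs_mul]
  exact mul_le_mul_of_nonneg_left
    (Finset.single_le_sum (f := fun j => |w j|) (fun _ _ => abs_nonneg _) (Finset.mem_univ j))
    (abs_nonneg _)

theorem abs_dotProduct_mulVec_le {k l : Type*} [Fintype k] [Fintype l] {A : Matrix k l ℝ}
    (hA : ∀ i j, |A i j| ≤ 1) (v : k → ℝ) (w : l → ℝ) : |v ⬝ᵥ (A *ᵥ w)| ≤ l1 v * l1 w := by
  rw [l1, Finset.sum_mul]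
  refine (Finset.abs_sum_le_sum_abs _ _).trans (Finset.sum_le_sum fun i _ => ?_)
  rw [abs_mul]
  refine mul_le_mul_of_nonneg_left ?_ (abs_nonneg _)
  refine (Finset.abs_sum_le_sum_abs _ _).trans (Finset.sum_le_sum fun j _ => ?_)
  rw [abs_mul]
  exact mul_le_of_le_one_left (abs_nonneg _) (hA i j)

theorem l1_mulVec_le {d : ℕ} {l : Type*} [Fintype l] {A : Matrix (Fin d) l ℝ}
    (hA : ∀ i j, |A i j| ≤ 1) (w : l → ℝ) : l1 (A *ᵥ w) ≤ d * l1 w := by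
  have : ∀ i ∈ (Finset.univ : Finset (Fin d)), |(A *ᵥ w) i| ≤ l1 w := fun i _ => by
    refine (Finset.abs_sum_le_sum_abs _ _).trans (Finset.sum_le_sum fun j _ => ?_)
    rw [abs_mul]
    exact mul_le_of_le_one_left (abs_nonneg _) (hA i j)
  refine (Finset.sum_le_sum this).trans ?_
  simp

/-- Overlaps of unit vectors are at most `1`. -/
theorem abs_transpose_mul_apply_le_one {n d : ℕ} {X Y : Matrix (Fin n) (Fin d) ℝ}
    (hX : ∀ j, ∑ i, X i j ^ 2 = 1) (hY : ∀ j, ∑ i, Y i j ^ 2 = 1) (j k : Fin d) :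
    |(Xᵀ * Y) j k| ≤ 1 := by
  rw [abs_le_one_iff_mul_self_le_one, Matrix.mul_apply, ← sq]
  have := Finset.sum_mul_sq_le_sq_mul_sq Finset.univ (fun i => X i j) (fun i => Y i k)
  rw [hX j, hY k, mul_one] at this
  simpa using this

end L1

section Frobenius

attribute [local instance] Matrix.frobeniusNormedAddCommGroup Matrix.frobeniusNormedSpace

theorem norm_vecMulVec_le {k l : Type*} [Fintype k] [Fintype l] (u : k → ℝ) (v : l → ℝ) :
    ‖vecMulVec u v‖ ≤ l1 u * l1 v := by
  refine le_of_sq_le_sq ?_ (mul_nonneg (l1_nonneg u) (l1_nonneg v))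
  rw [norm_sq_eq_sum, mul_pow]
  simp only [vecMulVec_apply, mul_pow]
  rw [← Finset.sum_mul_sum]
  exact mul_le_mul (sum_sq_le_l1_sq u) (sum_sq_le_l1_sq v) (Finset.sum_nonneg fun _ _ => sq_nonneg _) (sq_nonneg _)

theorem norm_le_of_unit {n d : ℕ} {X : Matrix (Fin n) (Fin d) ℝ}
    (hX : ∀ j, ∑ i, X i j ^ 2 = 1) : ‖X‖ ≤ 1 + d := by
  refine le_of_sq_le_sq ?_ (by positivity)
  rw [norm_sq_eq_sum, Finset.sum_comm, Finset.sum_congr rfl fun j _ => hX j]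
  simp
  nlinarith [(Nat.cast_nonneg d : (0 : ℝ) ≤ d)]

section Spiked

variable {n d : ℕ} {X B : Matrix (Fin n) (Fin d) ℝ}

theorem l1_overlap_spiked_le (hX : ∀ j, ∑ i, X i j ^ 2 = 1) (hB : ∀ j, ∑ i, B i j ^ 2 = 1)
    (η : ℝ) (c : Fin d → ℝ) (a : Fin n → ℝ) :
    l1 (Xᵀ *ᵥ spiked B η c a) ≤ d * l1 c + Real.sqrt η * l1 (Xᵀ *ᵥ a) := by
  rw [spiked, mulVec_add, mulVec_smul, mulVec_mulVec]
  refine (l1_add_le _ _).trans (add_le_add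
    (l1_mulVec_le (abs_transpose_mul_apply_le_one hX hB) c) ?_)
  rw [l1_smul, abs_of_nonneg (Real.sqrt_nonneg _)]

theorem mulVec_dotProduct_eq (A B : Matrix (Fin n) (Fin d) ℝ) (c c' : Fin d → ℝ) :
    (A *ᵥ c) ⬝ᵥ (B *ᵥ c') = c ⬝ᵥ ((Aᵀ * B) *ᵥ c') := by
  rw [← mulVec_mulVec, dotProduct_mulVec c, vecMul_transpose]

theorem mulVec_dotProduct_eq' (A : Matrix (Fin n) (Fin d) ℝ) (c : Fin d → ℝ) (a : Fin n → ℝ) :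
    (A *ᵥ c) ⬝ᵥ a = c ⬝ᵥ (Aᵀ *ᵥ a) := by
  rw [dotProduct_mulVec, vecMul_transpose]

/-- The scalar product of two samples agrees with the one of their noise parts up to a term that
does not grow with the dimension. -/
theorem abs_spiked_dotProduct_sub_le {B' : Matrix (Fin n) (Fin d) ℝ}
    (hB : ∀ j, ∑ i, B i j ^ 2 = 1) (hB' : ∀ j, ∑ i, B' i j ^ 2 = 1) (η η' : ℝ)
    (c c' : Fin d → ℝ) (a a' : Fin n → ℝ) :
    |spiked B η c a ⬝ᵥ spiked B' η' c' a' - Real.sqrt η * Real.sqrt η' * (a ⬝ᵥ a')| ≤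
      l1 c * l1 c' + Real.sqrt η' * (l1 c * l1 (Bᵀ *ᵥ a'))
        + Real.sqrt η * (l1 c' * l1 (B'ᵀ *ᵥ a)) := by
  have h : spiked B η c a ⬝ᵥ spiked B' η' c' a' - Real.sqrt η * Real.sqrt η' * (a ⬝ᵥ a') =
      c ⬝ᵥ ((Bᵀ * B') *ᵥ c') + Real.sqrt η' * (c ⬝ᵥ (Bᵀ *ᵥ a'))
        + Real.sqrt η * (c' ⬝ᵥ (B'ᵀ *ᵥ a)) := by
    rw [spiked, spiked, add_dotProduct, dotProduct_add, dotProduct_add, mulVec_dotProduct_eq,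
      dotProduct_smul, mulVec_dotProduct_eq', smul_dotProduct, smul_dotProduct, dotProduct_smul,
      dotProduct_comm a, mulVec_dotProduct_eq']
    simp only [smul_eq_mul]
    ring
  rw [h]
  refine (abs_add_three _ _ _).trans (add_le_add (add_le_add
    (abs_dotProduct_mulVec_le (abs_transpose_mul_apply_le_one hB hB') c c') ?_) ?_)
  · rw [abs_mul, abs_of_nonneg (Real.sqrt_nonneg _)]
    exact mul_le_mul_of_nonneg_left (abs_dotProduct_le_l1 _ _) (Real.sqrt_nonneg _)
  · rw [abs_mul, abs_of_nonneg (Real.sqrt_nonneg _)]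
    exact mul_le_mul_of_nonneg_left (abs_dotProduct_le_l1 _ _) (Real.sqrt_nonneg _)

end Spiked

/-- The discriminator direction of rank two: overlaps with a frame. -/
theorem transpose_mul_discRaw_vecMulVec {n d : ℕ} (τ : ℝ) (W X : Matrix (Fin n) (Fin d) ℝ)
    (y yt : Fin n → ℝ) :
    Xᵀ * discRaw τ W (vecMulVec y y) (vecMulVec yt yt) =
      τ • (vecMulVec (Xᵀ *ᵥ y) (Wᵀ *ᵥ y) - vecMulVec (Xᵀ *ᵥ yt) (Wᵀ *ᵥ yt)) := by
  rw [discRaw, Matrix.mul_smul, Matrix.sub_mul, Matrix.mul_sub, vecMulVec_mul, vecMulVec_mul,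
    mul_vecMulVec, mul_vecMulVec, mulVec_transpose W, mulVec_transpose W]

theorem discRaw_transpose_mul_self {n d : ℕ} (τ : ℝ) (W : Matrix (Fin n) (Fin d) ℝ)
    (y yt : Fin n → ℝ) :
    (discRaw τ W (vecMulVec y y) (vecMulVec yt yt))ᵀ *
        discRaw τ W (vecMulVec y y) (vecMulVec yt yt) =
      τ ^ 2 • ((y ⬝ᵥ y) • vecMulVec (Wᵀ *ᵥ y) (Wᵀ *ᵥ y)
        + (yt ⬝ᵥ yt) • vecMulVec (Wᵀ *ᵥ yt) (Wᵀ *ᵥ yt)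
        - (y ⬝ᵥ yt) • (vecMulVec (Wᵀ *ᵥ y) (Wᵀ *ᵥ yt) + vecMulVec (Wᵀ *ᵥ yt) (Wᵀ *ᵥ y))) := by
  have h1 : discRaw τ W (vecMulVec y y) (vecMulVec yt yt) =
      τ • (vecMulVec y (Wᵀ *ᵥ y) - vecMulVec yt (Wᵀ *ᵥ yt)) := by
    rw [discRaw, Matrix.sub_mul, vecMulVec_mul, vecMulVec_mul, mulVec_transpose W,
      mulVec_transpose W]
  rw [h1]
  simp only [Matrix.transpose_smul, Matrix.transpose_sub, transpose_vecMulVec, Matrix.smul_mul,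
    Matrix.mul_smul, Matrix.sub_mul, Matrix.mul_sub, vecMulVec_mul_vecMulVec, vecMulVec_smul,
    dotProduct_comm yt y]
  module

theorem discQuad_vecMulVec {n d : ℕ} (τ ηT ηG : ℝ) (W : Matrix (Fin n) (Fin d) ℝ)
    (y yt : Fin n → ℝ) :
    discQuad τ ηT ηG W (vecMulVec y y) (vecMulVec yt yt) =
      τ ^ 2 • (ηT • vecMulVec (Wᵀ *ᵥ y) (Wᵀ *ᵥ y) + ηG • vecMulVec (Wᵀ *ᵥ yt) (Wᵀ *ᵥ yt)) := by
  rw [discQuad, mul_vecMulVec, mul_vecMulVec, vecMulVec_mul, vecMulVec_mul, ← mulVec_transpose W,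
    ← mulVec_transpose W]

theorem noiseSize_bounds {n d : ℕ} (U V W : Matrix (Fin n) (Fin d) ℝ) (x : Noise d n) :
    (1 ≤ noiseSize U V W x ∧ l1 x.1 ≤ noiseSize U V W x ∧ l1 x.2.1 ≤ noiseSize U V W x) ∧
    (l1 (Uᵀ *ᵥ x.2.2.1) ≤ noiseSize U V W x ∧ l1 (Vᵀ *ᵥ x.2.2.1) ≤ noiseSize U V W x ∧
      l1 (Wᵀ *ᵥ x.2.2.1) ≤ noiseSize U V W x) ∧
    (l1 (Uᵀ *ᵥ x.2.2.2) ≤ noiseSize U V W x ∧ l1 (Vᵀ *ᵥ x.2.2.2) ≤ noiseSize U V W x ∧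
      l1 (Wᵀ *ᵥ x.2.2.2) ≤ noiseSize U V W x) ∧
    (x.2.2.1 ⬝ᵥ x.2.2.1) / n ≤ noiseSize U V W x ∧
      (x.2.2.2 ⬝ᵥ x.2.2.2) / n ≤ noiseSize U V W x := by
  have n1 := l1_nonneg x.1
  have n2 := l1_nonneg x.2.1
  have n3 := l1_nonneg (Uᵀ *ᵥ x.2.2.1)
  have n4 := l1_nonneg (Vᵀ *ᵥ x.2.2.1)
  have n5 := l1_nonneg (Wᵀ *ᵥ x.2.2.1)
  have n6 := l1_nonneg (Uᵀ *ᵥ x.2.2.2)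
  have n7 := l1_nonneg (Vᵀ *ᵥ x.2.2.2)
  have n8 := l1_nonneg (Wᵀ *ᵥ x.2.2.2)
  have n9 : 0 ≤ (x.2.2.1 ⬝ᵥ x.2.2.1) / n :=
    div_nonneg (Finset.sum_nonneg fun _ _ => mul_self_nonneg _) (Nat.cast_nonneg n)
  have n10 : 0 ≤ (x.2.2.2 ⬝ᵥ x.2.2.2) / n :=
    div_nonneg (Finset.sum_nonneg fun _ _ => mul_self_nonneg _) (Nat.cast_nonneg n)
  unfold noiseSize
  generalize l1 x.1 = p1 at *
  generalize l1 x.2.1 = p2 at *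
  generalize l1 (Uᵀ *ᵥ x.2.2.1) = p3 at *
  generalize l1 (Vᵀ *ᵥ x.2.2.1) = p4 at *
  generalize l1 (Wᵀ *ᵥ x.2.2.1) = p5 at *
  generalize l1 (Uᵀ *ᵥ x.2.2.2) = p6 at *
  generalize l1 (Vᵀ *ᵥ x.2.2.2) = p7 at *
  generalize l1 (Wᵀ *ᵥ x.2.2.2) = p8 at *
  generalize (x.2.2.1 ⬝ᵥ x.2.2.1) / (n : ℝ) = p9 at *
  generalize (x.2.2.2 ⬝ᵥ x.2.2.2) / (n : ℝ) = p10 at *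
  refine ⟨⟨?_, ?_, ?_⟩, ⟨?_, ?_, ?_⟩, ⟨?_, ?_, ?_⟩, ?_, ?_⟩ <;> linarith

theorem noiseFluct_bounds {n d : ℕ} (hn : 0 < n) (x : Noise d n) :
    |(x.2.2.1 ⬝ᵥ x.2.2.1) / n - 1| ≤ noiseFluct x / Real.sqrt n ∧
    |(x.2.2.2 ⬝ᵥ x.2.2.2) / n - 1| ≤ noiseFluct x / Real.sqrt n ∧
    |(x.2.2.1 ⬝ᵥ x.2.2.2) / n - 0| ≤ noiseFluct x / Real.sqrt n := by
  have hn0 : (0 : ℝ) < n := by exact_mod_cast hn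
  have hr0 : 0 < Real.sqrt n := Real.sqrt_pos.2 hn0
  rw [noiseFluct, mul_div_cancel_left₀ _ hr0.ne', sub_zero, abs_div _ (n : ℝ), abs_of_pos hn0]
  have h1 := abs_nonneg ((x.2.2.1 ⬝ᵥ x.2.2.1) / n - 1)
  have h2 := abs_nonneg ((x.2.2.2 ⬝ᵥ x.2.2.2) / n - 1)
  have h3 : 0 ≤ |x.2.2.1 ⬝ᵥ x.2.2.2| / n := by positivity
  generalize |(x.2.2.1 ⬝ᵥ x.2.2.1) / (n : ℝ) - 1| = p1 at *
  generalize |(x.2.2.2 ⬝ᵥ x.2.2.2) / (n : ℝ) - 1| = p2 at *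
  generalize |x.2.2.1 ⬝ᵥ x.2.2.2| / (n : ℝ) = p3 at *
  refine ⟨?_, ?_, ?_⟩ <;> linarith

section Scalar

variable {α K N r σ : ℝ}

/-- A quantity `p ≈ s m` of order `N`. -/
theorem le_of_abs_sub_le (hα : 1 ≤ α) (hK : 1 ≤ K) (hN : 1 ≤ N) {p s m : ℝ}
    (hp : |p - s * m| ≤ 3 * (α * K ^ 2)) (hsα : s ≤ α) (hm : 0 ≤ m / N)
    (hmK : m / N ≤ K) : p ≤ N * (4 * (α * K ^ 2)) := by
  have hN0 : 0 < N := by linarith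
  have h1 : s * (m / N) ≤ α * K := mul_le_mul hsα hmK hm (by linarith)
  have h2 : α * K ≤ α * K ^ 2 := mul_le_mul_of_nonneg_left (by nlinarith) (by linarith)
  have h3 : s * m = N * (s * (m / N)) := by field_simp
  have h4 : s * m ≤ N * (α * K ^ 2) := by
    rw [h3]; exact mul_le_mul_of_nonneg_left (h1.trans h2) hN0.le
  have h5 : α * K ^ 2 ≤ N * (α * K ^ 2) :=
    le_mul_of_one_le_left (mul_nonneg (by linarith) (sq_nonneg K)) hN
  have h6 := (abs_le.1 hp).2
  linarith

/-- A quantity `p ≈ s m` of order `N` whose rescaling `m / N` is close to `q`. -/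
theorem abs_div_sub_le (hα : 1 ≤ α) (hK : 1 ≤ K) (hN : 1 ≤ N) (hr : 1 ≤ r) (hrN : r * r = N)
    (hσ : 0 ≤ σ) {p s m q : ℝ} (hp : |p - s * m| ≤ 3 * (α * K ^ 2)) (hs : 0 ≤ s)
    (hsα : s ≤ α ^ 2) (hm : |m / N - q| ≤ σ / r) :
    |p / N - s * q| ≤ 3 * (α ^ 2 * K ^ 2 * ((1 + σ) / r)) := by
  have hN0 : 0 < N := by linarith
  have hr0 : 0 < r := by linarith
  have hα0 : 0 ≤ α := by linarith
  have hNr : 1 / N ≤ 1 / r := by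
    apply one_div_le_one_div_of_le hr0
    nlinarith
  have hσr : 0 ≤ σ / r := by positivity
  have h1 : |p / N - s * q| ≤ |p - s * m| / N + s * |m / N - q| := by
    have : p / N - s * q = (p - s * m) / N + s * (m / N - q) := by field_simp; ring
    rw [this]
    refine (abs_add_le _ _).trans (add_le_add (le_of_eq ?_) (le_of_eq ?_))
    · rw [abs_div, abs_of_pos hN0]
    · rw [abs_mul, abs_of_nonneg hs]
  have h2 : |p - s * m| / N ≤ 3 * (α * K ^ 2) * (1 / r) := by
    rw [div_eq_mul_one_div]
    exact mul_le_mul hp hNr (by positivity) (by positivity)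
  have h3 : s * |m / N - q| ≤ α ^ 2 * K ^ 2 * (σ / r) := by
    refine mul_le_mul (hsα.trans ?_) hm (abs_nonneg _) (by positivity)
    exact le_mul_of_one_le_right (by positivity) (one_le_pow₀ hK)
  have h4 : α * K ^ 2 ≤ α ^ 2 * K ^ 2 :=
    mul_le_mul_of_nonneg_right (by nlinarith) (by positivity)
  have h5 : 3 * (α * K ^ 2) * (1 / r) ≤ 3 * (α ^ 2 * K ^ 2) * (1 / r) :=
    mul_le_mul_of_nonneg_right (by linarith) (by positivity)
  have h6 : 0 ≤ α ^ 2 * K ^ 2 * (σ / r) := by positivity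
  rw [add_div]
  linarith

theorem const_mul_pow_le (hα : 1 ≤ α) (hK : 1 ≤ K) {C : ℝ} {i j : ℕ} (h16 : C ≤ 16)
    (hi : i ≤ 6) (hj : j ≤ 4) : C * (α ^ i * K ^ j) ≤ 16 * α ^ 6 * K ^ 4 := by
  have hα0 : 0 ≤ α := by linarith
  have hK0 : 0 ≤ K := by linarith
  rw [mul_assoc]
  exact mul_le_mul h16 (mul_le_mul (pow_le_pow_right₀ hα hi) (pow_le_pow_right₀ hK hj)
    (by positivity) (by positivity)) (by positivity) (by norm_num)

end Scalar

/-- What the step sizes need to know about a true sample `y` and a generated sample `ỹ`: overlaps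
with the frames `U, V, W`, and scalar products. -/
structure SampleBound {n d : ℕ} (α K ϑ ηT ηG : ℝ) (U V W : Matrix (Fin n) (Fin d) ℝ)
    (y yt : Fin n → ℝ) : Prop where
  overlap_true : l1 (Uᵀ *ᵥ y) ≤ α * K ∧ l1 (Vᵀ *ᵥ y) ≤ α * K ∧ l1 (Wᵀ *ᵥ y) ≤ α * K
  overlap_gen : l1 (Uᵀ *ᵥ yt) ≤ α * K ∧ l1 (Vᵀ *ᵥ yt) ≤ α * K ∧ l1 (Wᵀ *ᵥ yt) ≤ α * K
  size_true : y ⬝ᵥ y ≤ n * (4 * (α * K ^ 2))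
  size_gen : yt ⬝ᵥ yt ≤ n * (4 * (α * K ^ 2))
  fluct_true : |(y ⬝ᵥ y) / n - ηT| ≤ 3 * (α ^ 2 * K ^ 2 * ϑ)
  fluct_gen : |(yt ⬝ᵥ yt) / n - ηG| ≤ 3 * (α ^ 2 * K ^ 2 * ϑ)
  fluct_cross : |(y ⬝ᵥ yt) / n| ≤ 3 * (α ^ 2 * K ^ 2 * ϑ)

theorem mul_le_sq_of_le {p q K : ℝ} (hq : 0 ≤ q) (hp : p ≤ K) (hq' : q ≤ K) (hK : 0 ≤ K) :
    p * q ≤ K ^ 2 := by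
  rw [sq]; exact mul_le_mul hp hq' hq hK

/-- The samples of one step satisfy `SampleBound` with the size of the noise. -/
theorem sampleBound_noise {n d : ℕ} {α ηT ηG : ℝ} (hn : 0 < n) (hηT : 0 ≤ ηT) (hηG : 0 ≤ ηG)
    (hα : 1 ≤ α) (hTα : ηT ≤ α) (hGα : ηG ≤ α) (hdT : d + Real.sqrt ηT ≤ α)
    (hdG : d + Real.sqrt ηG ≤ α) {U V W : Matrix (Fin n) (Fin d) ℝ}
    (hU : ∀ j, ∑ i, U i j ^ 2 = 1) (hV : ∀ j, ∑ i, V i j ^ 2 = 1) (hW : ∀ j, ∑ i, W i j ^ 2 = 1)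
    (x : Noise d n) :
    SampleBound α (noiseSize U V W x) ((1 + noiseFluct x) / Real.sqrt n) ηT ηG U V W
      (spiked U ηT x.1 x.2.2.1) (spiked V ηG x.2.1 x.2.2.2) := by
  obtain ⟨⟨hK1, hc, hct⟩, ⟨hUa, hVa, hWa⟩, ⟨hUb, hVb, hWb⟩, haa, hbb⟩ := noiseSize_bounds U V W x
  obtain ⟨f1, f2, f3⟩ := noiseFluct_bounds hn x
  have hσ0 := noiseFluct_nonneg x
  set K := noiseSize U V W x
  set σ := noiseFluct x
  have hn1 : (1 : ℝ) ≤ n := by exact_mod_cast hn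
  have hr1 : 1 ≤ Real.sqrt n := Real.one_le_sqrt.2 hn1
  have hr2 : Real.sqrt n * Real.sqrt n = n := Real.mul_self_sqrt (by linarith)
  have hd0 : (0 : ℝ) ≤ d := Nat.cast_nonneg d
  have hsT := Real.sqrt_nonneg ηT
  have hsG := Real.sqrt_nonneg ηG
  have hK0 : 0 ≤ K := by linarith
  have hα0 : 0 ≤ α := by linarith
  have sαT : Real.sqrt ηT ≤ α := by linarith
  have sαG : Real.sqrt ηG ≤ α := by linarith
  have hover : ∀ {X B : Matrix (Fin n) (Fin d) ℝ} {η : ℝ} {c : Fin d → ℝ} {a : Fin n → ℝ},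
      (∀ j, ∑ i, X i j ^ 2 = 1) → (∀ j, ∑ i, B i j ^ 2 = 1) → d + Real.sqrt η ≤ α → l1 c ≤ K →
      l1 (Xᵀ *ᵥ a) ≤ K → l1 (Xᵀ *ᵥ spiked B η c a) ≤ α * K := by
    intro X B η c a hX hB hη hc ha
    refine (l1_overlap_spiked_le hX hB η c a).trans ?_
    calc _ ≤ (d : ℝ) * K + Real.sqrt η * K := add_le_add (mul_le_mul_of_nonneg_left hc hd0)
          (mul_le_mul_of_nonneg_left ha (Real.sqrt_nonneg η))
      _ = (d + Real.sqrt η) * K := by ring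
      _ ≤ α * K := mul_le_mul_of_nonneg_right hη hK0
  have hprod : ∀ {B B' : Matrix (Fin n) (Fin d) ℝ} {η η' : ℝ} {c c' : Fin d → ℝ}
      {a a' : Fin n → ℝ}, (∀ j, ∑ i, B i j ^ 2 = 1) → (∀ j, ∑ i, B' i j ^ 2 = 1) →
      Real.sqrt η ≤ α → Real.sqrt η' ≤ α → l1 c ≤ K → l1 c' ≤ K → l1 (Bᵀ *ᵥ a') ≤ K →
      l1 (B'ᵀ *ᵥ a) ≤ K →
      |spiked B η c a ⬝ᵥ spiked B' η' c' a' - Real.sqrt η * Real.sqrt η' * (a ⬝ᵥ a')| ≤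
        3 * (α * K ^ 2) := by
    intro B B' η η' c c' a a' hB hB' hη hη' hc hc' ha' ha
    refine (abs_spiked_dotProduct_sub_le hB hB' η η' c c' a a').trans ?_
    have h1 : l1 c * l1 c' ≤ α * K ^ 2 := (mul_le_sq_of_le (l1_nonneg _) hc hc' hK0).trans
      (le_mul_of_one_le_left (sq_nonneg K) hα)
    have h2 : Real.sqrt η' * (l1 c * l1 (Bᵀ *ᵥ a')) ≤ α * K ^ 2 :=
      mul_le_mul hη' (mul_le_sq_of_le (l1_nonneg _) hc ha' hK0)
        (mul_nonneg (l1_nonneg _) (l1_nonneg _)) hα0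
    have h3 : Real.sqrt η * (l1 c' * l1 (B'ᵀ *ᵥ a)) ≤ α * K ^ 2 :=
      mul_le_mul hη (mul_le_sq_of_le (l1_nonneg _) hc' ha hK0)
        (mul_nonneg (l1_nonneg _) (l1_nonneg _)) hα0
    calc _ ≤ α * K ^ 2 + α * K ^ 2 + α * K ^ 2 := add_le_add (add_le_add h1 h2) h3
      _ = 3 * (α * K ^ 2) := by ring
  have h1 := hprod (a := x.2.2.1) (a' := x.2.2.1) hU hU sαT sαT hc hc hUa hUa
  have h2 := hprod (a := x.2.2.2) (a' := x.2.2.2) hV hV sαG sαG hct hct hVb hVb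
  have h3 := hprod (a := x.2.2.1) (a' := x.2.2.2) hU hV sαT sαG hc hct hUb hVa
  rw [Real.mul_self_sqrt hηT] at h1
  rw [Real.mul_self_sqrt hηG] at h2
  have hα2 : α ≤ α ^ 2 := le_self_pow₀ hα two_ne_zero
  have hss : Real.sqrt ηT * Real.sqrt ηG ≤ α ^ 2 := mul_le_sq_of_le hsG sαT sαG hα0
  have pos : ∀ a : Fin n → ℝ, 0 ≤ (a ⬝ᵥ a) / n := fun a =>
    div_nonneg (Finset.sum_nonneg fun _ _ => mul_self_nonneg _) (Nat.cast_nonneg n)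
  have g1 := abs_div_sub_le hα hK1 hn1 hr1 hr2 hσ0 h1 hηT (hTα.trans hα2) f1
  have g2 := abs_div_sub_le hα hK1 hn1 hr1 hr2 hσ0 h2 hηG (hGα.trans hα2) f2
  have g3 := abs_div_sub_le hα hK1 hn1 hr1 hr2 hσ0 h3 (mul_nonneg hsT hsG) hss f3
  rw [mul_one] at g1 g2
  rw [mul_zero, sub_zero] at g3
  exact ⟨⟨hover hU hU hdT hc hUa, hover hV hU hdT hc hVa, hover hW hU hdT hc hWa⟩,
    ⟨hover hU hV hdG hct hUb, hover hV hV hdG hct hVb, hover hW hV hdG hct hWb⟩,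
    le_of_abs_sub_le hα hK1 hn1 h1 hTα (pos _) haa,
    le_of_abs_sub_le hα hK1 hn1 h2 hGα (pos _) hbb, g1, g2, g3⟩

theorem SampleBound.stepBound {n d : ℕ} {α K ϑ ηT ηG τ τt : ℝ}
    {U V W : Matrix (Fin n) (Fin d) ℝ} {y yt : Fin n → ℝ}
    (h : SampleBound α K ϑ ηT ηG U V W y yt) (hn : 0 < n) (hK1 : 1 ≤ K) (hα : 1 ≤ α)
    (hϑ : 0 ≤ ϑ) (hηT : 0 ≤ ηT) (hηG : 0 ≤ ηG) (hη : ηT + ηG ≤ α) (hτ : 0 ≤ τ) (hτα : τ ≤ α)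
    (hτt : 0 ≤ τt) (hτtα : τt ≤ α) (hd : 1 + d ≤ α)
    (hU : ∀ j, ∑ i, U i j ^ 2 = 1) (hV : ∀ j, ∑ i, V i j ^ 2 = 1) (hW : ∀ j, ∑ i, W i j ^ 2 = 1)
    {ct : Fin d → ℝ} (hct : l1 ct ≤ K) :
    StepBound τ τt ηT ηG (1 / n) (16 * α ^ 6 * K ^ 4) (16 * α ^ 6 * K ^ 4 * ϑ) U V W
      (vecMulVec y y) (vecMulVec yt yt) (vecMulVec yt ct) := by
  obtain ⟨⟨hUy, hVy, hWy⟩, ⟨hUyt, hVyt, hWyt⟩, byy, bytyt, g1, g2, g3⟩ := h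
  have hn0 : (0 : ℝ) < n := by exact_mod_cast hn
  have hK0 : 0 ≤ K := by linarith
  have hα0 : 0 ≤ α := by linarith
  have hαK : 0 ≤ α * K := mul_nonneg hα0 hK0
  have hαK2 : 0 ≤ α ^ 2 * K ^ 2 := by positivity
  have hτ2 : τ ^ 2 ≤ α ^ 2 := pow_le_pow_left₀ hτ hτα 2
  have outer : ∀ {u v : Fin d → ℝ}, l1 u ≤ α * K → l1 v ≤ α * K →
      ‖vecMulVec u v‖ ≤ α ^ 2 * K ^ 2 := fun {u v} hu hv =>
    (norm_vecMulVec_le u v).trans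
      ((mul_le_mul hu hv (l1_nonneg v) hαK).trans (le_of_eq (by ring)))
  have pyy : 0 ≤ y ⬝ᵥ y := Finset.sum_nonneg fun _ _ => mul_self_nonneg _
  have pytyt : 0 ≤ yt ⬝ᵥ yt := Finset.sum_nonneg fun _ _ => mul_self_nonneg _
  have byyt : |y ⬝ᵥ yt| ≤ n * (4 * (α * K ^ 2)) := by
    have h1 : 0 ≤ (y + yt) ⬝ᵥ (y + yt) := Finset.sum_nonneg fun _ _ => mul_self_nonneg _
    have h2 : 0 ≤ (y - yt) ⬝ᵥ (y - yt) := Finset.sum_nonneg fun _ _ => mul_self_nonneg _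
    simp only [add_dotProduct, dotProduct_add, sub_dotProduct, dotProduct_sub,
      dotProduct_comm yt y] at h1 h2
    clear g1 g2 g3 outer
    rw [abs_le]
    constructor <;> linarith
  have hWyy := outer hWy hWy
  have hWtt := outer hWyt hWyt
  have hWyt' : ‖vecMulVec (Wᵀ *ᵥ y) (Wᵀ *ᵥ yt) + vecMulVec (Wᵀ *ᵥ yt) (Wᵀ *ᵥ y)‖ ≤
      α ^ 2 * K ^ 2 + α ^ 2 * K ^ 2 :=
    (norm_add_le _ _).trans (add_le_add (outer hWy hWyt) (outer hWyt hWy))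
  have bound_disc : ∀ X : Matrix (Fin n) (Fin d) ℝ, l1 (Xᵀ *ᵥ y) ≤ α * K →
      l1 (Xᵀ *ᵥ yt) ≤ α * K →
      ‖Xᵀ * discRaw τ W (vecMulVec y y) (vecMulVec yt yt)‖ ≤ 16 * α ^ 6 * K ^ 4 :=
    fun X h1 h2 => by
      rw [transpose_mul_discRaw_vecMulVec]
      refine (norm_smul_le' hτ ((norm_sub_le _ _).trans
        (add_le_add (outer h1 hWy) (outer h2 hWyt)))).trans ?_
      have : τ * (α ^ 2 * K ^ 2 + α ^ 2 * K ^ 2) ≤ α * (α ^ 2 * K ^ 2 + α ^ 2 * K ^ 2) :=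
        mul_le_mul_of_nonneg_right hτα (add_nonneg hαK2 hαK2)
      exact (this.trans (le_of_eq (by ring : _ = 2 * (α ^ 3 * K ^ 2)))).trans
        (const_mul_pow_le hα hK1 (by norm_num) (by norm_num) (by norm_num))
  have unit_le : ∀ X : Matrix (Fin n) (Fin d) ℝ, (∀ j, ∑ i, X i j ^ 2 = 1) →
      ‖X‖ ≤ 16 * α ^ 6 * K ^ 4 := fun X hX =>
    (norm_le_of_unit hX).trans ((hd.trans (le_of_eq (by ring : _ = 1 * (α ^ 1 * K ^ 0)))).trans
      (const_mul_pow_le hα hK1 (by norm_num) (by norm_num) (by norm_num)))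
  have hgs : ‖τt • (Wᵀ * vecMulVec yt ct)‖ ≤ α ^ 3 * K ^ 2 := by
    have h1 : ‖vecMulVec (Wᵀ *ᵥ yt) ct‖ ≤ α ^ 2 * K ^ 2 :=
      outer hWyt (hct.trans (le_mul_of_one_le_left hK0 hα))
    rw [mul_vecMulVec]
    refine (norm_smul_le' hτt h1).trans ?_
    exact (mul_le_mul_of_nonneg_right hτtα hαK2).trans (le_of_eq (by ring))
  refine ⟨?_, unit_le U hU, unit_le V hV, unit_le W hW, ?_, ?_, bound_disc U hUy hUyt,
    bound_disc V hVy hVyt, bound_disc W hWy hWyt, ?_, ?_, ?_⟩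
  · have := const_mul_pow_le (C := 1) (i := 0) (j := 0) hα hK1 (by norm_num) (by norm_num)
      (by norm_num)
    simpa using this
  · exact (hgs.trans (le_of_eq (by ring : _ = 1 * (α ^ 3 * K ^ 2)))).trans
      (const_mul_pow_le hα hK1 (by norm_num) (by norm_num) (by norm_num))
  · have h1 : ‖W‖ ≤ α := (norm_le_of_unit hW).trans hd
    refine (norm_mul_le_of_le' h1 hgs).trans ?_
    exact (le_of_eq (by ring : _ = 1 * (α ^ 4 * K ^ 2))).trans
      (const_mul_pow_le hα hK1 (by norm_num) (by norm_num) (by norm_num))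
  · rw [discRaw_transpose_mul_self, smul_comm]
    have hcs : ∀ {p : ℝ} {M : Matrix (Fin d) (Fin d) ℝ} {m : ℝ}, |p| ≤ n * (4 * (α * K ^ 2)) →
        ‖M‖ ≤ m → ‖(1 / n : ℝ) • (p • M)‖ ≤ 4 * (α * K ^ 2) * m := fun {p M m} hp hM => by
      rw [smul_smul, norm_smul, Real.norm_eq_abs, abs_mul, abs_of_nonneg (by positivity)]
      refine mul_le_mul ?_ hM (norm_nonneg _) (by positivity)
      rw [one_div, inv_mul_le_iff₀ hn0]
      exact hp
    have key := (norm_sub_le _ _).trans ((add_le_add ((norm_add_le _ _).trans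
        (add_le_add (hcs (by rwa [abs_of_nonneg pyy]) hWyy)
          (hcs (by rwa [abs_of_nonneg pytyt]) hWtt)))
        (hcs byyt hWyt')))
    rw [smul_sub, smul_add]
    refine (norm_smul_le' (sq_nonneg τ) key).trans ?_
    refine (mul_le_mul_of_nonneg_right hτ2 (by positivity)).trans
      ((le_of_eq (by ring : _ = 16 * (α ^ 5 * K ^ 4))).trans
      (const_mul_pow_le hα hK1 (by norm_num) (by norm_num) (by norm_num)))
  · rw [discQuad_vecMulVec]
    have h1 := norm_smul_le' hηT hWyy
    have h2 := norm_smul_le' hηG hWtt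
    refine (norm_smul_le' (sq_nonneg τ) ((norm_add_le _ _).trans (add_le_add h1 h2))).trans ?_
    have h3 : ηT * (α ^ 2 * K ^ 2) + ηG * (α ^ 2 * K ^ 2) ≤ α * (α ^ 2 * K ^ 2) := by
      rw [← add_mul]; exact mul_le_mul_of_nonneg_right hη hαK2
    have h4 := mul_le_mul hτ2 h3 (by positivity) (by positivity)
    exact (h4.trans (le_of_eq (by ring : _ = 1 * (α ^ 5 * K ^ 2)))).trans
      (const_mul_pow_le hα hK1 (by norm_num) (by norm_num) (by norm_num))
  · have hid : (1 / n : ℝ) • ((discRaw τ W (vecMulVec y y) (vecMulVec yt yt))ᵀ *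
          discRaw τ W (vecMulVec y y) (vecMulVec yt yt))
          - discQuad τ ηT ηG W (vecMulVec y y) (vecMulVec yt yt) =
        τ ^ 2 • (((y ⬝ᵥ y) / n - ηT) • vecMulVec (Wᵀ *ᵥ y) (Wᵀ *ᵥ y)
          + ((yt ⬝ᵥ yt) / n - ηG) • vecMulVec (Wᵀ *ᵥ yt) (Wᵀ *ᵥ yt)
          - ((y ⬝ᵥ yt) / n) • (vecMulVec (Wᵀ *ᵥ y) (Wᵀ *ᵥ yt)
            + vecMulVec (Wᵀ *ᵥ yt) (Wᵀ *ᵥ y))) := by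
      rw [discRaw_transpose_mul_self, discQuad_vecMulVec]
      module
    rw [hid]
    have hcs : ∀ {p : ℝ} {M : Matrix (Fin d) (Fin d) ℝ} {m : ℝ},
        |p| ≤ 3 * (α ^ 2 * K ^ 2 * ϑ) → ‖M‖ ≤ m → ‖p • M‖ ≤ 3 * (α ^ 2 * K ^ 2 * ϑ) * m :=
      fun {p M m} hp hM => by
        rw [norm_smul, Real.norm_eq_abs]
        exact mul_le_mul hp hM (norm_nonneg _) (by positivity)
    have key := (norm_sub_le _ _).trans (add_le_add ((norm_add_le _ _).trans
        (add_le_add (hcs g1 hWyy) (hcs g2 hWtt))) (hcs g3 hWyt'))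
    refine (norm_smul_le' (sq_nonneg τ) key).trans ?_
    refine (mul_le_mul_of_nonneg_right hτ2 (by positivity)).trans
      ((le_of_eq (by ring : _ = 12 * (α ^ 6 * K ^ 4) * ϑ)).trans ?_)
    exact mul_le_mul_of_nonneg_right
      (const_mul_pow_le hα hK1 (by norm_num) le_rfl le_rfl) hϑ

/-- All step sizes of one update are bounded by a power of the size of the noise, and the
fluctuation of the quadratic term is smaller by a factor of order `1 / √n`. -/
theorem exists_stepBound (d : ℕ) {τ τt ηT ηG : ℝ} (hτ : 0 ≤ τ) (hτt : 0 ≤ τt) (hηT : 0 ≤ ηT)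
    (hηG : 0 ≤ ηG) : ∃ β : ℝ, 1 + d ≤ β ∧ ∀ (n : ℕ), 0 < n →
    ∀ (U V W : Matrix (Fin n) (Fin d) ℝ), (∀ j, ∑ i, U i j ^ 2 = 1) →
      (∀ j, ∑ i, V i j ^ 2 = 1) → (∀ j, ∑ i, W i j ^ 2 = 1) → ∀ x : Noise d n,
      StepBound τ τt ηT ηG (1 / n) (β * noiseSize U V W x ^ 4)
        (β * noiseSize U V W x ^ 4 * ((1 + noiseFluct x) / Real.sqrt n)) U V W
        (vecMulVec (spiked U ηT x.1 x.2.2.1) (spiked U ηT x.1 x.2.2.1))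
        (vecMulVec (spiked V ηG x.2.1 x.2.2.2) (spiked V ηG x.2.1 x.2.2.2))
        (vecMulVec (spiked V ηG x.2.1 x.2.2.2) x.2.1) := by
  obtain ⟨α, hα⟩ : ∃ α : ℝ, α = 1 + d + Real.sqrt ηT + Real.sqrt ηG + ηT + ηG + τ + τt := ⟨_, rfl⟩
  have hd0 : (0 : ℝ) ≤ d := Nat.cast_nonneg d
  have hsT := Real.sqrt_nonneg ηT
  have hsG := Real.sqrt_nonneg ηG
  have hα1 : 1 ≤ α := by linarith
  have hdα : 1 + d ≤ α := by linarith
  have h1 := one_le_pow₀ (n := 5) hα1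
  refine ⟨16 * α ^ 6, by nlinarith [pow_succ α 5], fun n hn U V W hU hV hW x => ?_⟩
  obtain ⟨⟨hK1, -, hct⟩, -⟩ := noiseSize_bounds U V W x
  have hϑ : 0 ≤ (1 + noiseFluct x) / Real.sqrt n :=
    div_nonneg (by linarith [noiseFluct_nonneg x]) (Real.sqrt_nonneg _)
  exact (sampleBound_noise hn hηT hηG hα1 (by linarith) (by linarith) (by linarith) (by linarith)
    hU hV hW x).stepBound hn hK1 hα1 hϑ hηT hηG (by linarith) hτ (by linarith) hτt (by linarith)
    hdα hU hV hW hct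

end Frobenius

/-! ### One step of the algorithm -/

section Step

variable {n d : ℕ}

/-- A microscopic state `(U, V, W)`. -/
abbrev State (n d : ℕ) : Type :=
  Matrix (Fin n) (Fin d) ℝ × Matrix (Fin n) (Fin d) ℝ × Matrix (Fin n) (Fin d) ℝ

/-- The true sample `y` produced from a pair of a state and a noise. -/
noncomputable def trueSample (ηT : ℝ) (p : State n d × Noise d n) : Fin n → ℝ :=
  spiked p.1.1 ηT p.2.1 p.2.2.2.1

/-- The generated sample `ỹ` produced from a pair of a state and a noise. -/
noncomputable def genSample (ηG : ℝ) (p : State n d × Noise d n) : Fin n → ℝ :=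
  spiked p.1.2.1 ηG p.2.2.1 p.2.2.2.2

/-- The generator after a gradient step, before its projection. -/
noncomputable def genMove (τt ηG : ℝ) (p : State n d × Noise d n) : Matrix (Fin n) (Fin d) ℝ :=
  p.1.2.1 + (1 / n : ℝ) • genRaw τt p.1.2.2 (vecMulVec (genSample ηG p) p.2.2.1)

/-- The discriminator after a gradient step, before its projection. -/
noncomputable def discMove (τ ηT ηG : ℝ) (p : State n d × Noise d n) :
    Matrix (Fin n) (Fin d) ℝ :=
  p.1.2.2 + (1 / n : ℝ) • discRaw τ p.1.2.2 (vecMulVec (trueSample ηT p) (trueSample ηT p))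
    (vecMulVec (genSample ηG p) (genSample ηG p))

/-- The update of the microscopic state. -/
noncomputable def step (τ τt ηT ηG : ℝ)
    (πV πW : Matrix (Fin n) (Fin d) ℝ → Matrix (Fin n) (Fin d) ℝ)
    (p : State n d × Noise d n) : State n d :=
  (p.1.1, πV (genMove τt ηG p), πW (discMove τ ηT ηG p))

/-- The leading part of `n` times the increment of the overlaps, at a state and a noise. -/
noncomputable def leadStep (τ τt ηT ηG : ℝ) (p : State n d × Noise d n) :
    Fin 4 → Matrix (Fin d) (Fin d) ℝ :=
  leadInc τ τt ηT ηG p.1.1 p.1.2.1 p.1.2.2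
    (vecMulVec (trueSample ηT p) (trueSample ηT p))
    (vecMulVec (genSample ηG p) (genSample ηG p)) (vecMulVec (genSample ηG p) p.2.2.1)

/-- The states in which `U` and `W` have orthonormal columns and `V` has columns of unit
length. -/
def goodSet (n d : ℕ) : Set (State n d) :=
  {s | s.1ᵀ * s.1 = 1 ∧ s.2.1 ∈ genSet n d ∧ s.2.2 ∈ discSet n d}

/-- The overlaps of a state. -/
def stateOverlap (s : State n d) : Fin 4 → Matrix (Fin d) (Fin d) ℝ := overlap s.1 s.2.1 s.2.2

theorem sum_sq_eq_one_of_orthonormal {X : Matrix (Fin n) (Fin d) ℝ} (hX : Xᵀ * X = 1)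
    (j : Fin d) : ∑ i, X i j ^ 2 = 1 := by
  have h := congrFun (congrFun hX j) j
  rw [Matrix.mul_apply, Matrix.one_apply_eq] at h
  rw [← h]
  exact Finset.sum_congr rfl fun i _ => by rw [Matrix.transpose_apply, sq]

theorem diagPart_transpose_mul_self {X : Matrix (Fin n) (Fin d) ℝ}
    (hX : ∀ j, ∑ i, X i j ^ 2 = 1) : diagPart (Xᵀ * X) = 1 := by
  have : (Xᵀ * X).diag = 1 := by
    funext j
    simp [Matrix.mul_apply, ← hX j, sq]
  rw [diagPart, this, Matrix.diagonal_one']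

variable {τ τt ηT ηG : ℝ} {πV πW : Matrix (Fin n) (Fin d) ℝ → Matrix (Fin n) (Fin d) ℝ}

theorem step_mem_goodSet (hπV : IsProjection (genSet n d) πV) (hπW : IsProjection (discSet n d) πW)
    {s : State n d} (hs : s ∈ goodSet n d) (x : Noise d n) :
    step τ τt ηT ηG πV πW (s, x) ∈ goodSet n d :=
  ⟨hs.1, (hπV.2 _).1, (hπW.2 _).1⟩

theorem unit_of_mem_goodSet {s : State n d} (hs : s ∈ goodSet n d) :
    (∀ j, ∑ i, s.1 i j ^ 2 = 1) ∧ (∀ j, ∑ i, s.2.1 i j ^ 2 = 1) ∧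
      ∀ j, ∑ i, s.2.2 i j ^ 2 = 1 :=
  ⟨sum_sq_eq_one_of_orthonormal hs.1, mem_genSet_iff.1 hs.2.1,
    sum_sq_eq_one_of_orthonormal hs.2.2⟩

theorem abs_stateOverlap_le_one {s : State n d} (hs : s ∈ goodSet n d) (m : Fin 4) (i j : Fin d) :
    |stateOverlap s m i j| ≤ 1 := by
  obtain ⟨hU, hV, hW⟩ := unit_of_mem_goodSet hs
  fin_cases m
  · exact abs_transpose_mul_apply_le_one hU hV i j
  · exact abs_transpose_mul_apply_le_one hU hW i j
  · exact abs_transpose_mul_apply_le_one hV hW i j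
  · exact abs_transpose_mul_apply_le_one hV hV i j

section Frobenius

attribute [local instance] Matrix.frobeniusNormedAddCommGroup Matrix.frobeniusNormedSpace

theorem abs_apply_le_norm {k l : Type*} [Fintype k] [Fintype l] (A : Matrix k l ℝ) (i : k) (j : l) :
    |A i j| ≤ ‖A‖ := by
  refine abs_le_of_sq_le_sq ?_ (norm_nonneg _)
  rw [norm_sq_eq_sum]
  exact (Finset.single_le_sum (f := fun j => A i j ^ 2) (fun _ _ => sq_nonneg _)
    (Finset.mem_univ j)).trans (Finset.single_le_sum (f := fun i => ∑ j, A i j ^ 2)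
      (fun _ _ => Finset.sum_nonneg fun _ _ => sq_nonneg _) (Finset.mem_univ i))

/-- Pointwise bounds for one step from a good state: the size of its leading part and the distance
of the step to it, in terms of the size and the fluctuation of the noise. -/
theorem exists_pointwise_step_bound (d : ℕ) {τ τt ηT ηG : ℝ} (hτ : 0 ≤ τ) (hτt : 0 ≤ τt) (hηT : 0 ≤ ηT)
    (hηG : 0 ≤ ηG) : ∃ β : ℝ, 0 ≤ β ∧ ∀ n : ℕ, 0 < n →
      ∀ s ∈ goodSet n d, ∀ (x : Noise d n) (m : Fin 4) (i j : Fin d),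
      |leadStep τ τt ηT ηG (s, x) m i j| ≤ β * noiseSize s.1 s.2.1 s.2.2 x ^ 16 ∧
      ∀ πV πW, IsProjection (genSet n d) πV → IsProjection (discSet n d) πW →
      |stateOverlap (step τ τt ηT ηG πV πW (s, x)) m i j - stateOverlap s m i j
        - 1 / n * leadStep τ τt ηT ηG (s, x) m i j| ≤
      β * (noiseSize s.1 s.2.1 s.2.2 x ^ 28 * (1 + noiseFluct x)) / (n * Real.sqrt n) := by
  obtain ⟨β, hdβ, hβ⟩ := exists_stepBound d hτ hτt hηT hηG
  have hd0 : (0 : ℝ) ≤ d := Nat.cast_nonneg d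
  have hβ1 : 1 ≤ β := by linarith
  refine ⟨6 * β ^ 4 + 200 * β ^ 7, by positivity, fun n hn s hs x m i j => ?_⟩
  obtain ⟨hU, hV, hW⟩ := unit_of_mem_goodSet hs
  have hB := hβ n hn s.1 s.2.1 s.2.2 hU hV hW x
  have hK1 := (noiseSize_bounds s.1 s.2.1 s.2.2 x).1.1
  have hσ0 := noiseFluct_nonneg x
  set K := noiseSize s.1 s.2.1 s.2.2 x
  have hK4 : 1 ≤ K ^ 4 := one_le_pow₀ hK1
  refine ⟨?_, fun πV πW hπV hπW => ?_⟩
  · refine (abs_apply_le_norm _ i j).trans ((hB.norm_leadInc_le m).trans ?_)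
    have : 0 ≤ 200 * β ^ 7 * K ^ 16 := by positivity
    nlinarith
  · have hs' := step_mem_goodSet (τ := τ) (τt := τt) (ηT := ηT) (ηG := ηG) hπV hπW hs x
    obtain ⟨-, hV', hW'⟩ := unit_of_mem_goodSet hs'
    have hL : (1 + d : ℝ) ≤ β * K ^ 4 := hdβ.trans (le_mul_of_one_le_right (by linarith) hK4)
    obtain ⟨σ, hσ, hA⟩ := exists_diagonal_of_nearest (hπV.2 (genMove τt ηG (s, x))).1
      (hπV.2 (genMove τt ηG (s, x))).2
    obtain ⟨N, hN, hNpos, hN2⟩ := exists_polar_of_nearest (hπW.2 (discMove τ ηT ηG (s, x))).1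
      (hπW.2 (discMove τ ηT ηG (s, x))).2
    have hn0 : (0 : ℝ) < n := by exact_mod_cast hn
    have hn1 : (1 : ℝ) ≤ n := by exact_mod_cast hn
    have key := hB.norm_overlap_sub_le (by positivity) (by rw [div_le_one hn0]; exact hn1)
      (diagPart_transpose_mul_self hV) (diagPart_transpose_mul_self hV')
      ((norm_le_of_unit hV').trans hL) hs.2.2 hs'.2.2 ((norm_le_of_unit hW').trans hL)
      hσ hA hN hNpos hN2 m
    have habs := (abs_apply_le_norm _ i j).trans key
    refine (le_of_eq ?_).trans (habs.trans ?_)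
    · rfl
    · have hr1 : 1 ≤ Real.sqrt n := Real.one_le_sqrt.2 hn1
      have hr2 : Real.sqrt n * Real.sqrt n = n := Real.mul_self_sqrt hn0.le
      generalize noiseFluct x = f at *
      generalize Real.sqrt n = r at *
      have h1 : 1 ≤ β * K ^ 4 * (1 + f) := by
        have := mul_le_mul hβ1 hK4 zero_le_one (by linarith)
        nlinarith
      have h2 : (1 / (n : ℝ)) ^ 2 ≤ 1 / n * (β * K ^ 4 * ((1 + f) / r)) := by
        rw [sq]
        refine mul_le_mul_of_nonneg_left ?_ (by positivity)
        rw [← hr2, mul_div_assoc', div_le_div_iff₀ (by positivity) (by positivity)]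
        nlinarith
      calc 100 * (β * K ^ 4) ^ 6 * ((1 / (n : ℝ)) ^ 2 + 1 / n * (β * K ^ 4 * ((1 + f) / r)))
          ≤ 100 * (β * K ^ 4) ^ 6 * (2 * (1 / n * (β * K ^ 4 * ((1 + f) / r)))) := by
            gcongr; linarith
        _ = 200 * β ^ 7 * (K ^ 28 * (1 + f)) / (n * r) := by field_simp; ring
        _ ≤ _ := by gcongr; nlinarith [pow_pos (by linarith : 0 < β) 4]

end Frobenius

end Step

/-! ### Measurability of the update -/

section Measurability

instance {n d : ℕ} : BorelSpace (Matrix (Fin n) (Fin d) ℝ) :=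
  inferInstanceAs (BorelSpace (Fin n → Fin d → ℝ))

instance {n d : ℕ} : SecondCountableTopology (Matrix (Fin n) (Fin d) ℝ) :=
  inferInstanceAs (SecondCountableTopology (Fin n → Fin d → ℝ))

variable {n d : ℕ}

theorem continuous_trueSample (ηT : ℝ) :
    Continuous (trueSample ηT : State n d × Noise d n → Fin n → ℝ) := by
  unfold trueSample spiked
  fun_prop

theorem continuous_genSample (ηG : ℝ) :
    Continuous (genSample ηG : State n d × Noise d n → Fin n → ℝ) := by
  unfold genSample spiked
  fun_prop

theorem continuous_genMove (τt ηG : ℝ) :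
    Continuous (genMove τt ηG : State n d × Noise d n → Matrix (Fin n) (Fin d) ℝ) := by
  have := continuous_genSample (n := n) (d := d) ηG
  unfold genMove genRaw
  fun_prop

theorem continuous_discMove (τ ηT ηG : ℝ) :
    Continuous (discMove τ ηT ηG : State n d × Noise d n → Matrix (Fin n) (Fin d) ℝ) := by
  have := continuous_genSample (n := n) (d := d) ηG
  have := continuous_trueSample (n := n) (d := d) ηT
  unfold discMove discRaw
  fun_prop

theorem measurable_step (τ τt ηT ηG : ℝ)
    {πV πW : Matrix (Fin n) (Fin d) ℝ → Matrix (Fin n) (Fin d) ℝ} (hV : Measurable πV)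
    (hW : Measurable πW) : Measurable (step τ τt ηT ηG πV πW) :=
  (measurable_fst.comp measurable_fst).prodMk
    ((hV.comp (continuous_genMove τt ηG).measurable).prodMk
      (hW.comp (continuous_discMove τ ηT ηG).measurable))

theorem continuous_stateOverlap (m : Fin 4) :
    Continuous fun s : State n d => stateOverlap s m := by
  fin_cases m <;> simp only [stateOverlap, overlap] <;> fun_prop

theorem continuous_leadStep (τ τt ηT ηG : ℝ) (m : Fin 4) :
    Continuous fun p : State n d × Noise d n => leadStep τ τt ηT ηG p m := by
  have := continuous_genSample (n := n) (d := d) ηG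
  have := continuous_trueSample (n := n) (d := d) ηT
  fin_cases m <;>
    simp only [leadStep, leadInc, genDir, genRaw, discCorr, discQuad, discRaw, diagPart] <;>
    fun_prop

theorem continuous_drift (τ τt ηT ηG : ℝ) (Λ Λt : Matrix (Fin d) (Fin d) ℝ) (m : Fin 4) :
    Continuous fun x : Fin 4 → Matrix (Fin d) (Fin d) ℝ => drift τ τt ηT ηG Λ Λt x m := by
  fin_cases m <;> simp only [drift, Lmat, Hmat] <;> fun_prop

theorem measurableSet_goodSet : MeasurableSet (goodSet n d) := by
  have h : goodSet n d = {s : State n d | s.1ᵀ * s.1 = 1} ∩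
      ({s : State n d | ∀ j, ∑ i, s.2.1 i j ^ 2 = 1} ∩ {s : State n d | s.2.2ᵀ * s.2.2 = 1}) := by
    ext s
    simp [goodSet, mem_genSet_iff, discSet]
  rw [h]
  refine IsClosed.measurableSet (IsClosed.inter (isClosed_eq (by fun_prop) continuous_const)
    (IsClosed.inter ?_ (isClosed_eq (by fun_prop) continuous_const)))
  simp only [Set.ofPred_forall]
  exact isClosed_iInter fun j => isClosed_eq (by fun_prop) continuous_const

end Measurability

/-! ### Moments of one step -/

section Moments

variable {n d : ℕ} {τ τt ηT ηG : ℝ} {ν νt : Measure (Fin d → ℝ)}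
  {Λ Λt : Matrix (Fin d) (Fin d) ℝ}

theorem hasMean_leadStep (hν : IsCentredLaw ν Λ) (hνt : IsCentredLaw νt Λt) (hηT : 0 ≤ ηT)
    (hηG : 0 ≤ ηG) {s : State n d} (hs : s ∈ goodSet n d) (m : Fin 4) :
    HasMean (noiseLaw ν νt n) (fun x => leadStep τ τt ηT ηG (s, x) m)
      (drift τ τt ηT ηG Λ Λt (stateOverlap s) m) := by
  have := hν.prob
  have := hνt.prob
  have hA := (hasMean_spiked (n := n) hν s.1 hηT).comp_measurePreserving
    (f := fun x => vecMulVec (spiked s.1 ηT x.1 x.2) (spiked s.1 ηT x.1 x.2))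
    (measurePreserving_noise_true ν νt)
  have hB := (hasMean_spiked (n := n) hνt s.2.1 hηG).comp_measurePreserving
    (f := fun x => vecMulVec (spiked s.2.1 ηG x.1 x.2) (spiked s.2.1 ηG x.1 x.2))
    (measurePreserving_noise_gen ν νt)
  have hC := (hasMean_spiked_feature (n := n) hνt s.2.1 ηG).comp_measurePreserving
    (f := fun x => vecMulVec (spiked s.2.1 ηG x.1 x.2) x.1)
    (measurePreserving_noise_gen ν νt)
  have h := HasMean.leadInc hA hB hC τ τt ηT ηG s.1 s.2.1 s.2.2 m
  rw [leadInc_mean hs.1 hs.2.2 hν.isSymm hνt.isSymm] at h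
  exact h

/-- The centred leading part of the increment of the overlaps in one step. -/
noncomputable def centredStep (τ τt ηT ηG : ℝ) (Λ Λt : Matrix (Fin d) (Fin d) ℝ) (m : Fin 4)
    (i j : Fin d) (p : State n d × Noise d n) : ℝ :=
  1 / n * (leadStep τ τt ηT ηG p m i j - drift τ τt ηT ηG Λ Λt (stateOverlap p.1) m i j)

/-- What is left of the increment of the overlaps in one step, besides its leading part. -/
noncomputable def stepError (τ τt ηT ηG : ℝ)
    (πV πW : Matrix (Fin n) (Fin d) ℝ → Matrix (Fin n) (Fin d) ℝ) (m : Fin 4)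
    (i j : Fin d) (p : State n d × Noise d n) : ℝ :=
  stateOverlap (step τ τt ηT ηG πV πW p) m i j - stateOverlap p.1 m i j
    - 1 / n * leadStep τ τt ηT ηG p m i j

theorem measurable_centredStep (m : Fin 4) (i j : Fin d) :
    Measurable (centredStep (n := n) τ τt ηT ηG Λ Λt m i j) := by
  have h1 := (continuous_leadStep (n := n) (d := d) τ τt ηT ηG m).matrix_elem i j
  have h2 : Continuous fun p : State n d × Noise d n => stateOverlap p.1 :=
    continuous_pi fun m => (continuous_stateOverlap m).comp continuous_fst
  have h3 := ((continuous_drift τ τt ηT ηG Λ Λt m).comp h2).matrix_elem i j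
  exact (continuous_const.mul (h1.sub h3)).measurable

theorem measurable_stepError
    {πV πW : Matrix (Fin n) (Fin d) ℝ → Matrix (Fin n) (Fin d) ℝ} (hV : Measurable πV)
    (hW : Measurable πW) (m : Fin 4) (i j : Fin d) :
    Measurable (stepError τ τt ηT ηG πV πW m i j) := by
  have h1 := ((continuous_leadStep (n := n) (d := d) τ τt ηT ηG m).matrix_elem i j).measurable
  have h2 := ((continuous_stateOverlap (n := n) (d := d) m).matrix_elem i j).measurable
  exact ((h2.comp (measurable_step τ τt ηT ηG hV hW)).sub (h2.comp measurable_fst)).sub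
    (h1.const_mul _)

theorem integral_centredStep (hν : IsCentredLaw ν Λ) (hνt : IsCentredLaw νt Λt) (hηT : 0 ≤ ηT)
    (hηG : 0 ≤ ηG) {s : State n d} (hs : s ∈ goodSet n d) (m : Fin 4) (i j : Fin d) :
    ∫ x, centredStep τ τt ηT ηG Λ Λt m i j (s, x) ∂(noiseLaw ν νt n) = 0 := by
  have := hν.prob
  have := hνt.prob
  have h := hasMean_leadStep (τ := τ) (τt := τt) hν hνt hηT hηG hs m
  simp only [centredStep]
  rw [integral_const_mul, integral_sub (h.integrable i j) (integrable_const _), h.mean]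
  simp

theorem lintegral_sub_integral_sq_le {Ω : Type*} [MeasurableSpace Ω] {μ : Measure Ω}
    [IsProbabilityMeasure μ] {f : Ω → ℝ} (hf : Measurable f) {B : ℝ} (hB : 0 ≤ B)
    (h : ∫⁻ ω, ENNReal.ofReal (f ω ^ 2) ∂μ ≤ ENNReal.ofReal B) :
    ∫⁻ ω, ENNReal.ofReal ((f ω - ∫ ω, f ω ∂μ) ^ 2) ∂μ ≤ ENNReal.ofReal B := by
  obtain ⟨hL, hB⟩ := integral_sq_le_of_lintegral_le hf.aestronglyMeasurable hB h
  have h1 := variance_le_expectation_sq (μ := μ) (X := f) hf.aestronglyMeasurable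
  rw [variance_eq_integral hf.aemeasurable] at h1
  have hint : Integrable (fun ω => (f ω - ∫ ω, f ω ∂μ) ^ 2) μ :=
    (hL.sub (memLp_const _)).integrable_sq
  rw [← ofReal_integral_eq_lintegral_ofReal hint (ae_of_all _ fun _ => sq_nonneg _)]
  exact ENNReal.ofReal_le_ofReal (h1.trans hB)

theorem exists_lintegral_noiseSize_pow_le (hν : IsCentredLaw ν Λ) (hνt : IsCentredLaw νt Λt)
    (p : ℕ) : ∃ B : ℝ, 0 ≤ B ∧ ∀ n : ℕ, 0 < n → ∀ s ∈ goodSet n d,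
      (Measurable fun x : Noise d n => noiseSize s.1 s.2.1 s.2.2 x) ∧
      ∫⁻ x, ENNReal.ofReal (noiseSize s.1 s.2.1 s.2.2 x ^ p) ∂(noiseLaw ν νt n) ≤
        ENNReal.ofReal B := by
  obtain ⟨hm, hB⟩ := uniformMoments_noiseSize (d := d) hν hνt
  obtain ⟨B, hB⟩ := hB p
  refine ⟨B, B.2, fun n hn s hs => ?_⟩
  obtain ⟨hU, hV, hW⟩ := unit_of_mem_goodSet hs
  let u : UnitState d := ⟨n, hn, s.1, s.2.1, s.2.2, hU, hV, hW⟩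
  refine ⟨hm u, ?_⟩
  refine (lintegral_mono fun x => ?_).trans ((hB u).trans_eq (by simp))
  have hK : 0 ≤ noiseSize s.1 s.2.1 s.2.2 x := by
    linarith [(noiseSize_bounds s.1 s.2.1 s.2.2 x).1.1]
  rw [ENNReal.ofReal_pow hK, ← Real.enorm_of_nonneg hK]

theorem exists_lintegral_centredStep_sq_le (hν : IsCentredLaw ν Λ) (hνt : IsCentredLaw νt Λt)
    (hτ : 0 ≤ τ) (hτt : 0 ≤ τt) (hηT : 0 ≤ ηT) (hηG : 0 ≤ ηG) :
    ∃ B : ℝ, 0 ≤ B ∧ ∀ n : ℕ, 0 < n → ∀ s ∈ goodSet n d, ∀ (m : Fin 4) (i j : Fin d),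
      ∫⁻ x, ENNReal.ofReal (centredStep τ τt ηT ηG Λ Λt m i j (s, x) ^ 2) ∂(noiseLaw ν νt n) ≤
        ENNReal.ofReal (B / n ^ 2) := by
  have := hν.prob
  have := hνt.prob
  obtain ⟨β, hβ0, hβ⟩ := exists_pointwise_step_bound d hτ hτt hηT hηG
  obtain ⟨B, hB0, hB⟩ := exists_lintegral_noiseSize_pow_le hν hνt 32
  refine ⟨β ^ 2 * B, by positivity, fun n hn s hs m i j => ?_⟩
  obtain ⟨hKm, hB⟩ := hB n hn s hs
  have hmean := (hasMean_leadStep (τ := τ) (τt := τt) hν hνt hηT hηG hs m).mean i j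
  have hmeas : Measurable fun x => 1 / n * leadStep τ τt ηT ηG (s, x) m i j :=
    ((((continuous_leadStep (n := n) (d := d) τ τt ηT ηG m).matrix_elem i j).measurable).comp
      (measurable_const.prodMk measurable_id)).const_mul _
  have h := lintegral_sub_integral_sq_le (μ := noiseLaw ν νt n) hmeas
    (B := β ^ 2 * B / n ^ 2) (by positivity) ?_
  · rw [integral_const_mul, hmean] at h
    simpa only [centredStep, mul_sub] using h
  · calc ∫⁻ x, ENNReal.ofReal ((1 / n * leadStep τ τt ηT ηG (s, x) m i j) ^ 2) ∂noiseLaw ν νt n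
        ≤ ∫⁻ x, ENNReal.ofReal (β ^ 2 / n ^ 2) *
            ENNReal.ofReal (noiseSize s.1 s.2.1 s.2.2 x ^ 32) ∂noiseLaw ν νt n := by
          refine lintegral_mono fun x => ?_
          rw [← ENNReal.ofReal_mul (by positivity)]
          refine ENNReal.ofReal_le_ofReal ?_
          have h1 := (hβ n hn s hs x m i j).1
          have h2 := pow_le_pow_left₀ (abs_nonneg _) h1 2
          rw [sq_abs] at h2
          calc _ = leadStep τ τt ηT ηG (s, x) m i j ^ 2 / n ^ 2 := by ring
            _ ≤ (β * noiseSize s.1 s.2.1 s.2.2 x ^ 16) ^ 2 / n ^ 2 := by gcongr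
            _ = _ := by ring
      _ ≤ ENNReal.ofReal (β ^ 2 / n ^ 2) * ENNReal.ofReal B := by
          rw [lintegral_const_mul _ (by fun_prop)]
          gcongr
      _ = _ := by rw [← ENNReal.ofReal_mul (by positivity)]; congr 1; ring

theorem exists_lintegral_stepError_le (hν : IsCentredLaw ν Λ) (hνt : IsCentredLaw νt Λt)
    (hτ : 0 ≤ τ) (hτt : 0 ≤ τt) (hηT : 0 ≤ ηT) (hηG : 0 ≤ ηG) :
    ∃ B : ℝ, 0 ≤ B ∧ ∀ n : ℕ, 0 < n → ∀ s ∈ goodSet n d, ∀ (m : Fin 4) (i j : Fin d)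
      (πV πW : _), IsProjection (genSet n d) πV → IsProjection (discSet n d) πW →
      ∫⁻ x, ENNReal.ofReal |stepError τ τt ηT ηG πV πW m i j (s, x)| ∂(noiseLaw ν νt n) ≤
        ENNReal.ofReal (B / (n * Real.sqrt n)) := by
  have := hν.prob
  have := hνt.prob
  obtain ⟨β, hβ0, hβ⟩ := exists_pointwise_step_bound d hτ hτt hηT hηG
  obtain ⟨B, hB0, hB⟩ := exists_lintegral_noiseSize_pow_le hν hνt 56
  obtain ⟨B', hB'⟩ := exists_lintegral_noiseFluct_sq_le hν hνt
  refine ⟨β * (B + 1 + B'), by positivity, fun n hn s hs m i j πV πW hV hW => ?_⟩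
  obtain ⟨hKm, hB⟩ := hB n hn s hs
  have hf := hB' n hn
  have hfm : Measurable fun x : Noise d n => noiseFluct x := by
    unfold noiseFluct
    simp only [dotProduct]
    fun_prop
  calc ∫⁻ x, ENNReal.ofReal |stepError τ τt ηT ηG πV πW m i j (s, x)| ∂noiseLaw ν νt n
      ≤ ∫⁻ x, ENNReal.ofReal (β / (n * Real.sqrt n)) *
          (ENNReal.ofReal (noiseSize s.1 s.2.1 s.2.2 x ^ 56) + ENNReal.ofReal 1
            + ENNReal.ofReal (noiseFluct x ^ 2)) ∂noiseLaw ν νt n := by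
        refine lintegral_mono fun x => ?_
        have hK : 0 ≤ noiseSize s.1 s.2.1 s.2.2 x := by
          linarith [(noiseSize_bounds s.1 s.2.1 s.2.2 x).1.1]
        rw [← ENNReal.ofReal_add (by positivity) (by positivity),
          ← ENNReal.ofReal_add (by positivity) (by positivity),
          ← ENNReal.ofReal_mul (by positivity)]
        refine ENNReal.ofReal_le_ofReal (((hβ n hn s hs x m i j).2 πV πW hV hW).trans ?_)
        rw [div_mul_eq_mul_div]
        gcongr
        nlinarith [sq_nonneg (noiseSize s.1 s.2.1 s.2.2 x ^ 28 - (1 + noiseFluct x)),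
          sq_nonneg (1 - noiseFluct x)]
    _ ≤ ENNReal.ofReal (β / (n * Real.sqrt n)) *
          (ENNReal.ofReal B + ENNReal.ofReal 1 + ENNReal.ofReal B') := by
        rw [lintegral_const_mul _ (by fun_prop), lintegral_add_left (by fun_prop),
          lintegral_add_left (by fun_prop)]
        gcongr
        · simp
        · simpa using hf
    _ = _ := by
        rw [← ENNReal.ofReal_add hB0 zero_le_one, ← ENNReal.ofReal_add (by positivity) (NNReal.coe_nonneg B'),
          ← ENNReal.ofReal_mul (by positivity)]
        congr 1
        ring

end Moments

/-! ### Gradients of the loss -/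

section Gradient

variable {n d : ℕ}

theorem hasDerivAt_Fout_Dhat (u v : Fin d → ℝ) :
    HasDerivAt (fun t : ℝ => Fout (Dhat (u + t • v))) (u ⬝ᵥ v) 0 := by
  have h : ∀ t : ℝ, Fout (Dhat (u + t • v)) = ∑ l, (u l + t * v l) ^ 2 / 2 := fun t => by
    rw [Fout, Dhat, EuclideanSpace.real_norm_sq_eq, Finset.sum_div]
    simp
  simp only [h, dotProduct]
  refine HasDerivAt.fun_sum fun l _ => ?_
  have h1 : HasDerivAt (fun t : ℝ => u l + t * v l) (v l) 0 := by
    simpa using ((hasDerivAt_id (0 : ℝ)).mul_const (v l)).const_add (u l)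
  have h2 : HasDerivAt (fun t : ℝ => (u l + t * v l) ^ 2 / 2)
      ((2 : ℕ) * (u l + 0 * v l) ^ (2 - 1) * v l / 2) 0 := (h1.pow 2).div_const 2
  refine h2.congr_deriv ?_
  push_cast
  ring

theorem matGrad_dataLoss_disc (y yt : Fin n → ℝ) (W : Matrix (Fin n) (Fin d) ℝ) :
    matGrad (fun W' => dataLoss y yt W') W = (vecMulVec y y - vecMulVec yt yt) * W := by
  have key : ∀ (z : Fin n → ℝ) (i : Fin n) (j : Fin d), HasDerivAt
      (fun t : ℝ => Fout (discriminator z (W + t • Matrix.single i j (1 : ℝ))))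
      ((vecMulVec z z * W) i j) 0 := fun z i j => by
    have h := hasDerivAt_Fout_Dhat (z ᵥ* W) (z ᵥ* Matrix.single i j (1 : ℝ))
    have h1 : ∀ t : ℝ, z ᵥ* (W + t • Matrix.single i j (1 : ℝ)) =
        z ᵥ* W + t • (z ᵥ* Matrix.single i j (1 : ℝ)) := fun t => by
      rw [Matrix.vecMul_add, Matrix.vecMul_smul]
    simp only [discriminator, h1]
    convert h using 1
    rw [Matrix.vecMulVec_mul, vecMulVec_apply]
    simp [dotProduct, Matrix.vecMul, Matrix.single_apply, mul_comm, ite_and]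
  ext i j
  simp only [matGrad, Matrix.of_apply, dataLoss, Matrix.sub_mul, Matrix.sub_apply]
  exact ((key y i j).sub (key yt i j)).deriv

theorem matGrad_dataLoss_gen (y : Fin n → ℝ) (η : ℝ) (ct : Fin d → ℝ) (b : Fin n → ℝ)
    (V W : Matrix (Fin n) (Fin d) ℝ) :
    matGrad (fun V' => dataLoss y (spiked V' η ct b) W) V =
      -(W * (Wᵀ * vecMulVec (spiked V η ct b) ct)) := by
  ext i j
  have h := hasDerivAt_Fout_Dhat (spiked V η ct b ᵥ* W)
    ((Matrix.single i j (1 : ℝ) *ᵥ ct) ᵥ* W)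
  have h1 : ∀ t : ℝ, spiked (V + t • Matrix.single i j (1 : ℝ)) η ct b ᵥ* W =
      spiked V η ct b ᵥ* W + t • ((Matrix.single i j (1 : ℝ) *ᵥ ct) ᵥ* W) := fun t => by
    rw [← Matrix.smul_vecMul, ← Matrix.add_vecMul]
    congr 1
    rw [spiked, spiked, Matrix.add_mulVec, Matrix.smul_mulVec]
    abel
  simp only [matGrad, Matrix.of_apply, dataLoss, discriminator, h1]
  rw [(h.const_sub _).deriv, Matrix.neg_apply]
  congr 1
  rw [Matrix.mul_vecMulVec, Matrix.mul_vecMulVec, vecMulVec_apply, Matrix.mulVec_transpose]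
  simp [dotProduct, Matrix.mulVec, Matrix.vecMul, Matrix.single_apply, ite_and, Finset.sum_mul,
    Finset.mul_sum]
  refine Finset.sum_congr rfl fun l _ => Finset.sum_congr rfl fun k _ => ?_
  ring

/-- The training recursion is the update map applied to the state and the noise. -/
theorem train_succ (τ τt ηT ηG : ℝ)
    (πV πW : Matrix (Fin n) (Fin d) ℝ → Matrix (Fin n) (Fin d) ℝ)
    (U V0 W0 : Matrix (Fin n) (Fin d) ℝ) (c ct : ℕ → Fin d → ℝ) (a b : ℕ → Fin n → ℝ) (k : ℕ) :
    (U, train τ τt ηT ηG πV πW U V0 W0 c ct a b (k + 1)) =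
      step τ τt ηT ηG πV πW ((U, train τ τt ηT ηG πV πW U V0 W0 c ct a b k),
        (c k, ct k, a k, b k)) := by
  simp only [train, step, matGrad_dataLoss_gen, matGrad_dataLoss_disc]
  refine Prod.ext rfl (Prod.ext ?_ ?_)
  · simp only [genMove, genSample, genRaw]
    congr 1
    rw [Matrix.mul_smul, smul_neg, sub_neg_eq_add, smul_smul]
    congr 2
    ring
  · simp only [discMove, trueSample, genSample, discRaw]
    congr 1
    rw [smul_smul]
    congr 2
    ring

end Gradient

/-! ### Ordinary differential equations and their Euler scheme -/

section ODE

variable {E : Type*} [NormedAddCommGroup E] [NormedSpace ℝ E]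

/-- `x` solves `ẋ = f(x)` on `[0, ∞)`, with a one-sided derivative at `0`. -/
def IsFlowLine (f : E → E) (x : ℝ → E) : Prop :=
  ∀ t : ℝ, 0 ≤ t → HasDerivWithinAt x (f (x t)) (Set.Ici 0) t

theorem IsFlowLine.continuousOn {f : E → E} {x : ℝ → E} (hx : IsFlowLine f x) :
    ContinuousOn x (Set.Ici 0) := fun t ht => (hx t ht).continuousWithinAt

/-- A continuously differentiable field agrees on any ball with a bounded and globally Lipschitz
one, by means of a bump function. -/
theorem exists_lipschitz_eqOn_closedBall [FiniteDimensional ℝ E] {f : E → E}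
    (hf : ContDiff ℝ 1 f) {R : ℝ} (hR : 0 < R) :
    ∃ (g : E → E) (K : NNReal) (B : ℝ), LipschitzWith K g ∧ (∀ x, ‖g x‖ ≤ B) ∧
      ∀ x ∈ Metric.closedBall (0 : E) R, g x = f x := by
  let φ : ContDiffBump (0 : E) := ⟨R, R + 1, hR, by linarith⟩
  have hg : ContDiff ℝ 1 fun x => φ x • f x := φ.contDiff.smul hf
  have hs : HasCompactSupport fun x => φ x • f x := φ.hasCompactSupport.smul_right
  obtain ⟨K, hK⟩ := hg.lipschitzWith_of_hasCompactSupport hs (by simp)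
  obtain ⟨B, hB⟩ := hs.exists_bound_of_continuous hg.continuous
  exact ⟨_, K, B, hK, hB, fun x hx => by simp [φ.one_of_mem_closedBall hx]⟩

theorem IsFlowLine.eq_of_lipschitzWith {g : E → E} {K : NNReal} (hg : LipschitzWith K g)
    {T : ℝ} {x y : ℝ → E}
    (hx : ∀ t ∈ Set.Icc 0 T, HasDerivWithinAt x (g (x t)) (Set.Icc 0 T) t)
    (hy : ∀ t ∈ Set.Icc 0 T, HasDerivWithinAt y (g (y t)) (Set.Icc 0 T) t)
    (h0 : x 0 = y 0) : Set.EqOn x y (Set.Icc 0 T) :=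
  ODE_solution_unique_of_mem_Icc_right (v := fun _ => g) (s := fun _ => Set.univ)
    (fun _ _ => hg.lipschitzOnWith) (fun t ht => (hx t ht).continuousWithinAt)
    (fun t ht => (hx t (Set.Ico_subset_Icc_self ht)).mono_of_mem_nhdsWithin
      (Icc_mem_nhdsGE_of_mem ht)) (fun _ _ => Set.mem_univ _)
    (fun t ht => (hy t ht).continuousWithinAt)
    (fun t ht => (hy t (Set.Ico_subset_Icc_self ht)).mono_of_mem_nhdsWithin
      (Icc_mem_nhdsGE_of_mem ht)) (fun _ _ => Set.mem_univ _) h0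

/-- A bounded and globally Lipschitz field has a solution on `[0, ∞)` from each point. -/
theorem exists_isFlowLine_of_lipschitzWith [CompleteSpace E] {g : E → E} {K : NNReal}
    (hg : LipschitzWith K g) {B : ℝ} (hB : ∀ x, ‖g x‖ ≤ B) (x₀ : E) :
    ∃ x : ℝ → E, x 0 = x₀ ∧ IsFlowLine g x := by
  have hB0 : 0 ≤ B := (norm_nonneg _).trans (hB x₀)
  have hloc : ∀ N : ℕ, ∃ x : ℝ → E, x 0 = x₀ ∧
      ∀ t ∈ Set.Icc (0 : ℝ) N, HasDerivWithinAt x (g (x t)) (Set.Icc 0 N) t := fun N => by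
    have hN : (0 : ℝ) ≤ N := Nat.cast_nonneg N
    have hpl : IsPicardLindelof (fun _ => g) (tmin := 0) (tmax := N) ⟨0, le_rfl, hN⟩ x₀
        (B.toNNReal * N) 0 B.toNNReal K :=
      { lipschitzOnWith := fun _ _ => hg.lipschitzOnWith
        continuousOn := fun _ _ => continuousOn_const
        norm_le := fun _ _ x _ => by rw [Real.coe_toNNReal _ hB0]; exact hB x
        mul_max_le := by simp [hN] }
    exact hpl.exists_eq_forall_mem_Icc_hasDerivWithinAt₀
  choose α hα0 hα using hloc
  have heq : ∀ M N : ℕ, M ≤ N → Set.EqOn (α M) (α N) (Set.Icc 0 M) := fun M N hMN =>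
    IsFlowLine.eq_of_lipschitzWith hg (hα M)
      (fun t ht => (hα N t ⟨ht.1, ht.2.trans (by exact_mod_cast hMN)⟩).mono
        (Set.Icc_subset_Icc_right (by exact_mod_cast hMN))) (by rw [hα0, hα0])
  -- the local solutions are glued along the integer parts
  refine ⟨fun t => α (⌊t⌋₊ + 1) t, by simp [hα0], fun t ht => ?_⟩
  have ht1 : t < (⌊t⌋₊ + 1 : ℕ) := by push_cast; exact Nat.lt_floor_add_one t
  have hev : (fun s => α (⌊s⌋₊ + 1) s) =ᶠ[nhdsWithin t (Set.Ici 0)] α (⌊t⌋₊ + 1) := by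
    filter_upwards [self_mem_nhdsWithin, nhdsWithin_le_nhds (Iio_mem_nhds ht1)] with s hs0 hs
    have hs1 : s < (⌊s⌋₊ + 1 : ℕ) := by push_cast; exact Nat.lt_floor_add_one s
    rcases le_total (⌊s⌋₊ + 1) (⌊t⌋₊ + 1) with h | h
    · exact heq _ _ h ⟨hs0, hs1.le⟩
    · exact (heq _ _ h ⟨hs0, le_of_lt hs⟩).symm
  have hmem : Set.Icc (0 : ℝ) (⌊t⌋₊ + 1 : ℕ) ∈ nhdsWithin t (Set.Ici 0) := by
    rw [← Set.Ici_inter_Iic]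
    exact Filter.inter_mem self_mem_nhdsWithin (nhdsWithin_le_nhds (Iic_mem_nhds ht1))
  exact ((hα _ t ⟨ht, ht1.le⟩).mono_of_mem_nhdsWithin hmem).congr_of_eventuallyEq hev rfl

/-- Uniqueness for a continuously differentiable field: on a compact time interval the solutions
stay in a ball, where the field is Lipschitz. -/
theorem IsFlowLine.eq_of_contDiff [FiniteDimensional ℝ E] {f : E → E} (hf : ContDiff ℝ 1 f)
    {x y : ℝ → E} (hx : IsFlowLine f x) (hy : IsFlowLine f y) (h0 : x 0 = y 0) {T : ℝ}
    (hT : 0 ≤ T) : x T = y T := by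
  have hsub : Set.Icc 0 T ⊆ Set.Ici 0 := Set.Icc_subset_Ici_self
  obtain ⟨R, hR⟩ := isCompact_Icc.exists_bound_of_continuousOn (hx.continuousOn.mono hsub)
  obtain ⟨R', hR'⟩ := isCompact_Icc.exists_bound_of_continuousOn (hy.continuousOn.mono hsub)
  obtain ⟨g, K, -, hg, -, hgf⟩ := exists_lipschitz_eqOn_closedBall hf
    (R := max 1 (max R R')) (by positivity)
  have hmem : ∀ z : E, ‖z‖ ≤ max R R' → g z = f z := fun z hz =>
    hgf z (by simpa using Or.inr (by simpa using hz))
  refine IsFlowLine.eq_of_lipschitzWith hg (fun t ht => ?_) (fun t ht => ?_) h0 ⟨hT, le_rfl⟩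
  · rw [hmem _ ((hR t ht).trans (le_max_left _ _))]
    exact (hx t ht.1).mono hsub
  · rw [hmem _ ((hR' t ht).trans (le_max_right _ _))]
    exact (hy t ht.1).mono hsub

/-- The local error of the Euler scheme. -/
theorem IsFlowLine.norm_sub_euler_le {g : E → E} {K : NNReal} (hg : LipschitzWith K g) {B : ℝ}
    (hB : ∀ x, ‖g x‖ ≤ B) {x : ℝ → E} (hx : IsFlowLine g x) {t h : ℝ} (ht : 0 ≤ t) (hh : 0 ≤ h) :
    ‖x (t + h) - x t - h • g (x t)‖ ≤ K * B * h ^ 2 := by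
  have hder : ∀ s ∈ Set.Icc t (t + h),
      HasDerivWithinAt x (g (x s)) (Set.Icc t (t + h)) s := fun s hs =>
    (hx s (ht.trans hs.1)).mono fun r hr => ht.trans hr.1
  have h1 : ∀ s ∈ Set.Icc t (t + h), ‖x s - x t‖ ≤ B * (s - t) :=
    norm_image_sub_le_of_norm_deriv_le_segment' hder fun s _ => hB _
  have hB0 : 0 ≤ B := (norm_nonneg _).trans (hB (x t))
  have h2 := norm_image_sub_le_of_norm_deriv_le_segment'
    (f := fun s => x s - (s - t) • g (x t)) (f' := fun s => g (x s) - g (x t)) (a := t)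
    (b := t + h) (C := K * (B * h))
    (fun s hs => by
      have := (((hasDerivAt_id s).sub_const t).smul_const (g (x t))).hasDerivWithinAt
        (s := Set.Icc t (t + h))
      rw [one_smul] at this
      exact (hder s hs).sub this)
    (fun s hs => by
      have h3 := hg.dist_le_mul (x s) (x t)
      rw [dist_eq_norm, dist_eq_norm] at h3
      refine h3.trans (mul_le_mul_of_nonneg_left ?_ K.2)
      exact (h1 s ⟨hs.1, hs.2.le⟩).trans (mul_le_mul_of_nonneg_left (by linarith [hs.2]) hB0))
    (t + h) ⟨by linarith, le_rfl⟩
  have h4 : x (t + h) - x t - h • g (x t) =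
      x (t + h) - (t + h - t) • g (x t) - (x t - (t - t) • g (x t)) := by
    simp only [add_sub_cancel_left, sub_self, zero_smul, sub_zero]
    abel
  rw [h4]
  exact h2.trans_eq (by ring)

/-- The accumulated error of the Euler scheme with step size `h`. -/
theorem IsFlowLine.norm_sub_euler_sum_le {g : E → E} {K : NNReal} (hg : LipschitzWith K g) {B : ℝ}
    (hB : ∀ x, ‖g x‖ ≤ B) {x : ℝ → E} (hx : IsFlowLine g x) {h : ℝ} (hh : 0 ≤ h) (k : ℕ) :
    ‖x (k * h) - x 0 - h • ∑ j ∈ Finset.range k, g (x (j * h))‖ ≤ k * (K * B * h ^ 2) := by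
  induction k with
  | zero => simp
  | succ k ih =>
    have h1 := hx.norm_sub_euler_le hg hB (t := k * h) (by positivity) hh
    have h2 : x ((k + 1 : ℕ) * h) - x 0 - h • ∑ j ∈ Finset.range (k + 1), g (x (j * h)) =
        (x (k * h) - x 0 - h • ∑ j ∈ Finset.range k, g (x (j * h))) +
          (x (k * h + h) - x (k * h) - h • g (x (k * h))) := by
      rw [Finset.sum_range_succ, smul_add]
      push_cast
      rw [add_one_mul]
      abel
    rw [h2]
    refine (norm_add_le _ _).trans ?_
    push_cast
    linarith

theorem discrete_gronwall_sum {u : ℕ → ℝ} {a c : ℝ} (hc : 0 ≤ c) {N : ℕ}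
    (h : ∀ k ≤ N, u k ≤ a + c * ∑ j ∈ Finset.range k, u j) (ha : 0 ≤ a) :
    ∀ k ≤ N, u k ≤ a * Real.exp (c * k) := by
  have key : ∀ k ≤ N, a + c * ∑ j ∈ Finset.range k, u j ≤ a * Real.exp (c * k) := by
    intro k
    induction k with
    | zero => simp
    | succ k ih =>
      intro hk
      have h1 := ih (by omega)
      have h2 := (h k (by omega)).trans h1
      have h3 : 1 + c ≤ Real.exp c := by linarith [Real.add_one_le_exp c]
      have h4 : Real.exp (c * (k + 1 : ℕ)) = Real.exp (c * k) * Real.exp c := by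
        rw [← Real.exp_add]; push_cast; ring_nf
      rw [Finset.sum_range_succ, h4]
      have h5 : 0 ≤ a * Real.exp (c * k) := by positivity
      nlinarith [mul_le_mul_of_nonneg_left h3 h5, mul_le_mul_of_nonneg_left h2 hc]
  exact fun k hk => (h k hk).trans (key k hk)

end ODE

/-! ### The overlaps follow the averaged equation -/

section Averaging

/-- A run of the algorithm in dimension `n`: a recursion `Z_{k+1} = step(Z_k, ξ_k)` started from a
good state and driven by independent noise of law `noiseLaw`. -/
structure IsRun {n d : ℕ} {Ω : Type*} [MeasurableSpace Ω] (μ : Measure Ω)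
    (τ τt ηT ηG : ℝ) (ν νt : Measure (Fin d → ℝ))
    (πV πW : Matrix (Fin n) (Fin d) ℝ → Matrix (Fin n) (Fin d) ℝ)
    (Z : ℕ → Ω → State n d) (ξ : ℕ → Ω → Noise d n) : Prop where
  projV : IsProjection (genSet n d) πV
  projW : IsProjection (discSet n d) πW
  measurable_zero : Measurable (Z 0)
  measurable_noise : ∀ k, Measurable (ξ k)
  law : ∀ k, μ.map (ξ k) = noiseLaw ν νt n
  indep : iIndepFun ξ μ
  indep_zero : IndepFun (Z 0) (fun ω k => ξ k ω) μ
  succ : ∀ k ω, Z (k + 1) ω = step τ τt ηT ηG πV πW (Z k ω, ξ k ω)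
  good_zero : ∀ᵐ ω ∂μ, Z 0 ω ∈ goodSet n d

variable {n d : ℕ} {Ω : Type*} [MeasurableSpace Ω] {μ : Measure Ω}
  {τ τt ηT ηG : ℝ} {ν νt : Measure (Fin d → ℝ)} {Λ Λt : Matrix (Fin d) (Fin d) ℝ}
  {πV πW : Matrix (Fin n) (Fin d) ℝ → Matrix (Fin n) (Fin d) ℝ}
  {Z : ℕ → Ω → State n d} {ξ : ℕ → Ω → Noise d n}

theorem IsRun.measurable_and_indep [IsProbabilityMeasure μ]
    (h : IsRun μ τ τt ηT ηG ν νt πV πW Z ξ) (k : ℕ) :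
    Measurable (Z k) ∧ IndepFun (Z k) (ξ k) μ :=
  measurable_and_indepFun_of_recursion (measurable_step τ τt ηT ηG h.projV.1 h.projW.1)
    h.measurable_zero h.measurable_noise h.indep h.indep_zero h.succ k

theorem IsRun.good (h : IsRun μ τ τt ηT ηG ν νt πV πW Z ξ) (k : ℕ) :
    ∀ᵐ ω ∂μ, Z k ω ∈ goodSet n d := by
  filter_upwards [h.good_zero] with ω hω
  induction k with
  | zero => exact hω
  | succ k ih => rw [h.succ]; exact step_mem_goodSet h.projV h.projW ih _

/-- The deviation of an overlap from its averaged evolution. -/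
noncomputable def driftError (τ τt ηT ηG : ℝ) (Λ Λt : Matrix (Fin d) (Fin d) ℝ)
    (Z : ℕ → Ω → State n d) (k : ℕ) (m : Fin 4) (i j : Fin d) (ω : Ω) : ℝ :=
  stateOverlap (Z k ω) m i j - stateOverlap (Z 0 ω) m i j
    - 1 / n * ∑ l ∈ Finset.range k, drift τ τt ηT ηG Λ Λt (stateOverlap (Z l ω)) m i j

theorem IsRun.driftError_eq (h : IsRun μ τ τt ηT ηG ν νt πV πW Z ξ) (k : ℕ) (m : Fin 4)
    (i j : Fin d) (ω : Ω) :
    driftError τ τt ηT ηG Λ Λt Z k m i j ω =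
      ∑ l ∈ Finset.range k, centredStep τ τt ηT ηG Λ Λt m i j (Z l ω, ξ l ω) +
        ∑ l ∈ Finset.range k, stepError τ τt ηT ηG πV πW m i j (Z l ω, ξ l ω) := by
  rw [driftError, ← Finset.sum_range_sub (fun l => stateOverlap (Z l ω) m i j), Finset.mul_sum,
    ← Finset.sum_sub_distrib, ← Finset.sum_add_distrib]
  refine Finset.sum_congr rfl fun l _ => ?_
  rw [h.succ, centredStep, stepError]
  ring

/-- The fluctuations of the overlaps form a martingale, which is of order `n^(-1/2)` over `n T`
steps, and so are the accumulated errors of the single steps. -/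
theorem exists_integral_driftError_le (hν : IsCentredLaw ν Λ) (hνt : IsCentredLaw νt Λt)
    (hτ : 0 ≤ τ) (hτt : 0 ≤ τt) (hηT : 0 ≤ ηT) (hηG : 0 ≤ ηG) :
    ∃ B : ℝ, 0 ≤ B ∧ ∀ n : ℕ, 0 < n → ∀ {Ω : Type*} [MeasurableSpace Ω] (μ : Measure Ω)
      [IsProbabilityMeasure μ] (πV πW : Matrix (Fin n) (Fin d) ℝ → Matrix (Fin n) (Fin d) ℝ)
      (Z : ℕ → Ω → State n d) (ξ : ℕ → Ω → Noise d n),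
      IsRun μ τ τt ηT ηG ν νt πV πW Z ξ → ∀ (k : ℕ) (m : Fin 4) (i j : Fin d),
      Integrable (driftError τ τt ηT ηG Λ Λt Z k m i j) μ ∧
        ∫ ω, |driftError τ τt ηT ηG Λ Λt Z k m i j ω| ∂μ ≤
          Real.sqrt (k * (B / n ^ 2)) + k * (B / (n * Real.sqrt n)) := by
  obtain ⟨B₁, hB₁0, hB₁⟩ := exists_lintegral_centredStep_sq_le (τ := τ) (τt := τt) hν hνt hτ hτt
    hηT hηG
  obtain ⟨B₂, hB₂0, hB₂⟩ := exists_lintegral_stepError_le (τ := τ) (τt := τt) hν hνt hτ hτt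
    hηT hηG
  refine ⟨B₁ + B₂, by positivity, ?_⟩
  intro n hn Ω _ μ _ πV πW Z ξ h k m i j
  obtain ⟨hmart, hmart2⟩ := integral_sq_martingale_le
    (measurable_step τ τt ηT ηG h.projV.1 h.projW.1) h.measurable_zero h.measurable_noise h.indep
    h.indep_zero h.succ h.law measurableSet_goodSet h.good
    (measurable_centredStep (τ := τ) (τt := τt) (ηT := ηT) (ηG := ηG) (Λ := Λ) (Λt := Λt) m i j)
    (B := B₁ / n ^ 2) (by positivity)
    (fun s hs => integral_centredStep hν hνt hηT hηG hs m i j)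
    (fun s hs => hB₁ n hn s hs m i j) k
  have hmart1 := integral_abs_le_sqrt hmart hmart2
  have hmarti := hmart.integrable one_le_two
  have hmeasE := measurable_stepError (τ := τ) (τt := τt) (ηT := ηT) (ηG := ηG) h.projV.1
    h.projW.1 m i j
  have herr : ∀ l, Integrable
      (fun ω => stepError τ τt ηT ηG πV πW m i j (Z l ω, ξ l ω)) μ ∧
      ∫ ω, |stepError τ τt ηT ηG πV πW m i j (Z l ω, ξ l ω)| ∂μ ≤ B₂ / (n * Real.sqrt n) := by
    intro l
    obtain ⟨hZ, hind⟩ := h.measurable_and_indep l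
    have hm : Measurable fun ω => stepError τ τt ηT ηG πV πW m i j (Z l ω, ξ l ω) :=
      hmeasE.comp (hZ.prodMk (h.measurable_noise l))
    have hle := lintegral_le_of_indepFun hZ (h.measurable_noise l) hind measurableSet_goodSet
      (h.good l) (f := fun p => ENNReal.ofReal |stepError τ τt ηT ηG πV πW m i j p|)
      (by fun_prop) (by rw [h.law]; exact fun s hs => hB₂ n hn s hs m i j πV πW h.projV h.projW)
    have hi : Integrable
        (fun ω => |stepError τ τt ηT ηG πV πW m i j (Z l ω, ξ l ω)|) μ :=
      (lintegral_ofReal_ne_top_iff_integrable hm.abs.aestronglyMeasurable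
        (ae_of_all _ fun _ => abs_nonneg _)).1 (hle.trans_lt ENNReal.ofReal_lt_top).ne
    refine ⟨(integrable_norm_iff hm.aestronglyMeasurable).1 hi, ?_⟩
    rw [integral_eq_lintegral_of_nonneg_ae (ae_of_all _ fun _ => abs_nonneg _)
      hm.abs.aestronglyMeasurable]
    exact ENNReal.toReal_le_of_le_ofReal (by positivity) hle
  have hfun : driftError τ τt ηT ηG Λ Λt Z k m i j = fun ω =>
      ∑ l ∈ Finset.range k, centredStep τ τt ηT ηG Λ Λt m i j (Z l ω, ξ l ω) +
        ∑ l ∈ Finset.range k, stepError τ τt ηT ηG πV πW m i j (Z l ω, ξ l ω) :=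
    funext fun ω => h.driftError_eq k m i j ω
  have hsum : Integrable (fun ω => ∑ l ∈ Finset.range k,
      |stepError τ τt ηT ηG πV πW m i j (Z l ω, ξ l ω)|) μ :=
    integrable_finsetSum _ fun l _ => (herr l).1.abs
  have hint : Integrable (driftError τ τt ηT ηG Λ Λt Z k m i j) μ := by
    rw [hfun]
    exact hmarti.add (integrable_finsetSum _ fun l _ => (herr l).1)
  refine ⟨hint, ?_⟩
  calc ∫ ω, |driftError τ τt ηT ηG Λ Λt Z k m i j ω| ∂μ
      ≤ ∫ ω, (|∑ l ∈ Finset.range k, centredStep τ τt ηT ηG Λ Λt m i j (Z l ω, ξ l ω)| +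
        ∑ l ∈ Finset.range k, |stepError τ τt ηT ηG πV πW m i j (Z l ω, ξ l ω)|) ∂μ := by
        refine integral_mono hint.abs (hmarti.abs.add hsum) fun ω => ?_
        simp only [hfun]
        exact (abs_add_le _ _).trans (by gcongr; exact Finset.abs_sum_le_sum_abs _ _)
    _ ≤ Real.sqrt (k * (B₁ / n ^ 2)) + k * (B₂ / (n * Real.sqrt n)) := by
        rw [integral_add hmarti.abs hsum, integral_finsetSum _ fun l _ => (herr l).1.abs]
        refine add_le_add hmart1 ((Finset.sum_le_sum fun l _ => (herr l).2).trans_eq ?_)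
        simp
    _ ≤ _ := by gcongr <;> linarith

/-- The macroscopic state `(P, Q, R, S)`, with the supremum norm of its entries. -/
abbrev Macro (d : ℕ) : Type := Fin 4 → Fin d → Fin d → ℝ

/-- The drift as a vector field on the space of macroscopic states. -/
noncomputable def driftField (τ τt ηT ηG : ℝ) (Λ Λt : Matrix (Fin d) (Fin d) ℝ) (x : Macro d) :
    Macro d :=
  fun m i j => drift τ τt ηT ηG Λ Λt (fun m => Matrix.of (x m)) m i j

/-- The macroscopic state that belongs to a microscopic state. -/
def macroState (s : State n d) : Macro d := fun m i j => stateOverlap s m i j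

theorem contDiff_driftField (τ τt ηT ηG : ℝ) (Λ Λt : Matrix (Fin d) (Fin d) ℝ) :
    ContDiff ℝ 1 (driftField τ τt ηT ηG Λ Λt) := by
  refine contDiff_pi.2 fun m => contDiff_pi.2 fun i => contDiff_pi.2 fun j => ?_
  have hx : ∀ m i j, ContDiff ℝ 1 fun x : Macro d => x m i j := fun m i j => by fun_prop
  fin_cases m <;>
    simp only [driftField, drift, Lmat, Hmat, Matrix.mul_neg, Matrix.neg_mul, Matrix.add_mul,
      Matrix.mul_sub, Matrix.mul_smul, Matrix.mul_one, Matrix.add_apply, Matrix.sub_apply,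
      Matrix.smul_apply, Matrix.neg_apply, Matrix.mul_diagonal, Matrix.diagonal_mul] <;>
    simp only [Matrix.mul_apply, Matrix.transpose_apply, Matrix.of_apply, smul_eq_mul,
      Matrix.diag_apply] <;>
    fun_prop

theorem norm_macro_le_sum (x : Macro d) : ‖x‖ ≤ ∑ m, ∑ i, ∑ j, |x m i j| := by
  have h : ∀ {ι F : Type} [Fintype ι] [NormedAddCommGroup F] (y : ι → F), ‖y‖ ≤ ∑ i, ‖y i‖ :=
    fun y => (pi_norm_le_iff_of_nonneg (Finset.sum_nonneg fun _ _ => norm_nonneg _)).2 fun i =>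
      Finset.single_le_sum (f := fun i => ‖y i‖) (fun _ _ => norm_nonneg _) (Finset.mem_univ i)
  exact (h x).trans (Finset.sum_le_sum fun m _ =>
    (h (x m)).trans (Finset.sum_le_sum fun i _ => h (x m i)))

theorem norm_macroState_le_one {s : State n d} (hs : s ∈ goodSet n d) : ‖macroState s‖ ≤ 1 :=
  (pi_norm_le_iff_of_nonneg zero_le_one).2 fun m => (pi_norm_le_iff_of_nonneg zero_le_one).2
    fun i => (pi_norm_le_iff_of_nonneg zero_le_one).2 fun j => abs_stateOverlap_le_one hs m i j

theorem measurable_macroState : Measurable (macroState : State n d → Macro d) :=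
  measurable_pi_lambda _ fun m => measurable_pi_lambda _ fun i => measurable_pi_lambda _ fun j =>
    ((continuous_stateOverlap m).matrix_elem i j).measurable

end Averaging

section Comparison

variable {n d : ℕ} {τ τt ηT ηG : ℝ} {ν νt : Measure (Fin d → ℝ)}
  {Λ Λt : Matrix (Fin d) (Fin d) ℝ}

/-- On each path the distance between the macroscopic state and the solution of the averaged
equation is controlled by its past, the error of the averaging and the error of the Euler
scheme. -/
theorem norm_macroState_sub_le {Ω : Type*} {Z : ℕ → Ω → State n d} {g : Macro d → Macro d}
    {K : NNReal} {B : ℝ}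
    (hgK : LipschitzWith K g) (hgB : ∀ x, ‖g x‖ ≤ B)
    (hg : ∀ x ∈ Metric.closedBall 0 1, g x = driftField τ τt ηT ηG Λ Λt x)
    {x : ℝ → Macro d} (hx : IsFlowLine g x) {ω : Ω} (hω : ∀ k, Z k ω ∈ goodSet n d) (k : ℕ) :
    ‖macroState (Z k ω) - x (k / n)‖ ≤ ‖macroState (Z 0 ω) - x 0‖
      + ∑ m, ∑ i, ∑ j, |driftError τ τt ηT ηG Λ Λt Z k m i j ω|
      + 1 / n * ∑ l ∈ Finset.range k, K * ‖macroState (Z l ω) - x (l / n)‖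
      + k * (K * B * (1 / n) ^ 2) := by
  have h1 := hx.norm_sub_euler_sum_le hgK hgB (h := 1 / n) (by positivity) k
  simp only [mul_one_div] at h1
  set e : Macro d := fun m i j => driftError τ τt ηT ηG Λ Λt Z k m i j ω with he
  have h2 : ‖e‖ ≤ ∑ m, ∑ i, ∑ j, |driftError τ τt ηT ηG Λ Λt Z k m i j ω| := norm_macro_le_sum e
  have hgd : ∀ l, g (macroState (Z l ω)) = driftField τ τt ηT ηG Λ Λt (macroState (Z l ω)) :=
    fun l => hg _ (by simpa using norm_macroState_le_one (hω l))
  have he2 : e = macroState (Z k ω) - macroState (Z 0 ω)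
      - (1 / n : ℝ) • ∑ l ∈ Finset.range k, g (macroState (Z l ω)) := by
    funext m i j
    simp only [he, driftError, hgd, Pi.sub_apply, Pi.smul_apply, Finset.sum_apply, smul_eq_mul]
    rfl
  have h3 : ‖(1 / n : ℝ) • ∑ l ∈ Finset.range k,
      (g (macroState (Z l ω)) - g (x (l / n)))‖ ≤
      1 / n * ∑ l ∈ Finset.range k, K * ‖macroState (Z l ω) - x (l / n)‖ := by
    rw [norm_smul, Real.norm_of_nonneg (by positivity)]
    refine mul_le_mul_of_nonneg_left (norm_sum_le_of_le _ fun l _ => ?_) (by positivity)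
    simpa [dist_eq_norm] using hgK.dist_le_mul (macroState (Z l ω)) (x (l / n))
  have h4 : macroState (Z k ω) - x (k / n) = (macroState (Z 0 ω) - x 0) + e
      + (1 / n : ℝ) • ∑ l ∈ Finset.range k, (g (macroState (Z l ω)) - g (x (l / n)))
      - (x (k / n) - x 0 - (1 / n : ℝ) • ∑ l ∈ Finset.range k, g (x (l / n))) := by
    rw [he2, Finset.sum_sub_distrib, smul_sub]
    abel
  rw [h4]
  refine (norm_sub_le _ _).trans (add_le_add ?_ h1)
  exact norm_add₃_le.trans (by gcongr)

section Run

variable {Ω : Type*} [MeasurableSpace Ω] {μ : Measure Ω} [IsProbabilityMeasure μ]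
  {πV πW : Matrix (Fin n) (Fin d) ℝ → Matrix (Fin n) (Fin d) ℝ}
  {Z : ℕ → Ω → State n d} {ξ : ℕ → Ω → Noise d n}

theorem IsRun.integrable_norm_sub (h : IsRun μ τ τt ηT ηG ν νt πV πW Z ξ) (k : ℕ) (y : Macro d) :
    Integrable (fun ω => ‖macroState (Z k ω) - y‖) μ := by
  have hm : Measurable fun ω => ‖macroState (Z k ω) - y‖ :=
    ((measurable_macroState.comp (h.measurable_and_indep k).1).sub_const y).norm
  refine Integrable.of_bound hm.aestronglyMeasurable (1 + ‖y‖) ?_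
  filter_upwards [h.good k] with ω hω
  rw [norm_norm]
  exact (norm_sub_le _ _).trans (add_le_add_left (norm_macroState_le_one hω) _)

end Run

/-- The macroscopic state converges at rate `n^(-1/2)` to the solution of the averaged equation.
The field `g` is only required to agree with the drift on the unit ball, where the macroscopic
states live. -/
theorem exists_integral_macroState_sub_le (hν : IsCentredLaw ν Λ) (hνt : IsCentredLaw νt Λt)
    (hτ : 0 ≤ τ) (hτt : 0 ≤ τt) (hηT : 0 ≤ ηT) (hηG : 0 ≤ ηG)
    {g : Macro d → Macro d} {K : NNReal} {B : ℝ}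
    (hgK : LipschitzWith K g) (hgB : ∀ x, ‖g x‖ ≤ B)
    (hg : ∀ x ∈ Metric.closedBall 0 1, g x = driftField τ τt ηT ηG Λ Λt x)
    {x : ℝ → Macro d} (hx : IsFlowLine g x) {C₀ T : ℝ} (hC₀ : 0 ≤ C₀) (hT : 0 ≤ T) :
    ∃ C : ℝ, 0 ≤ C ∧ ∀ n : ℕ, 0 < n → ∀ {Ω : Type*} [MeasurableSpace Ω] (μ : Measure Ω)
      [IsProbabilityMeasure μ] (πV πW : Matrix (Fin n) (Fin d) ℝ → Matrix (Fin n) (Fin d) ℝ)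
      (Z : ℕ → Ω → State n d) (ξ : ℕ → Ω → Noise d n),
      IsRun μ τ τt ηT ηG ν νt πV πW Z ξ →
      ∫ ω, ‖macroState (Z 0 ω) - x 0‖ ∂μ ≤ C₀ / Real.sqrt n →
      ∀ k : ℕ, (k : ℝ) ≤ n * T →
        ∫ ω, ‖macroState (Z k ω) - x (k / n)‖ ∂μ ≤ C / Real.sqrt n := by
  obtain ⟨A, hA0, hA⟩ := exists_integral_driftError_le (τ := τ) (τt := τt) hν hνt hτ hτt hηT hηG
  have hB0 : 0 ≤ B := (norm_nonneg _).trans (hgB 0)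
  set c : ℝ := C₀ + 4 * (d * (d * (Real.sqrt (T * A) + T * A))) + T * (K * B) with hc
  have hc0 : 0 ≤ c := by positivity
  refine ⟨c * Real.exp (K * T), by positivity, ?_⟩
  intro n hn Ω _ μ _ πV πW Z ξ h h0 k hk
  have hn0 : (0 : ℝ) < n := by exact_mod_cast hn
  have hr0 : 0 < Real.sqrt n := Real.sqrt_pos.2 hn0
  have hr2 : Real.sqrt n * Real.sqrt n = n := Real.mul_self_sqrt hn0.le
  have hr1 : Real.sqrt n ≤ n := by
    have : 1 ≤ Real.sqrt n := Real.one_le_sqrt.2 (by exact_mod_cast hn)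
    nlinarith
  have hgood : ∀ᵐ ω ∂μ, ∀ k, Z k ω ∈ goodSet n d := ae_all_iff.2 h.good
  -- the averaging error of a single coordinate
  have hcoord : ∀ l ≤ k, ∀ m i j, ∫ ω, |driftError τ τt ηT ηG Λ Λt Z l m i j ω| ∂μ ≤
      (Real.sqrt (T * A) + T * A) / Real.sqrt n := fun l hl m i j => by
    have hl' : (l : ℝ) ≤ n * T := le_trans (by exact_mod_cast hl) hk
    refine (hA n hn μ πV πW Z ξ h l m i j).2.trans ?_
    rw [add_div]
    refine add_le_add ?_ ?_
    · rw [← Real.sqrt_div (by positivity)]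
      refine Real.sqrt_le_sqrt ?_
      calc (l : ℝ) * (A / n ^ 2) ≤ n * T * (A / n ^ 2) := by gcongr
        _ = T * A / n := by field_simp
    · calc (l : ℝ) * (A / (n * Real.sqrt n)) ≤ n * T * (A / (n * Real.sqrt n)) := by gcongr
        _ = T * A / Real.sqrt n := by field_simp
  have hrec : ∀ l ≤ k, ∫ ω, ‖macroState (Z l ω) - x (l / n)‖ ∂μ ≤ c / Real.sqrt n +
      K / n * ∑ p ∈ Finset.range l, ∫ ω, ‖macroState (Z p ω) - x (p / n)‖ ∂μ := fun l hl => by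
    have hl' : (l : ℝ) ≤ n * T := le_trans (by exact_mod_cast hl) hk
    have i0 := h.integrable_norm_sub 0 (x 0)
    have i1 : ∀ m i j, Integrable (fun ω => |driftError τ τt ηT ηG Λ Λt Z l m i j ω|) μ :=
      fun m i j => (hA n hn μ πV πW Z ξ h l m i j).1.abs
    have i1' : Integrable (fun ω => ∑ m, ∑ i, ∑ j,
        |driftError τ τt ηT ηG Λ Λt Z l m i j ω|) μ :=
      integrable_finsetSum _ fun m _ => integrable_finsetSum _ fun i _ =>
        integrable_finsetSum _ fun j _ => i1 m i j
    have i2 : ∀ p, Integrable (fun ω => K * ‖macroState (Z p ω) - x (p / n)‖) μ :=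
      fun p => (h.integrable_norm_sub p _).const_mul _
    have i2' : Integrable (fun ω => 1 / n * ∑ p ∈ Finset.range l,
        K * ‖macroState (Z p ω) - x (p / n)‖) μ :=
      (integrable_finsetSum _ fun p _ => i2 p).const_mul _
    have i01 : Integrable (fun ω => ‖macroState (Z 0 ω) - x 0‖ + ∑ m, ∑ i, ∑ j,
        |driftError τ τt ηT ηG Λ Λt Z l m i j ω|) μ := i0.add i1'
    have i012 : Integrable (fun ω => ‖macroState (Z 0 ω) - x 0‖ + ∑ m, ∑ i, ∑ j,
        |driftError τ τt ηT ηG Λ Λt Z l m i j ω| + 1 / n * ∑ p ∈ Finset.range l,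
        K * ‖macroState (Z p ω) - x (p / n)‖) μ := i01.add i2'
    have hmono : ∫ ω, ‖macroState (Z l ω) - x (l / n)‖ ∂μ ≤
        ∫ ω, (‖macroState (Z 0 ω) - x 0‖
          + ∑ m, ∑ i, ∑ j, |driftError τ τt ηT ηG Λ Λt Z l m i j ω|
          + 1 / n * ∑ p ∈ Finset.range l, K * ‖macroState (Z p ω) - x (p / n)‖
          + l * (K * B * (1 / n) ^ 2)) ∂μ := by
      refine integral_mono_ae (h.integrable_norm_sub l _) (i012.add (integrable_const _)) ?_
      filter_upwards [hgood] with ω hω using norm_macroState_sub_le hgK hgB hg hx hω l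
    rw [integral_add i012 (integrable_const _), integral_add i01 i2', integral_add i0 i1',
      integral_const_mul, integral_finsetSum _ fun p _ => i2 p] at hmono
    simp only [integral_const_mul, integral_const, probReal_univ, one_smul] at hmono
    have hdrift : ∫ ω, ∑ m, ∑ i, ∑ j, |driftError τ τt ηT ηG Λ Λt Z l m i j ω| ∂μ ≤
        4 * (d * (d * (Real.sqrt (T * A) + T * A))) / Real.sqrt n := by
      rw [integral_finsetSum _ fun m _ => integrable_finsetSum _ fun i _ =>
        integrable_finsetSum _ fun j _ => i1 m i j]
      calc _ ≤ ∑ _m : Fin 4, ∑ _i : Fin d, ∑ _j : Fin d,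
              (Real.sqrt (T * A) + T * A) / Real.sqrt n := by
            refine Finset.sum_le_sum fun m _ => ?_
            rw [integral_finsetSum _ fun i _ => integrable_finsetSum _ fun j _ => i1 m i j]
            refine Finset.sum_le_sum fun i _ => ?_
            rw [integral_finsetSum _ fun j _ => i1 m i j]
            exact Finset.sum_le_sum fun j _ => hcoord l hl m i j
        _ = _ := by
            simp only [Finset.sum_const, Finset.card_univ, Fintype.card_fin, nsmul_eq_mul]
            push_cast
            ring
    have heuler : (l : ℝ) * (K * B * (1 / n) ^ 2) ≤ T * (K * B) / Real.sqrt n := by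
      calc (l : ℝ) * (K * B * (1 / n) ^ 2) ≤ n * T * (K * B * (1 / n) ^ 2) := by gcongr
        _ = T * (K * B) / n := by field_simp
        _ ≤ _ := by gcongr
    have hsum : c / Real.sqrt n = C₀ / Real.sqrt n
        + 4 * (d * (d * (Real.sqrt (T * A) + T * A))) / Real.sqrt n
        + T * (K * B) / Real.sqrt n := by
      rw [hc, add_div, add_div]
    rw [← Finset.mul_sum, ← mul_assoc, one_div_mul_eq_div] at hmono
    linarith
  refine (discrete_gronwall_sum (by positivity) hrec (by positivity) k le_rfl).trans ?_
  rw [mul_div_right_comm]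
  refine mul_le_mul_of_nonneg_left (Real.exp_le_exp.2 ?_) (by positivity)
  rw [div_mul_eq_mul_div, mul_div_assoc]
  refine mul_le_mul_of_nonneg_left ?_ K.2
  rw [div_le_iff₀ hn0, mul_comm]
  exact hk

end Comparison

/-! ### The macroscopic matrix and its blocks -/

section Blocks

variable {n d : ℕ}

/-- The `3d × 3d` matrix of a macroscopic state, with `Z = 1`. -/
def toBlocks (x : Macro d) : Matrix (MacroIdx d) (MacroIdx d) ℝ :=
  blocks (Matrix.of (x 0)) (Matrix.of (x 1)) (Matrix.of (x 2)) (Matrix.of (x 3)) 1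

/-- The blocks `(P, Q, R, S)` of a `3d × 3d` matrix. -/
def ofBlocks (M : Matrix (MacroIdx d) (MacroIdx d) ℝ) : Macro d
  | 0 => fun i j => M (.inl i) (.inr (.inl j))
  | 1 => fun i j => M (.inl i) (.inr (.inr j))
  | 2 => fun i j => M (.inr (.inl i)) (.inr (.inr j))
  | 3 => fun i j => M (.inr (.inl i)) (.inr (.inl j))

theorem ofBlocks_blocks (P Q R S Z : Matrix (Fin d) (Fin d) ℝ) :
    ofBlocks (blocks P Q R S Z) = ![P, Q, R, S] := by
  funext m
  fin_cases m <;> rfl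

theorem ofBlocks_toBlocks (x : Macro d) : ofBlocks (toBlocks x) = x := by
  rw [toBlocks, ofBlocks_blocks]
  funext m
  fin_cases m <;> rfl

theorem macro3_eq_toBlocks {s : State n d} (hs : s ∈ goodSet n d) :
    macro3 s.1 s.2.1 s.2.2 = toBlocks (macroState s) := by
  rw [macro3_eq_blocks _ _ _ hs.1, show s.2.2ᵀ * s.2.2 = 1 from hs.2.2]
  rfl

theorem abs_apply_le_frobNorm {k l : Type*} [Fintype k] [Fintype l] (A : Matrix k l ℝ) (i : k)
    (j : l) : |A i j| ≤ frobNorm A := by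
  rw [← norm_eq_frobNorm]
  exact abs_apply_le_norm A i j

theorem norm_ofBlocks_sub_le (M N : Matrix (MacroIdx d) (MacroIdx d) ℝ) :
    ‖ofBlocks M - ofBlocks N‖ ≤ frobNorm (M - N) := by
  have h0 := frobNorm_nonneg (M - N)
  refine (pi_norm_le_iff_of_nonneg h0).2 fun m => (pi_norm_le_iff_of_nonneg h0).2 fun i =>
    (pi_norm_le_iff_of_nonneg h0).2 fun j => ?_
  fin_cases m <;> exact abs_apply_le_frobNorm (M - N) _ _

theorem abs_toBlocks_sub_le (x y : Macro d) (a b : MacroIdx d) :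
    |toBlocks x a b - toBlocks y a b| ≤ ‖x - y‖ := by
  have h : ∀ m i j, |x m i j - y m i j| ≤ ‖x - y‖ := fun m i j =>
    ((norm_le_pi_norm ((x - y) m i) j).trans (norm_le_pi_norm ((x - y) m) i)).trans
      (norm_le_pi_norm (x - y) m)
  rcases a with i | i | i <;> rcases b with j | j | j <;>
    simp [toBlocks, blocks, h]

theorem frobNorm_toBlocks_sub_le (x y : Macro d) :
    frobNorm (toBlocks x - toBlocks y) ≤ 3 * d * ‖x - y‖ := by
  rw [frobNorm]
  refine Real.sqrt_le_iff.2 ⟨by positivity, ?_⟩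
  calc ∑ a, ∑ b, (toBlocks x - toBlocks y) a b ^ 2
      ≤ ∑ _a : MacroIdx d, ∑ _b : MacroIdx d, ‖x - y‖ ^ 2 :=
        Finset.sum_le_sum fun a _ => Finset.sum_le_sum fun b _ =>
          sq_le_sq' (abs_le.1 (abs_toBlocks_sub_le x y a b)).1
            (abs_le.1 (abs_toBlocks_sub_le x y a b)).2
    _ = (3 * d * ‖x - y‖) ^ 2 := by
        simp only [Finset.sum_const, Finset.card_univ, Fintype.card_sum, Fintype.card_fin,
          nsmul_eq_mul]
        push_cast
        ring

theorem measurable_frobNorm {k l : Type*} [Fintype k] [Fintype l] :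
    Measurable (frobNorm : Matrix k l ℝ → ℝ) := by
  unfold frobNorm
  refine (Finset.measurable_sum _ fun i _ => Finset.measurable_sum _ fun j _ => ?_).sqrt
  exact ((measurable_pi_apply j).comp (measurable_pi_apply i)).pow_const 2

theorem measurable_macro3 :
    Measurable fun s : State n d => macro3 s.1 s.2.1 s.2.2 := by
  refine measurable_pi_lambda _ fun a => measurable_pi_lambda _ fun b => ?_
  rcases a with i | i | i <;> rcases b with j | j | j <;>
    simp only [macro3, micro, Matrix.mul_apply, Matrix.transpose_apply, Matrix.fromCols_apply_inl,
      Matrix.fromCols_apply_inr] <;>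
    exact Continuous.measurable (by fun_prop)

variable {τ τt ηT ηG : ℝ} {Λ Λt : Matrix (Fin d) (Fin d) ℝ}

/-- The solutions of the vector equation give solutions of the macroscopic equation. -/
theorem IsFlowLine.isMacroSolution {x : ℝ → Macro d}
    (hx : IsFlowLine (driftField τ τt ηT ηG Λ Λt) x) :
    IsMacroSolution τ τt ηT ηG Λ Λt (toBlocks (x 0)) fun t => toBlocks (x t) := by
  have h : ∀ (m : Fin 4) (t : ℝ), 0 ≤ t → ∀ i j, HasDerivWithinAt (fun s => x s m i j)
      (driftField τ τt ηT ηG Λ Λt (x t) m i j) (Set.Ici 0) t := fun m t ht i j =>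
    hasDerivWithinAt_pi.1 (hasDerivWithinAt_pi.1 (hasDerivWithinAt_pi.1 (hx t ht) m) i) j
  exact ⟨rfl, fun t => Matrix.of (x t 0), fun t => Matrix.of (x t 1), fun t => Matrix.of (x t 2),
    fun t => Matrix.of (x t 3), fun _ => 1, fun t _ => rfl, h 0, h 1, h 2, h 3,
    fun t _ i j => hasDerivWithinAt_const _ _ _⟩

/-- All solutions of the macroscopic equation with `Z = 1` at time `0` come from the vector
equation. -/
theorem IsMacroSolution.exists_isFlowLine {x₀ : Macro d}
    {M : ℝ → Matrix (MacroIdx d) (MacroIdx d) ℝ}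
    (hM : IsMacroSolution τ τt ηT ηG Λ Λt (toBlocks x₀) M) :
    ∃ x : ℝ → Macro d, x 0 = x₀ ∧ IsFlowLine (driftField τ τt ηT ηG Λ Λt) x ∧
      ∀ t, 0 ≤ t → M t = toBlocks (x t) := by
  obtain ⟨h0, P, Q, R, S, Z, hb, hP, hQ, hR, hS, hZ⟩ := hM
  have h00 : blocks (P 0) (Q 0) (R 0) (S 0) (Z 0) = toBlocks x₀ := by rw [← hb 0 le_rfl, h0]
  have hZ1 : ∀ t, 0 ≤ t → Z t = 1 := fun t ht => by
    have hZ0 : Z 0 = 1 := by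
      ext i j
      exact congrFun (congrFun h00 (.inr (.inr i))) (.inr (.inr j))
    rw [← hZ0]
    ext i j
    exact IsFlowLine.eq_of_contDiff (f := fun _ : ℝ => (0 : ℝ)) contDiff_const
      (x := fun s => Z s i j) (y := fun _ => Z 0 i j) (fun s hs => hZ s hs i j)
      (fun s _ => hasDerivWithinAt_const _ _ _) rfl ht
  refine ⟨fun t => ![P t, Q t, R t, S t], ?_, fun t ht => ?_, fun t ht => ?_⟩
  · rw [← ofBlocks_toBlocks x₀, ← h00, ofBlocks_blocks]
    rfl
  · refine hasDerivWithinAt_pi.2 fun m => hasDerivWithinAt_pi.2 fun i =>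
      hasDerivWithinAt_pi.2 fun j => ?_
    fin_cases m
    · exact hP t ht i j
    · exact hQ t ht i j
    · exact hR t ht i j
    · exact hS t ht i j
  · rw [hb t ht, hZ1 t ht]
    rfl

end Blocks

/-! ### Convergence -/

section Convergence

variable {n d : ℕ} {τ τt ηT ηG : ℝ} {ν νt : Measure (Fin d → ℝ)}
  {Λ Λt : Matrix (Fin d) (Fin d) ℝ}

section Model

variable {Ω : Type*} [MeasurableSpace Ω] {μ : Measure Ω}
  {πV πW : Matrix (Fin n) (Fin d) ℝ → Matrix (Fin n) (Fin d) ℝ}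
  {U V0 W0 : Ω → Matrix (Fin n) (Fin d) ℝ} {c ct : ℕ → Ω → Fin d → ℝ} {a b : ℕ → Ω → Fin n → ℝ}
  {C₀ : ℝ} {M0 : Matrix (MacroIdx d) (MacroIdx d) ℝ}

theorem IsInit.good (hi : IsInit μ C₀ M0 U V0 W0) :
    ∀ᵐ ω ∂μ, (U ω, V0 ω, W0 ω) ∈ goodSet n d := by
  filter_upwards [hi.orth, hi.gen, hi.disc] with ω h1 h2 h3 using ⟨h1, h2, h3⟩

theorem IsNoise.isRun (hN : IsNoise μ ν νt U V0 W0 c ct a b) (hi : IsInit μ C₀ M0 U V0 W0)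
    (hV : IsProjection (genSet n d) πV) (hW : IsProjection (discSet n d) πW) :
    IsRun μ τ τt ηT ηG ν νt πV πW
      (fun k ω => (U ω, train τ τt ηT ηG πV πW (U ω) (V0 ω) (W0 ω)
        (fun j => c j ω) (fun j => ct j ω) (fun j => a j ω) (fun j => b j ω) k))
      (fun k ω => (c k ω, ct k ω, a k ω, b k ω)) where
  projV := hV
  projW := hW
  measurable_zero := hN.meas_init
  measurable_noise := hN.meas_noise
  law := hN.law
  indep := hN.indep_time
  indep_zero := hN.indep_init
  succ _ _ := train_succ _ _ _ _ _ _ _ _ _ _ _ _ _ _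
  good_zero := hi.good

theorem integrable_frobNorm_macro3_sub [IsProbabilityMeasure μ] {Z : Ω → State n d}
    (hZ : Measurable Z) (hgood : ∀ᵐ ω ∂μ, Z ω ∈ goodSet n d)
    (N : Matrix (MacroIdx d) (MacroIdx d) ℝ) :
    Integrable (fun ω => frobNorm (macro3 (Z ω).1 (Z ω).2.1 (Z ω).2.2 - N)) μ := by
  have hm : Measurable fun ω => frobNorm (macro3 (Z ω).1 (Z ω).2.1 (Z ω).2.2 - N) := by
    have h1 := measurable_macro3.comp hZ
    refine measurable_frobNorm.comp (measurable_pi_lambda _ fun i => measurable_pi_lambda _ fun j =>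
      ?_)
    exact ((measurable_pi_apply j).comp ((measurable_pi_apply i).comp h1)).sub_const _
  refine Integrable.of_bound hm.aestronglyMeasurable
    (3 * d * 1 + frobNorm (toBlocks (0 : Macro d) - N)) ?_
  filter_upwards [hgood] with ω hω
  rw [Real.norm_of_nonneg (frobNorm_nonneg _), macro3_eq_toBlocks hω]
  have h1 : toBlocks (macroState (Z ω)) - N =
      (toBlocks (macroState (Z ω)) - toBlocks 0) + (toBlocks (0 : Macro d) - N) := by abel
  have h2 : ∀ A B : Matrix (MacroIdx d) (MacroIdx d) ℝ,
      frobNorm (A + B) ≤ frobNorm A + frobNorm B := fun A B => by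
    let _ := Matrix.frobeniusNormedAddCommGroup (m := MacroIdx d) (n := MacroIdx d) (α := ℝ)
    simp only [← norm_eq_frobNorm]
    exact norm_add_le _ _
  rw [h1]
  refine (h2 _ _).trans (add_le_add_left ((frobNorm_toBlocks_sub_le _ _).trans ?_) _)
  rw [sub_zero]
  exact mul_le_mul_of_nonneg_left (norm_macroState_le_one hω) (by positivity)

/-- The initial macroscopic state is close to `M0`, hence `M0` is close to a matrix with the block
structure of the macroscopic states. -/
theorem IsInit.abs_sub_toBlocks_le [IsProbabilityMeasure μ] (hi : IsInit μ C₀ M0 U V0 W0)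
    (hm : Measurable fun ω => (U ω, V0 ω, W0 ω)) (i j : MacroIdx d) :
    |M0 i j - toBlocks (ofBlocks M0) i j| ≤ 2 * (C₀ / Real.sqrt n) := by
  have hint := integrable_frobNorm_macro3_sub hm hi.good M0
  have h1 : ∀ᵐ ω ∂μ, |M0 i j - toBlocks (ofBlocks M0) i j| ≤
      2 * frobNorm (macro3 (U ω) (V0 ω) (W0 ω) - M0) := by
    filter_upwards [hi.good] with ω hω
    have e := macro3_eq_toBlocks hω
    set X := macro3 (U ω) (V0 ω) (W0 ω)
    have e' : toBlocks (ofBlocks X) = X := by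
      rw [e, ofBlocks_toBlocks]
    have h2 := abs_apply_le_frobNorm (X - M0) i j
    have h3 := (abs_toBlocks_sub_le (ofBlocks X) (ofBlocks M0) i j).trans
      (norm_ofBlocks_sub_le X M0)
    rw [e'] at h3
    rw [Matrix.sub_apply] at h2
    rw [abs_le] at h2 h3 ⊢
    constructor <;> linarith [h2.1, h2.2, h3.1, h3.2]
  have h2 := integral_mono_ae (integrable_const _) (hint.const_mul 2) h1
  rw [integral_const_mul] at h2
  simp only [integral_const, probReal_univ, one_smul] at h2
  exact h2.trans (mul_le_mul_of_nonneg_left hi.conc zero_le_two)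

theorem IsInit.const_nonneg [IsProbabilityMeasure μ] (hi : IsInit μ C₀ M0 U V0 W0) (hn : 0 < n) :
    0 ≤ C₀ := by
  have h := (integral_nonneg fun ω => frobNorm_nonneg _).trans hi.conc
  have hr : 0 < Real.sqrt n := Real.sqrt_pos.2 (by exact_mod_cast hn)
  by_contra hneg
  exact absurd h (not_le.2 (div_neg_of_neg_of_pos (not_le.1 hneg) hr))

end Model

/-- A limit of macroscopic states of norm at most `1` has norm at most `1`. -/
theorem norm_le_one_of_tendsto {E : Type*} [NormedAddCommGroup E] {x : ℝ → E}
    (hx : ContinuousOn x (Set.Ici 0)) {t : ℝ} (ht : 0 ≤ t) {C : ℝ}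
    (h : ∀ᶠ n : ℕ in Filter.atTop, ∀ k : ℕ, (k : ℝ) ≤ n * t → ‖x (k / n)‖ ≤ 1 + C / Real.sqrt n) :
    ‖x t‖ ≤ 1 := by
  have h1 : Filter.Tendsto (fun n : ℕ => ((⌊t * (n : ℝ)⌋₊ : ℝ) / n)) Filter.atTop (nhds t) :=
    (tendsto_nat_floor_mul_div_atTop ht).comp tendsto_natCast_atTop_atTop
  have h2 : Filter.Tendsto (fun n : ℕ => ((⌊t * (n : ℝ)⌋₊ : ℝ) / n)) Filter.atTop
      (nhdsWithin t (Set.Ici 0)) :=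
    tendsto_nhdsWithin_iff.2 ⟨h1, Filter.Eventually.of_forall fun n => by
      simp only [Set.mem_Ici]; positivity⟩
  have h3 := ((hx t ht).tendsto.comp h2).norm
  have h4 : Filter.Tendsto (fun n : ℕ => 1 + C / Real.sqrt n) Filter.atTop (nhds (1 + 0)) :=
    (Filter.Tendsto.div_atTop tendsto_const_nhds
      (Real.tendsto_sqrt_atTop.comp tendsto_natCast_atTop_atTop)).const_add 1
  rw [add_zero] at h4
  refine le_of_tendsto_of_tendsto h3 h4 ?_
  filter_upwards [h] with n hn
  refine hn _ ?_
  rw [mul_comm]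
  exact Nat.floor_le (by positivity)

end Convergence

end GAN

theorem theorem1 {d : ℕ} (τ τt ηT ηG : ℝ) (hτ : 0 < τ) (hτt : 0 < τt) (hηT : 0 ≤ ηT) (hηG : 0 ≤ ηG)
    (Λ Λt : Matrix (Fin d) (Fin d) ℝ) (ν νt : Measure (Fin d → ℝ))
    (hν : GAN.IsCentredLaw ν Λ) (hνt : GAN.IsCentredLaw νt Λt)
    (Ω : ℕ → Type*) [∀ n, MeasurableSpace (Ω n)] (μ : ∀ n, Measure (Ω n))
    [∀ n, IsProbabilityMeasure (μ n)]
    (U V0 W0 : ∀ n, Ω n → Matrix (Fin n) (Fin d) ℝ)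
    (c ct : ∀ n, ℕ → Ω n → Fin d → ℝ) (a b : ∀ n, ℕ → Ω n → Fin n → ℝ)
    (πV πW : ∀ n, Matrix (Fin n) (Fin d) ℝ → Matrix (Fin n) (Fin d) ℝ)
    (C₀ : ℝ) (M0 : Matrix (GAN.MacroIdx d) (GAN.MacroIdx d) ℝ)
    (hnoise : ∀ n, d ≤ n →
      GAN.IsNoise (μ n) ν νt (U n) (V0 n) (W0 n) (c n) (ct n) (a n) (b n))
    (hinit : ∀ n, d ≤ n → GAN.IsInit (μ n) C₀ M0 (U n) (V0 n) (W0 n))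
    (hπV : ∀ n, d ≤ n → GAN.IsProjection (GAN.genSet n d) (πV n))
    (hπW : ∀ n, d ≤ n → GAN.IsProjection (GAN.discSet n d) (πW n)) :
    ∃ M : ℝ → Matrix (GAN.MacroIdx d) (GAN.MacroIdx d) ℝ,
      GAN.IsMacroSolution τ τt ηT ηG Λ Λt M0 M ∧
      (∀ M' : ℝ → Matrix (GAN.MacroIdx d) (GAN.MacroIdx d) ℝ,
        GAN.IsMacroSolution τ τt ηT ηG Λ Λt M0 M' → ∀ t : ℝ, 0 ≤ t → M' t = M t) ∧
      ∀ T : ℝ, 0 < T → ∃ C : ℝ, ∀ n : ℕ, d ≤ n → ∀ k : ℕ, (k : ℝ) ≤ n * T →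
        Integrable (fun ω =>
          let X := GAN.train τ τt ηT ηG (πV n) (πW n) (U n ω) (V0 n ω) (W0 n ω)
            (fun j => c n j ω) (fun j => ct n j ω) (fun j => a n j ω) (fun j => b n j ω) k
          GAN.frobNorm (GAN.macro3 (U n ω) X.1 X.2 - M (k / n))) (μ n) ∧
        ∫ ω,
          (let X := GAN.train τ τt ηT ηG (πV n) (πW n) (U n ω) (V0 n ω) (W0 n ω)
            (fun j => c n j ω) (fun j => ct n j ω) (fun j => a n j ω) (fun j => b n j ω) k
          GAN.frobNorm (GAN.macro3 (U n ω) X.1 X.2 - M (k / n))) ∂(μ n) ≤ C / Real.sqrt n := by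
  open GAN in
  have hC₀ : 0 ≤ C₀ := (hinit (d + 1) (by omega)).const_nonneg (by omega)
  let Z : ∀ n, ℕ → Ω n → State n d := fun n k ω =>
    (U n ω, train τ τt ηT ηG (πV n) (πW n) (U n ω) (V0 n ω) (W0 n ω)
      (fun j => c n j ω) (fun j => ct n j ω) (fun j => a n j ω) (fun j => b n j ω) k)
  have hrun : ∀ n, d ≤ n → IsRun (μ n) τ τt ηT ηG ν νt (πV n) (πW n) (Z n)
      (fun k ω => (c n k ω, ct n k ω, a n k ω, b n k ω)) := fun n hn =>
    (hnoise n hn).isRun (hinit n hn) (hπV n hn) (hπW n hn)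
  have hlarge : ∀ᶠ n : ℕ in Filter.atTop, d ≤ n ∧ 0 < n :=
    (Filter.eventually_ge_atTop d).and (Filter.eventually_gt_atTop 0)
  set x₀ : Macro d := ofBlocks M0 with hx₀
  -- `M0` does not depend on `n`, so the error of its block structure is zero
  have hM0 : M0 = toBlocks x₀ := by
    ext i j
    have hlim : Filter.Tendsto (fun n : ℕ => 2 * (C₀ / Real.sqrt n)) Filter.atTop
        (nhds (2 * 0)) :=
      (Filter.Tendsto.div_atTop tendsto_const_nhds
        (Real.tendsto_sqrt_atTop.comp tendsto_natCast_atTop_atTop)).const_mul 2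
    rw [mul_zero] at hlim
    have h := ge_of_tendsto hlim (hlarge.mono fun n hn =>
      (hinit n hn.1).abs_sub_toBlocks_le (hnoise n hn.1).meas_init i j)
    exact sub_eq_zero.1 (abs_nonpos_iff.1 h)
  have hstart : ∀ n, d ≤ n → ∫ ω, ‖macroState (Z n 0 ω) - x₀‖ ∂(μ n) ≤ C₀ / Real.sqrt n :=
    fun n hn => by
    refine le_trans (integral_mono_ae ((hrun n hn).integrable_norm_sub 0 x₀)
      (integrable_frobNorm_macro3_sub (hrun n hn).measurable_zero ((hrun n hn).good 0) M0) ?_)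
      (hinit n hn).conc
    filter_upwards [(hrun n hn).good 0] with ω hω
    have h := norm_ofBlocks_sub_le (toBlocks (macroState (Z n 0 ω))) M0
    rw [ofBlocks_toBlocks] at h
    rw [macro3_eq_toBlocks hω]
    exact h
  obtain ⟨g, K, B, hgK, hgB, hg⟩ := exists_lipschitz_eqOn_closedBall
    (contDiff_driftField τ τt ηT ηG Λ Λt) one_pos
  obtain ⟨x, hx0, hxg⟩ := exists_isFlowLine_of_lipschitzWith hgK hgB x₀
  have hconv : ∀ T : ℝ, 0 ≤ T → ∃ C : ℝ, 0 ≤ C ∧ ∀ n, d ≤ n → 0 < n → ∀ k : ℕ, (k : ℝ) ≤ n * T →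
      ∫ ω, ‖macroState (Z n k ω) - x (k / n)‖ ∂(μ n) ≤ C / Real.sqrt n := fun T hT => by
    obtain ⟨C, hC0, hC⟩ := exists_integral_macroState_sub_le hν hνt hτ.le hτt.le hηT hηG hgK hgB hg
      hxg hC₀ hT
    exact ⟨C, hC0, fun n hdn hn k hk => hC n hn (μ n) (πV n) (πW n) (Z n) _ (hrun n hdn)
      (by rw [hx0]; exact hstart n hdn) k hk⟩
  -- the limit inherits the bound of the macroscopic states, so the truncation of the drift
  -- is never active
  have hx1 : ∀ t : ℝ, 0 ≤ t → ‖x t‖ ≤ 1 := fun t ht => by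
    obtain ⟨C, -, hC⟩ := hconv t ht
    refine norm_le_one_of_tendsto hxg.continuousOn ht (C := C) ?_
    filter_upwards [hlarge] with n hn k hk
    have h1 : ∀ᵐ ω ∂(μ n), ‖x (k / n)‖ ≤ 1 + ‖macroState (Z n k ω) - x (k / n)‖ := by
      filter_upwards [(hrun n hn.1).good k] with ω hω
      have h2 := norm_sub_norm_le (x (k / n)) (macroState (Z n k ω))
      rw [norm_sub_rev] at h2
      linarith [norm_macroState_le_one hω]
    have hi := (hrun n hn.1).integrable_norm_sub k (x (k / n))
    have h3 := integral_mono_ae (integrable_const _) ((integrable_const 1).add hi) h1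
    simp only [Pi.add_apply] at h3
    rw [integral_add (integrable_const 1) hi] at h3
    simp only [integral_const, probReal_univ, one_smul] at h3
    linarith [hC n hn.1 hn.2 k hk]
  have hflow : IsFlowLine (driftField τ τt ηT ηG Λ Λt) x := fun t ht => by
    rw [← hg _ (by simpa using hx1 t ht)]
    exact hxg t ht
  refine ⟨fun t => toBlocks (x t), ?_, fun M' hM' t ht => ?_, fun T hT => ?_⟩
  · rw [hM0, ← hx0]
    exact hflow.isMacroSolution
  · rw [hM0] at hM'
    obtain ⟨y, hy0, hy, hyM⟩ := hM'.exists_isFlowLine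
    rw [hyM t ht, hy.eq_of_contDiff (contDiff_driftField τ τt ηT ηG Λ Λt) hflow
      (hy0.trans hx0.symm) ht]
  · obtain ⟨C, hC0, hC⟩ := hconv T hT.le
    refine ⟨3 * d * C, fun n hdn k hk => ?_⟩
    have hmeas := ((hrun n hdn).measurable_and_indep k).1
    have hgood := (hrun n hdn).good k
    have hint := integrable_frobNorm_macro3_sub hmeas hgood (toBlocks (x (k / n)))
    refine ⟨hint, ?_⟩
    have hi := (hrun n hdn).integrable_norm_sub k (x (k / n))
    have h1 := integral_mono_ae hint (hi.const_mul (3 * d)) (by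
      filter_upwards [hgood] with ω hω
      rw [macro3_eq_toBlocks hω]
      exact frobNorm_toBlocks_sub_le _ _)
    rw [integral_const_mul] at h1
    refine h1.trans ?_
    rcases Nat.eq_zero_or_pos n with rfl | hn
    · -- here `d = 0`, and both sides vanish
      simp [Nat.le_zero.1 hdn]
    · rw [mul_div_assoc]
      exact mul_le_mul_of_nonneg_left (hC n hdn hn k hk) (by positivity)
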